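/- **Theorem 4.3.** Fix a dimension $d\ge 1$ and $1<p<\infty$, and let $1/p'=1-1/p$. There is a constant $C$, depending only on $d$ and $p$, such that the following holds. *Setting.* Cubes are half-open and axis-parallel, and $\ell(Q)$, $|Q|$ denote side length and Lebesgue measure. Let $\mathcal D$ be a dyadic grid in $\mathbb R^d$: a collection of cubes with side lengths $\delta 2^k$, $k\in\mathbb Z$ (for some $\delta>0$), such that for each $k$ the cubes of side $\delta2^k$ partition $\mathbb R^d$, and each cube is the union of its children, the cubes of $\mathcal D$ of half its side length that it contains. A *generalized Haar function* on $Q\in\mathcal D$ is a complex linear combination of the indicators of the children of $Q$. Let $\mathbb S=\sum_{Q\in\mathcal D}\mathbb S_Q$ be a *generalized Haar shift* of complexity type $(m,n)\in\mathbb Z_+^2$: for a locally finite measure $\sigma$ and $f\in L^p(\sigma)$, $$\mathbb S_Q(f\sigma)(x)=\sum_{\substack{Q',R'\in\mathcal D;\ Q',R'\subset Q\\ \ell(Q')=2^{-m}\ell(Q),\ \ell(R')=2^{-n}\ell(Q)}}\frac{1}{|Q|}\Big(\int f\,h^{Q'}_{R'}\,d\sigma\Big)k^{R'}_{Q'}(x)=\frac1{|Q|}\int_Q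 s_Q(x,y)f(y)\,\sigma(dy),$$ where $h^{Q'}_{R'}$ and $k^{R'}_{Q'}$ are generalized Haar functions on $R'$ and $Q'$ of sup norm at most $1$. Its *complexity* is $\kappa=\max(m,n,1)$. Its truncations and maximal truncations are $$\mathbb S_{\epsilon,\upsilon}(f\sigma)=\sum_{Q\in\mathcal D:\ \epsilon\le\ell(Q)\le\upsilon}\mathbb S_Q(f\sigma),\qquad \mathbb S_\natural(f\sigma)(x)=\sup_{0<\epsilon\le\upsilon<\infty}|\mathbb S_{\epsilon,\upsilon}(f\sigma)(x)|.$$ A *linearization* $\mathbb L$ of $\mathbb S_\natural$ is given by measurable functions $\epsilon(x),\upsilon(x)\in(0,\infty)$ and $\vartheta(x)\in[0,2\pi)$, as $\mathbb Lf(x)=e^{i\vartheta(x)}\mathbb S_{\epsilon(x),\upsilon(x)}f(x)$. Its adjoint is $$\mathbb L^*\nu(y)=\sum_{Q\in\mathcal D}\frac1{|Q|}\int_Q s_Q(x,y)\mathbf 1_{\{\epsilon(x)\le\ell(Q)\le\upsilon(x)\}}e^{i\vartheta(x)}\,\nu(dx),$$ considered for linearizations for which $\epsilon(\cdot)$ is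 bounded below by a positive constant and $\upsilon(\cdot)$ is bounded above, so that the sum is finite at each $y$. *Statement.* Let $\sigma,w$ be arbitrary weights, that is, locally finite non-negative Borel measures on $\mathbb R^d$. Let $\mathfrak M_p,\mathfrak T_p\in[0,\infty]$ be the best constants in $$\|M(f\sigma)\|_{L^p(w)}\le\mathfrak M_p\|f\|_{L^p(\sigma)},\qquad \int_Q\mathbb S_\natural(\mathbf 1_Qf\sigma)\,dw\le\mathfrak T_p\|f\|_{L^p(\sigma)}w(Q)^{1/p'},$$ for all $f\in L^p(\sigma)$ and all $Q\in\mathcal D$, where $M(f\sigma)(x)=\sup_{Q\ni x}|Q|^{-1}\int_Q|f|\,d\sigma$ is the Hardy–Littlewood maximal function, over all cubes $Q$ in $\mathbb R^d$ that contain $x$. Let $\mathfrak N_p\in[0,\infty]$ be given by $$\mathfrak N_p^p=\sup_{\mathbb L}\ \sup_{\|\varphi\|_\infty\le1}\ \sup_{Q_0\in\mathcal D}\frac1{\sigma(Q_0)}\int_{Q_0}\sup_{Q\in\mathcal D,\,Q\subset Q_0}\mathbf 1_Q(x)\Big(\frac1{w(Q)}\int_Q|\mathbb L^*(\mathbf 1_Q\varphi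 w)(y)|\,\sigma(dy)\Big)^p w(dx),$$ where $\varphi$ is complex-valued and measurable and $0/0=0$. Then, for all $f\in L^p(\sigma)$, $$\|\mathbb S_\natural(f\sigma)\|_{L^p(w)}\le C\,\{\kappa\,\mathfrak M_p+\mathfrak T_p+\mathfrak N_p\}\,\|f\|_{L^p(\sigma)}.$$ -/

import Mathlib

open MeasureTheory
open scoped ENNReal NNReal

noncomputable section

namespace TwoWeight

/-- A half-open axis-parallel cube `∏ᵢ [aᵢ, aᵢ + ℓ)` in `ℝ^d`. -/
@[ext]
structure Cube (d : ℕ) where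
  /-- The lower corner `a`. -/
  corner : Fin d → ℝ
  /-- The side length `ℓ`. -/
  side : ℝ
  side_pos : 0 < side

namespace Cube

variable {d : ℕ}

/-- The set of points of the cube. -/
def toSet (Q : Cube d) : Set (Fin d → ℝ) :=
  Set.univ.pi fun i => Set.Ico (Q.corner i) (Q.corner i + Q.side)

/-- The Lebesgue measure `|Q| = ℓ(Q)^d` of the cube, see `volume_toSet`. -/
def vol (Q : Cube d) : ℝ := Q.side ^ d

theorem vol_pos (Q : Cube d) : 0 < Q.vol := pow_pos Q.side_pos d

theorem volume_toSet (Q : Cube d) : volume Q.toSet = ENNReal.ofReal Q.vol := by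
  simp [toSet, vol, Real.volume_pi_Ico, ENNReal.ofReal_pow Q.side_pos.le]

theorem measurableSet_toSet (Q : Cube d) : MeasurableSet Q.toSet :=
  MeasurableSet.univ_pi fun _ => measurableSet_Ico

end Cube

/-- A dyadic grid in `ℝ^d`: a collection of cubes with side lengths `δ 2^k`, `k ∈ ℤ`, such that for
every `k` the cubes of side length `δ 2^k` partition `ℝ^d`, and every cube is the union of its
children, that is, of the cubes of the grid of half its side length that it contains (being
disjoint, these are `2^d` in number). -/
structure DyadicGrid (d : ℕ) where
  /-- The cubes of the grid. -/
  cubes : Set (Cube d)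
  /-- The side length of the cubes of generation `0`. -/
  base : ℝ
  base_pos : 0 < base
  side_eq : ∀ Q ∈ cubes, ∃ k : ℤ, Q.side = base * (2 : ℝ) ^ k
  partition : ∀ (k : ℤ) (x : Fin d → ℝ),
    ∃! Q : Cube d, Q ∈ cubes ∧ Q.side = base * (2 : ℝ) ^ k ∧ x ∈ Q.toSet
  union_children : ∀ Q ∈ cubes,
    Q.toSet = ⋃ Q' ∈ {Q' ∈ cubes | Q'.side = Q.side / 2 ∧ Q'.toSet ⊆ Q.toSet}, Q'.toSet

namespace DyadicGrid

variable {d : ℕ} (D : DyadicGrid d)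

/-- The cubes `Q'` of the grid with `Q' ⊆ Q` and `ℓ(Q') = 2^{-m} ℓ(Q)`. -/
def descendants (m : ℕ) (Q : Cube d) : Set (Cube d) :=
  {Q' | Q' ∈ D.cubes ∧ Q'.side = Q.side / 2 ^ m ∧ Q'.toSet ⊆ Q.toSet}

/-- `h` is a generalized Haar function on the cube `Q`: a linear combination of the indicators of the
children of `Q`, that is, `h` vanishes off `Q` and is constant on every child of `Q`. -/
def IsGenHaarFunction (Q : Cube d) (h : (Fin d → ℝ) → ℂ) : Prop :=
  (∀ x, x ∉ Q.toSet → h x = 0) ∧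
    ∀ Q' ∈ D.descendants 1 Q, ∀ x ∈ Q'.toSet, ∀ y ∈ Q'.toSet, h x = h y

/-- Two cubes of the grid of the same side length that share a point coincide. -/
theorem eq_of_mem {Q R : Cube d} (hQ : Q ∈ D.cubes) (hR : R ∈ D.cubes) (h : Q.side = R.side)
    {x : Fin d → ℝ} (hxQ : x ∈ Q.toSet) (hxR : x ∈ R.toSet) : Q = R := by
  obtain ⟨k, hk⟩ := D.side_eq Q hQ
  exact (D.partition k x).unique ⟨hQ, hk, hxQ⟩ ⟨hR, h ▸ hk, hxR⟩

/-- The finite sums over `descendants` below are really finite. -/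
theorem finite_descendants (m : ℕ) (Q : Cube d) : (D.descendants m Q).Finite := by
  set s : ℝ := (Q.side / 2 ^ m) ^ d with hs
  have hs0 : 0 < s := pow_pos (div_pos Q.side_pos (by positivity)) d
  have hfin : {i : D.descendants m Q | ENNReal.ofReal s ≤ volume i.1.toSet}.Finite := by
    refine Measure.finite_const_le_meas_of_disjoint_iUnion volume (by simpa using hs0)
      (fun i => i.1.measurableSet_toSet) ?_ ?_
    · intro i j hij
      refine Set.disjoint_left.2 fun x hxi hxj => hij ?_
      exact Subtype.ext (D.eq_of_mem i.2.1 j.2.1 (i.2.2.1.trans j.2.2.1.symm) hxi hxj)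
    · refine ne_top_of_le_ne_top ?_ (measure_mono (Set.iUnion_subset fun i => i.2.2.2))
      rw [Q.volume_toSet]
      exact ENNReal.ofReal_ne_top
  have huniv : {i : D.descendants m Q | ENNReal.ofReal s ≤ volume i.1.toSet} = Set.univ := by
    ext i
    have : i.1.vol = s := by rw [Cube.vol, i.2.2.1]
    simp [Cube.volume_toSet, this]
  rw [huniv] at hfin
  exact Set.finite_coe_iff.1 (Set.finite_univ_iff.1 hfin)

end DyadicGrid

/-- A generalized Haar shift of complexity type `(m, n)` on the grid `D`, given by the generalized
Haar functions `h Q' R'` on `R'` and `k R' Q'` on `Q'`, of sup norm at most one, for all cubes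
`Q', R' ⊆ Q` of the grid with `ℓ(Q') = 2^{-m} ℓ(Q)` and `ℓ(R') = 2^{-n} ℓ(Q)`.
(The values of `h` and `k` at other pairs of cubes are never used.) -/
structure GenHaarShift {d : ℕ} (D : DyadicGrid d) (m n : ℕ) where
  h : Cube d → Cube d → (Fin d → ℝ) → ℂ
  k : Cube d → Cube d → (Fin d → ℝ) → ℂ
  h_haar : ∀ Q ∈ D.cubes, ∀ Q' ∈ D.descendants m Q, ∀ R' ∈ D.descendants n Q,
    D.IsGenHaarFunction R' (h Q' R')
  k_haar : ∀ Q ∈ D.cubes, ∀ Q' ∈ D.descendants m Q, ∀ R' ∈ D.descendants n Q,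
    D.IsGenHaarFunction Q' (k R' Q')
  h_le : ∀ Q ∈ D.cubes, ∀ Q' ∈ D.descendants m Q, ∀ R' ∈ D.descendants n Q,
    ∀ x, ‖h Q' R' x‖ ≤ 1
  k_le : ∀ Q ∈ D.cubes, ∀ Q' ∈ D.descendants m Q, ∀ R' ∈ D.descendants n Q,
    ∀ x, ‖k R' Q' x‖ ≤ 1

/-- The complexity `κ = max(m, n, 1)` of a shift of complexity type `(m, n)`. -/
def complexity (m n : ℕ) : ℕ := max (max m n) 1

/-- A choice of truncation parameters `ε(x), υ(x) ∈ (0, ∞)` and of a phase `ϑ(x) ∈ [0, 2π)`,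
all measurable: the data of a linearization `𝕃 f(x) = e^{iϑ(x)} 𝕊_{ε(x),υ(x)} f(x)` of the maximal
truncations of a shift. (The requirement `𝕃 f ≥ 0` normalizes the phase for one given `f`; it
excludes no choice of the data, as `f = 0` shows.) -/
structure Linearization (d : ℕ) where
  ε : (Fin d → ℝ) → ℝ
  υ : (Fin d → ℝ) → ℝ
  ϑ : (Fin d → ℝ) → ℝ
  ε_measurable : Measurable ε
  υ_measurable : Measurable υ
  ϑ_measurable : Measurable ϑ
  ε_pos : ∀ x, 0 < ε x
  υ_pos : ∀ x, 0 < υ x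
  ϑ_mem : ∀ x, ϑ x ∈ Set.Ico 0 (2 * Real.pi)

/-- The truncation parameters stay in a compact subinterval of `(0, ∞)`, so that only finitely many
scales occur in the linearization, and the formula for its adjoint is a finite sum at every point. -/
def Linearization.IsBounded {d : ℕ} (L : Linearization d) : Prop :=
  ∃ a b : ℝ, 0 < a ∧ ∀ x, a ≤ L.ε x ∧ L.υ x ≤ b

namespace GenHaarShift

variable {d : ℕ} {D : DyadicGrid d} {m n : ℕ} (S : GenHaarShift D m n)

/-- The component `𝕊_Q` applied to the measure `fσ`:
`𝕊_Q(fσ)(x) = ∑_{Q', R'} |Q|⁻¹ (∫ f h^{Q'}_{R'} dσ) k^{R'}_{Q'}(x)`. -/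
def component (Q : Cube d) (σ : Measure (Fin d → ℝ)) (f : (Fin d → ℝ) → ℂ) (x : Fin d → ℝ) : ℂ :=
  ∑ᶠ (Q' ∈ D.descendants m Q) (R' ∈ D.descendants n Q),
    (∫ y, f y * S.h Q' R' y ∂σ) / (Q.vol : ℂ) * S.k R' Q' x

/-- The kernel `s_Q(x, y) = ∑_{Q', R'} h^{Q'}_{R'}(y) k^{R'}_{Q'}(x)`, so that
`𝕊_Q(fσ)(x) = |Q|⁻¹ ∫_Q s_Q(x, y) f(y) σ(dy)`. -/
def kernel (Q : Cube d) (x y : Fin d → ℝ) : ℂ :=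
  ∑ᶠ (Q' ∈ D.descendants m Q) (R' ∈ D.descendants n Q), S.h Q' R' y * S.k R' Q' x

/-- The truncation `𝕊_{ε,υ}(fσ)(x) = ∑_{Q : ε ≤ ℓ(Q) ≤ υ} 𝕊_Q(fσ)(x)`. For `ε > 0` only the
finitely many cubes `Q` that contain `x` contribute. -/
def truncation (ε υ : ℝ) (σ : Measure (Fin d → ℝ)) (f : (Fin d → ℝ) → ℂ) (x : Fin d → ℝ) : ℂ :=
  ∑ᶠ Q ∈ {Q ∈ D.cubes | ε ≤ Q.side ∧ Q.side ≤ υ}, S.component Q σ f x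

/-- The maximal truncations `𝕊_♮(fσ)(x) = sup_{0 < ε ≤ υ < ∞} |𝕊_{ε,υ}(fσ)(x)|`. -/
def maxTruncation (σ : Measure (Fin d → ℝ)) (f : (Fin d → ℝ) → ℂ) (x : Fin d → ℝ) : ℝ≥0∞ :=
  ⨆ (ε : ℝ) (υ : ℝ) (_ : 0 < ε) (_ : ε ≤ υ), ‖S.truncation ε υ σ f x‖ₑ

/-- The adjoint of a linearization, applied to the measure `φw`:
`𝕃^*(φw)(y) = ∑_Q |Q|⁻¹ ∫_Q s_Q(x, y) 1_{ε(x) ≤ ℓ(Q) ≤ υ(x)} e^{iϑ(x)} φ(x) w(dx)`. -/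
def adjoint (L : Linearization d) (w : Measure (Fin d → ℝ)) (φ : (Fin d → ℝ) → ℂ)
    (y : Fin d → ℝ) : ℂ :=
  ∑ᶠ Q ∈ D.cubes, (Q.vol : ℂ)⁻¹ * ∫ x in Q.toSet, S.kernel Q x y *
    Set.indicator {x | L.ε x ≤ Q.side ∧ Q.side ≤ L.υ x}
      (fun x => Complex.exp (Complex.I * (L.ϑ x : ℂ)) * φ x) x ∂w

/-- The testing constant `𝔗_p`: the best constant in
`∫_Q 𝕊_♮(1_Q fσ) dw ≤ 𝔗_p ‖f‖_{L^p(σ)} w(Q)^{1/p'}`, for all `f ∈ L^p(σ)` and all cubes `Q` of the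
grid, where `1/p' = 1 - 1/p`. -/
def testingConst (p : ℝ) (σ w : Measure (Fin d → ℝ)) : ℝ≥0∞ :=
  sInf {T : ℝ≥0∞ | ∀ Q ∈ D.cubes, ∀ f : (Fin d → ℝ) → ℂ, MemLp f (ENNReal.ofReal p) σ →
    ∫⁻ x in Q.toSet, S.maxTruncation σ (Q.toSet.indicator f) x ∂w ≤
      T * eLpNorm f (ENNReal.ofReal p) σ * w Q.toSet ^ (1 - 1 / p)}

/-- The nonstandard testing constant `𝔑_p`:
`𝔑_p^p = sup_{𝕃, φ, Q₀} σ(Q₀)⁻¹ ∫_{Q₀} sup_{Q ⊆ Q₀} 1_Q(x)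
  (w(Q)⁻¹ ∫_Q |𝕃^*(1_Q φ w)| dσ)^p w(dx)`,
over linearizations `𝕃`, functions `|φ| ≤ 1` and cubes of the grid; a quotient `0 / 0` is `0`. -/
def nonstandardConst (p : ℝ) (σ w : Measure (Fin d → ℝ)) : ℝ≥0∞ :=
  (⨆ (L : Linearization d) (_ : L.IsBounded)
      (φ : (Fin d → ℝ) → ℂ) (_ : Measurable φ) (_ : ∀ x, ‖φ x‖ ≤ 1)
      (Q₀ : Cube d) (_ : Q₀ ∈ D.cubes),
    (σ Q₀.toSet)⁻¹ * ∫⁻ x in Q₀.toSet,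
      (⨆ (Q : Cube d) (_ : Q ∈ D.cubes) (_ : Q.toSet ⊆ Q₀.toSet) (_ : x ∈ Q.toSet),
        ((w Q.toSet)⁻¹ *
          ∫⁻ y in Q.toSet, ‖S.adjoint L w (Q.toSet.indicator φ) y‖ₑ ∂σ) ^ p) ∂w) ^ (1 / p)

end GenHaarShift

/-- The Hardy–Littlewood maximal function of the measure `fσ`:
`M(fσ)(x) = sup_{Q ∋ x} |Q|⁻¹ ∫_Q |f| dσ`, over all cubes `Q` in `ℝ^d` that contain `x`. -/
def maximalFunction {d : ℕ} (σ : Measure (Fin d → ℝ)) (f : (Fin d → ℝ) → ℂ)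
    (x : Fin d → ℝ) : ℝ≥0∞ :=
  ⨆ (Q : Cube d) (_ : x ∈ Q.toSet),
    (ENNReal.ofReal Q.vol)⁻¹ * ∫⁻ y in Q.toSet, ‖f y‖ₑ ∂σ

/-- The two-weight maximal function constant `𝔐_p`: the best constant in
`‖M(fσ)‖_{L^p(w)} ≤ 𝔐_p ‖f‖_{L^p(σ)}`. -/
def maximalConst {d : ℕ} (p : ℝ) (σ w : Measure (Fin d → ℝ)) : ℝ≥0∞ :=
  sInf {A : ℝ≥0∞ | ∀ f : (Fin d → ℝ) → ℂ, MemLp f (ENNReal.ofReal p) σ →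
    eLpNorm (maximalFunction σ f) (ENNReal.ofReal p) w ≤ A * eLpNorm f (ENNReal.ofReal p) σ}

end TwoWeight

end

/-! By monotone convergence it is enough to bound truncations that use only generations from `lo` to
`hi`, with a constant independent of both. Their maximum `Sf` is a finite maximum of functions
constant on small cells, so a bounded linearization `lin` attains it at the given f, with the phase
chosen so that `lin f = Sf`.

Put Ω_k = {Sf > 2^k} and let Q run over its maximal cells of generation at most `hi`. Let E_k be the
set where 2^(k+1) < Sf ≤ 2^(k+2) and (m+n+3) Mf ≤ 2^(k-1); the rest of the level is paid for by the
maximal function, whence the factor κ. For x in E_k ∩ Q, f is split into pieces. Off Q it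
contributes at most 2^k + (m+2) Mf, because the parent of Q contains a point with Sf ≤ 2^k
(`enorm_lin_compl_le`). On the cells of Ω_(k+2) at most n generations below Q it contributes at most
(n+1) Mf (`enorm_lin_shallow_le`). On the deeper cells the kernel seen from x ∉ Ω_(k+2) is constant
on cells n generations below the maximal ones, so f may be replaced by its averages there
(`scalePart_refAvg_eq`). These averages form a bad part, where the maximal averages have more than
doubled since Q, and a good part, bounded by twice the maximal average at Q. Hence at least 2^(k-1)
of Sf(x) comes from `testPart` (f on Ω_k \ Ω_(k+2), plus the bad averages) and `goodPart`
(`enorm_lin_sub_le`).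

Integration over E_k ∩ Q gives `local_estimate`: 𝔗_p controls `testPart`, and duality bounds the
good part by the maximal average at Q times the mass on Q of the adjoint applied to the indicator of
E_k ∩ Q. If w(Q) ≤ K w(E_k ∩ Q), this can be divided by w(E_k ∩ Q)^(1/p') and raised to the power p.
The other cells contribute at most w(Ω_k)/K, which is absorbed into the left side for large K.

Two sums over k remain. The test parts sum to C ∫|f|^p: the sets Ω_k \ Ω_(k+2) overlap at most
twice, and repeated doubling bounds the overlap of the bad sets at a fixed size of the average
(`exists_sum_testPart_le`). The adjoint terms form a Carleson embedding (`exists_tsum_adjAvg_le`).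
Its difficulty is that the adjoint is applied to a different function for each k, while 𝔑_p allows
one φ for all cubes. Orthogonal characters resolve this: the indicator of E_k is an average of
unimodular multiples of the functions φ_i = ∑_l χ_i(l) 1_(E_l), each bounded by one because the E_l
are disjoint, and convexity of t^p passes the estimate to the average. -/

noncomputable section
namespace TwoWeight

/-! ### Cells of the grid, functions constant on cells, and stopping rules. -/

namespace DyadicGrid

variable {d : ℕ} (D : DyadicGrid d)

/-- The cube of side length `δ 2^k` of the grid that contains `x`. -/
def cubeAt (k : ℤ) (x : Fin d → ℝ) : Cube d := (D.partition k x).choose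

theorem cubeAt_mem (k : ℤ) (x : Fin d → ℝ) : D.cubeAt k x ∈ D.cubes :=
  (D.partition k x).choose_spec.1.1

theorem side_cubeAt (k : ℤ) (x : Fin d → ℝ) : (D.cubeAt k x).side = D.base * (2 : ℝ) ^ k :=
  (D.partition k x).choose_spec.1.2.1

/-- The point set of `D.cubeAt k x`. -/
def cell (k : ℤ) (x : Fin d → ℝ) : Set (Fin d → ℝ) := (D.cubeAt k x).toSet

theorem mem_cell_self (k : ℤ) (x : Fin d → ℝ) : x ∈ D.cell k x :=
  (D.partition k x).choose_spec.1.2.2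

variable {D}

theorem eq_cubeAt {Q : Cube d} (hQ : Q ∈ D.cubes) {k : ℤ} (hk : Q.side = D.base * (2 : ℝ) ^ k)
    {x : Fin d → ℝ} (hx : x ∈ Q.toSet) : Q = D.cubeAt k x :=
  D.eq_of_mem hQ (D.cubeAt_mem k x) (hk.trans (D.side_cubeAt k x).symm) hx (D.mem_cell_self k x)

theorem cubeAt_eq_of_mem {k : ℤ} {x y : Fin d → ℝ} (h : y ∈ D.cell k x) :
    D.cubeAt k y = D.cubeAt k x :=
  (eq_cubeAt (D.cubeAt_mem k x) (D.side_cubeAt k x) h).symm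

theorem cell_eq_of_mem {k : ℤ} {x y : Fin d → ℝ} (h : y ∈ D.cell k x) :
    D.cell k y = D.cell k x := by
  rw [cell, cell, cubeAt_eq_of_mem h]

theorem mem_cell_comm {k : ℤ} {x y : Fin d → ℝ} : y ∈ D.cell k x ↔ x ∈ D.cell k y :=
  ⟨fun h => cell_eq_of_mem h ▸ D.mem_cell_self k x,
    fun h => cell_eq_of_mem h ▸ D.mem_cell_self k y⟩

theorem cubeAt_eq_iff {k : ℤ} {x y : Fin d → ℝ} :
    D.cubeAt k y = D.cubeAt k x ↔ y ∈ D.cell k x :=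
  ⟨fun h => by rw [cell, ← h]; exact D.mem_cell_self k y, cubeAt_eq_of_mem⟩

variable (D)

/-- The union-of-children axiom links consecutive generations here; partitions of each generation
alone would not be nested. -/
theorem cell_subset_succ (k : ℤ) (x : Fin d → ℝ) : D.cell k x ⊆ D.cell (k + 1) x := by
  have hx : x ∈ (D.cubeAt (k + 1) x).toSet := D.mem_cell_self (k + 1) x
  rw [D.union_children _ (D.cubeAt_mem (k + 1) x)] at hx
  simp only [Set.mem_iUnion] at hx
  obtain ⟨Q', ⟨hQ', hs, hsub⟩, hxQ⟩ := hx
  have : Q' = D.cubeAt k x := eq_cubeAt hQ' (by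
    rw [hs, side_cubeAt, zpow_add_one₀ two_ne_zero]; ring) hxQ
  rw [cell, ← this]
  exact hsub

theorem cell_mono {k l : ℤ} (h : k ≤ l) (x : Fin d → ℝ) : D.cell k x ⊆ D.cell l x := by
  induction l, h using Int.leInduction with
  | base => exact subset_rfl
  | succ l _ ih => exact ih.trans (D.cell_subset_succ l x)

theorem measurableSet_cell (k : ℤ) (x : Fin d → ℝ) : MeasurableSet (D.cell k x) :=
  Cube.measurableSet_toSet _

variable {D}

/-- Two cells that meet are nested. -/
theorem cell_subset_of_mem {k l : ℤ} (h : k ≤ l) {x y : Fin d → ℝ} (hy : y ∈ D.cell l x) :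
    D.cell k y ⊆ D.cell l x := by
  rw [← cell_eq_of_mem hy]; exact D.cell_mono h y

theorem descendant_eq_cubeAt {j : ℕ} {k : ℤ} {x : Fin d → ℝ} {Q : Cube d}
    (hQ : Q ∈ D.descendants j (D.cubeAt k x)) {y : Fin d → ℝ} (hy : y ∈ Q.toSet) :
    Q = D.cubeAt (k - j) y := by
  refine eq_cubeAt hQ.1 ?_ hy
  rw [hQ.2.1, side_cubeAt, zpow_sub₀ two_ne_zero, zpow_natCast]; ring

theorem cubeAt_mem_descendants {j : ℕ} {k : ℤ} {x y : Fin d → ℝ} (hy : y ∈ D.cell k x) :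
    D.cubeAt (k - j) y ∈ D.descendants j (D.cubeAt k x) := by
  refine ⟨D.cubeAt_mem _ _, ?_, cell_subset_of_mem (k := k - j) (by omega) hy⟩
  rw [side_cubeAt, side_cubeAt, zpow_sub₀ two_ne_zero, zpow_natCast]; ring

variable (D)

/-- Disjoint sets of positive Lebesgue measure in a σ-finite space are countably many. -/
theorem countable_range_cubeAt (k : ℤ) : (Set.range (D.cubeAt k)).Countable := by
  have h := Measure.countable_meas_pos_of_disjoint_iUnion (μ := (volume : Measure (Fin d → ℝ)))
    (As := fun Q : Set.range (D.cubeAt k) => Q.1.toSet)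
    (fun Q => Q.1.measurableSet_toSet) (by
      rintro ⟨_, x, rfl⟩ ⟨_, y, rfl⟩ hxy
      refine Set.disjoint_left.2 fun z hz hz' => hxy (Subtype.ext ?_)
      exact (cubeAt_eq_of_mem hz).symm.trans (cubeAt_eq_of_mem hz'))
  have hu : {Q : Set.range (D.cubeAt k) | 0 < volume Q.1.toSet} = Set.univ := by
    ext Q
    simpa [Cube.volume_toSet] using Q.1.vol_pos
  rw [hu] at h
  exact Set.countable_coe_iff.1 (Set.countable_univ_iff.1 h)

/-- The cells of one generation can be numbered, measurably. -/
theorem exists_index (k : ℤ) : ∃ e : (Fin d → ℝ) → ℕ, Measurable e ∧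
    ∀ x y, e y = e x → y ∈ D.cell k x := by
  have := (D.countable_range_cubeAt k).to_subtype
  obtain ⟨e, he⟩ := exists_injective_nat (Set.range (D.cubeAt k))
  have hinj : ∀ x y, e ⟨_, Set.mem_range_self y⟩ = e ⟨_, Set.mem_range_self x⟩ →
      y ∈ D.cell k x := fun x y h => cubeAt_eq_iff.1 (congrArg Subtype.val (he h))
  refine ⟨fun x => e ⟨_, Set.mem_range_self x⟩, ?_, hinj⟩
  refine measurable_to_countable fun x => ?_
  have : (fun x => e ⟨_, Set.mem_range_self x⟩) ⁻¹' {e ⟨_, Set.mem_range_self x⟩} = D.cell k x := by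
    ext y
    refine ⟨hinj x y, fun hy => ?_⟩
    have := cubeAt_eq_of_mem hy
    simp only [Set.mem_preimage, Set.mem_singleton_iff, this]
  rw [this]
  exact D.measurableSet_cell k x

/-- `F` is constant on the cells of generation `s`. -/
def CellConst {β : Type*} (s : ℤ) (F : (Fin d → ℝ) → β) : Prop :=
  ∀ x y, y ∈ D.cell s x → F y = F x

variable {D}

namespace CellConst

theorem mono {β : Type*} {s t : ℤ} (h : s ≤ t) {F : (Fin d → ℝ) → β} (hF : D.CellConst t F) :
    D.CellConst s F := fun x y hy => hF x y (D.cell_mono h x hy)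

/-- The function factors through the countable index of its cells. This settles most measurability
questions below, including those for choices made cell by cell. -/
theorem measurable {β : Type*} [MeasurableSpace β] {s : ℤ} {F : (Fin d → ℝ) → β}
    (hF : D.CellConst s F) : Measurable F := by
  classical
  obtain ⟨e, he, hinj⟩ := D.exists_index s
  have : F = (fun i : ℕ => if h : ∃ x, e x = i then F h.choose else F 0) ∘ e := by
    funext x
    have h : ∃ y, e y = e x := ⟨x, rfl⟩
    simp only [Function.comp_apply, dif_pos h]
    exact (hF _ _ (hinj _ _ h.choose_spec)).symm
  rw [this]
  exact (measurable_of_countable _).comp he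

theorem measurableSet {s : ℤ} {P : (Fin d → ℝ) → Prop} (hP : D.CellConst s P) :
    MeasurableSet {x | P x} := measurableSet_setOfPred.2 hP.measurable

theorem measurable_prod {β : Type*} [MeasurableSpace β] {s t : ℤ}
    {F : (Fin d → ℝ) → (Fin d → ℝ) → β}
    (h₁ : D.CellConst s F) (h₂ : ∀ x, D.CellConst t (F x)) :
    Measurable (Function.uncurry F) := by
  classical
  obtain ⟨e, he, hinj⟩ := D.exists_index s
  obtain ⟨e', he', hinj'⟩ := D.exists_index t
  let G : ℕ × ℕ → β := fun i =>
    if h : ∃ z : (Fin d → ℝ) × (Fin d → ℝ), e z.1 = i.1 ∧ e' z.2 = i.2 then F h.choose.1 h.choose.2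
    else F 0 0
  have : Function.uncurry F = G ∘ fun z => (e z.1, e' z.2) := by
    funext ⟨x, y⟩
    have h : ∃ z : (Fin d → ℝ) × (Fin d → ℝ), e z.1 = e x ∧ e' z.2 = e' y := ⟨(x, y), rfl, rfl⟩
    simp only [G, Function.comp_apply, dif_pos h, Function.uncurry]
    rw [h₁ _ _ (hinj _ _ h.choose_spec.1), h₂ x _ _ (hinj' _ _ h.choose_spec.2)]
  rw [this]
  exact (measurable_of_countable _).comp
    ((he.comp measurable_fst).prodMk (he'.comp measurable_snd))

end CellConst

variable (D)

/-- The Lebesgue measure of the cells of generation `k`. -/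
def cellVol (k : ℤ) : ℝ≥0∞ := ENNReal.ofReal ((D.base * (2 : ℝ) ^ k) ^ d)

theorem vol_cubeAt (k : ℤ) (x : Fin d → ℝ) : (D.cubeAt k x).vol = (D.base * (2 : ℝ) ^ k) ^ d := by
  rw [Cube.vol, side_cubeAt]

theorem ofReal_vol_cubeAt (k : ℤ) (x : Fin d → ℝ) :
    ENNReal.ofReal (D.cubeAt k x).vol = D.cellVol k := by
  rw [vol_cubeAt, cellVol]

theorem cellVol_ne_zero (k : ℤ) : D.cellVol k ≠ 0 := by
  have := D.base_pos
  simp only [cellVol, ne_eq, ENNReal.ofReal_eq_zero, not_le]; positivity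

/-- Positivity of the dimension matters here: volumes at least double per generation, which makes
the sums over large scales geometric. Using 2 in place of 2^d keeps the constants free of d. -/
theorem inv_cellVol_add_le (hd : 0 < d) (k : ℤ) (i : ℕ) :
    (D.cellVol (k + i))⁻¹ ≤ (2⁻¹ : ℝ≥0∞) ^ i * (D.cellVol k)⁻¹ := by
  have hb := D.base_pos
  have h : (2 : ℝ≥0∞) ^ i * D.cellVol k ≤ D.cellVol (k + i) := by
    have h2 : (2 : ℝ≥0∞) ^ i = ENNReal.ofReal (2 ^ i) := by
      rw [ENNReal.ofReal_pow (by norm_num)]; norm_num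
    rw [h2, cellVol, cellVol, ← ENNReal.ofReal_mul (by positivity)]
    refine ENNReal.ofReal_le_ofReal ?_
    have : (D.base * (2 : ℝ) ^ (k + i)) ^ d = (2 ^ i) ^ d * (D.base * (2 : ℝ) ^ k) ^ d := by
      rw [zpow_add₀ two_ne_zero, zpow_natCast, ← mul_pow]; ring
    rw [this]
    refine mul_le_mul_of_nonneg_right ?_ (by positivity)
    exact le_self_pow₀ (one_le_pow₀ (by norm_num)) hd.ne'
  rw [← ENNReal.inv_pow, ← ENNReal.mul_inv (by simp) (by simp)]
  exact ENNReal.inv_le_inv.2 h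

theorem isBounded_toSet (Q : Cube d) : Bornology.IsBounded Q.toSet := by
  refine (Metric.isBounded_Icc (Q.corner) (Q.corner + fun _ => Q.side)).subset ?_
  intro x hx
  rw [Cube.toSet, Set.mem_univ_pi] at hx
  exact ⟨fun i => (hx i).1, fun i => (hx i).2.le⟩

theorem measure_toSet_lt_top (μ : Measure (Fin d → ℝ)) [IsLocallyFiniteMeasure μ] (Q : Cube d) :
    μ Q.toSet < ⊤ := (isBounded_toSet Q).measure_lt_top

theorem measure_cell_lt_top (μ : Measure (Fin d → ℝ)) [IsLocallyFiniteMeasure μ] (k : ℤ)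
    (x : Fin d → ℝ) : μ (D.cell k x) < ⊤ := measure_toSet_lt_top μ _

/-- A stopping rule: `τ` chooses, for the points of `U`, the generation of a cell contained in `U`,
consistently on that cell. -/
structure IsStopping (U : Set (Fin d → ℝ)) (τ : (Fin d → ℝ) → ℤ) : Prop where
  subset : ∀ x ∈ U, D.cell (τ x) x ⊆ U
  const : ∀ x ∈ U, ∀ y ∈ D.cell (τ x) x, τ y = τ x

variable {D}

namespace IsStopping

variable {U : Set (Fin d → ℝ)} {τ : (Fin d → ℝ) → ℤ}

theorem countable (U : Set (Fin d → ℝ)) (τ : (Fin d → ℝ) → ℤ) :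
    ((fun x => D.cell (τ x) x) '' U).Countable := by
  have : ((fun x => D.cell (τ x) x) '' U) ⊆ ⋃ k : ℤ, Cube.toSet '' Set.range (D.cubeAt k) := by
    rintro _ ⟨x, -, rfl⟩
    exact Set.mem_iUnion.2 ⟨τ x, _, ⟨x, rfl⟩, rfl⟩
  exact (Set.countable_iUnion fun k => (D.countable_range_cubeAt k).image _).mono this

theorem pairwiseDisjoint (h : D.IsStopping U τ) :
    ((fun x => D.cell (τ x) x) '' U).PairwiseDisjoint id := by
  rintro _ ⟨x, hx, rfl⟩ _ ⟨y, hy, rfl⟩ hxy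
  refine Set.disjoint_left.2 fun z hz hz' => hxy ?_
  have h1 := h.const x hx z hz
  have h2 := h.const y hy z hz'
  have e1 := cell_eq_of_mem (D := D) hz
  have e2 := cell_eq_of_mem (D := D) hz'
  simp only at *
  rw [← e1, ← e2, ← h1, ← h2]

theorem biUnion (h : D.IsStopping U τ) : ⋃ c ∈ (fun x => D.cell (τ x) x) '' U, c = U := by
  refine subset_antisymm (Set.iUnion₂_subset ?_) fun x hx => ?_
  · rintro _ ⟨x, hx, rfl⟩
    exact h.subset x hx
  · exact Set.mem_biUnion ⟨x, hx, rfl⟩ (D.mem_cell_self _ x)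

theorem measurableSet (h : D.IsStopping U τ) : MeasurableSet U := by
  rw [← h.biUnion]
  refine MeasurableSet.biUnion (countable U τ) ?_
  rintro _ ⟨x, -, rfl⟩
  exact D.measurableSet_cell _ _

/-- An inequality between two measures holds on `U` if it holds on all chosen cells. -/
theorem measure_le (h : D.IsStopping U τ) {μ ν : Measure (Fin d → ℝ)}
    (hle : ∀ x ∈ U, μ (D.cell (τ x) x) ≤ ν (D.cell (τ x) x)) : μ U ≤ ν U := by
  have hm : ∀ c ∈ (fun x => D.cell (τ x) x) '' U, MeasurableSet (id c) := by
    rintro _ ⟨x, -, rfl⟩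
    exact D.measurableSet_cell _ _
  rw [← h.biUnion]
  have e1 := measure_biUnion (μ := μ) (countable U τ) h.pairwiseDisjoint hm
  have e2 := measure_biUnion (μ := ν) (countable U τ) h.pairwiseDisjoint hm
  simp only [id] at e1 e2
  rw [e1, e2]
  refine ENNReal.tsum_le_tsum ?_
  rintro ⟨_, x, hx, rfl⟩
  exact hle x hx

/-- Two integrals over `U` agree if they agree on all chosen cells. -/
theorem integral_congr (h : D.IsStopping U τ) {μ : Measure (Fin d → ℝ)} {F G : (Fin d → ℝ) → ℂ}
    (hF : IntegrableOn F U μ) (hG : IntegrableOn G U μ)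
    (heq : ∀ x ∈ U, ∫ y in D.cell (τ x) x, F y ∂μ = ∫ y in D.cell (τ x) x, G y ∂μ) :
    ∫ y in U, F y ∂μ = ∫ y in U, G y ∂μ := by
  have hc := (countable (D := D) U τ).to_subtype
  have hU : ⋃ c : (fun x => D.cell (τ x) x) '' U, (c : Set (Fin d → ℝ)) = U := by
    rw [← Set.biUnion_eq_iUnion (s := (fun x => D.cell (τ x) x) '' U) (t := fun c _ => c)]
    exact h.biUnion
  have hm : ∀ c : (fun x => D.cell (τ x) x) '' U, MeasurableSet (c : Set (Fin d → ℝ)) := by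
    rintro ⟨_, x, -, rfl⟩
    exact D.measurableSet_cell _ _
  have hd : Pairwise (Function.onFun Disjoint
      fun c : (fun x => D.cell (τ x) x) '' U => (c : Set (Fin d → ℝ))) := by
    intro a b hab
    exact h.pairwiseDisjoint a.2 b.2 (fun e => hab (Subtype.ext e))
  rw [← hU] at hF hG ⊢
  rw [integral_iUnion hm hd hF, integral_iUnion hm hd hG]
  refine tsum_congr ?_
  rintro ⟨_, x, hx, rfl⟩
  exact heq x hx

end IsStopping

end DyadicGrid

open DyadicGrid

theorem finsum_mem_eq_single {α M : Type*} [AddCommMonoid M] {s : Set α} {a : α} (ha : a ∈ s)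
    {f : α → M} (hf : ∀ b ∈ s, b ≠ a → f b = 0) : ∑ᶠ b ∈ s, f b = f a := by
  rw [finsum_eq_single _ a fun b hb => ?_, finsum_eq_single _ ha fun h h' => (h' rfl).elim]
  by_cases hbs : b ∈ s
  · rw [finsum_eq_single _ hbs fun h h' => (h' rfl).elim, hf b hbs hb]
  · simp [hbs]

/-- A sum over a family of cubes of terms that vanish unless the cube contains `x` and has one of
the side lengths `δ 2^k`, `a ≤ k ≤ b`. -/
theorem DyadicGrid.finsum_mem_cubes {d : ℕ} {D : DyadicGrid d} {M : Type*} [AddCommMonoid M]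
    {T : Set (Cube d)} (hT : T ⊆ D.cubes) {a b : ℤ} {x : Fin d → ℝ}
    (hmem : ∀ k ∈ Finset.Icc a b, D.cubeAt k x ∈ T) {f : Cube d → M}
    (hf : ∀ Q ∈ T, f Q ≠ 0 → x ∈ Q.toSet ∧
      ∀ k : ℤ, Q.side = D.base * (2 : ℝ) ^ k → k ∈ Finset.Icc a b) :
    ∑ᶠ Q ∈ T, f Q = ∑ k ∈ Finset.Icc a b, f (D.cubeAt k x) := by
  have hinj : Set.InjOn (fun k => D.cubeAt k x) (Finset.Icc a b : Finset ℤ) := by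
    intro k _ l _ h
    have h' := congrArg Cube.side h
    simp only [side_cubeAt] at h'
    have h2 := mul_left_cancel₀ D.base_pos.ne' h'
    exact zpow_right_injective₀ two_pos (by norm_num) h2
  rw [← finsum_mem_coe_finset, ← finsum_mem_image (f := f) hinj]
  refine finsum_mem_inter_support_eq' _ _ _ fun Q hQ => ⟨fun h => ?_, ?_⟩
  · obtain ⟨hx, hk⟩ := hf Q h hQ
    obtain ⟨k, hk'⟩ := D.side_eq Q (hT h)
    exact ⟨k, hk k hk', (eq_cubeAt (hT h) hk' hx).symm⟩
  · rintro ⟨k, hk, rfl⟩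
    exact hmem k hk

/-! ### The shift, one generation at a time. -/

namespace GenHaarShift

variable {d : ℕ} {D : DyadicGrid d} {m n : ℕ} (S : GenHaarShift D m n)

theorem h_eq_zero {k : ℤ} {x y : Fin d → ℝ} {Q' R' : Cube d}
    (hQ : Q' ∈ D.descendants m (D.cubeAt k x)) (hR : R' ∈ D.descendants n (D.cubeAt k x))
    (hy : y ∉ R'.toSet) : S.h Q' R' y = 0 :=
  (S.h_haar _ (D.cubeAt_mem k x) _ hQ _ hR).1 y hy

theorem k_eq_zero {k : ℤ} {x y : Fin d → ℝ} {Q' R' : Cube d}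
    (hQ : Q' ∈ D.descendants m (D.cubeAt k x)) (hR : R' ∈ D.descendants n (D.cubeAt k x))
    (hy : y ∉ Q'.toSet) : S.k R' Q' y = 0 :=
  (S.k_haar _ (D.cubeAt_mem k x) _ hQ _ hR).1 y hy

/-- The function `h` is constant on the cells of generation `k - n - 1`. -/
theorem cellConst_h {k : ℤ} {x : Fin d → ℝ} {Q' R' : Cube d}
    (hQ : Q' ∈ D.descendants m (D.cubeAt k x)) (hR : R' ∈ D.descendants n (D.cubeAt k x)) :
    D.CellConst (k - n - 1) (S.h Q' R') := by
  intro y z hz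
  by_cases hy : y ∈ R'.toSet
  · have e := descendant_eq_cubeAt hR hy
    refine (S.h_haar _ (D.cubeAt_mem k x) _ hQ _ hR).2 (D.cubeAt (k - n - 1) y) ?_ z hz y
      (D.mem_cell_self _ _)
    rw [e]
    exact_mod_cast cubeAt_mem_descendants (j := 1) (D.mem_cell_self (k - n) y)
  · have hz' : z ∉ R'.toSet := fun hz' => hy <| by
      have e := descendant_eq_cubeAt hR hz'
      rw [e]
      exact D.cell_mono (by omega) z (mem_cell_comm.1 hz)
    rw [S.h_eq_zero hQ hR hy, S.h_eq_zero hQ hR hz']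

theorem kernel_eq_zero_of_notMem {k : ℤ} {x y z : Fin d → ℝ} (hy : y ∉ D.cell k x) :
    S.kernel (D.cubeAt k x) z y = 0 := by
  refine finsum_mem_eq_zero_of_forall_eq_zero fun Q' hQ' =>
    finsum_mem_eq_zero_of_forall_eq_zero fun R' hR' => ?_
  rw [S.h_eq_zero hQ' hR' fun h => hy (hR'.2.2 h), zero_mul]

theorem kernel_eq_finsum (k : ℤ) (x y : Fin d → ℝ) : S.kernel (D.cubeAt k x) x y =
    ∑ᶠ R' ∈ D.descendants n (D.cubeAt k x),
      S.h (D.cubeAt (k - m) x) R' y * S.k R' (D.cubeAt (k - m) x) x := by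
  have hQ := cubeAt_mem_descendants (j := m) (D.mem_cell_self k x)
  refine finsum_mem_eq_single (f := fun Q' => ∑ᶠ R' ∈ D.descendants n (D.cubeAt k x),
    S.h Q' R' y * S.k R' Q' x) hQ fun Q' hQ' hne =>
      finsum_mem_eq_zero_of_forall_eq_zero fun R' hR' => ?_
  rw [S.k_eq_zero hQ' hR' fun h => hne (descendant_eq_cubeAt hQ' h), mul_zero]

theorem kernel_eq_of_mem {k : ℤ} {x y : Fin d → ℝ} (hy : y ∈ D.cell k x) :
    S.kernel (D.cubeAt k x) x y =
      S.h (D.cubeAt (k - m) x) (D.cubeAt (k - n) y) y *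
        S.k (D.cubeAt (k - n) y) (D.cubeAt (k - m) x) x := by
  have hQ := cubeAt_mem_descendants (j := m) (D.mem_cell_self k x)
  rw [kernel_eq_finsum]
  refine finsum_mem_eq_single (cubeAt_mem_descendants hy) fun R' hR' hne => ?_
  rw [S.h_eq_zero hQ hR' fun h => hne (descendant_eq_cubeAt hR' h), zero_mul]

/-- The kernel `|Q|⁻¹ s_Q(x, y)`, where `Q` is the cube of generation `k` that contains `x`. -/
def ker (k : ℤ) (x y : Fin d → ℝ) : ℂ :=
  ((D.cubeAt k x).vol : ℂ)⁻¹ * S.kernel (D.cubeAt k x) x y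

theorem ker_eq_zero {k : ℤ} {x y : Fin d → ℝ} (hy : y ∉ D.cell k x) : S.ker k x y = 0 := by
  rw [ker, S.kernel_eq_zero_of_notMem hy, mul_zero]

/-- For given x and y only one pair (Q', R') contributes, the one with x in Q' and y in R', so the
double sum is a single product of two factors of modulus at most one. -/
theorem enorm_ker_le (k : ℤ) (x y : Fin d → ℝ) : ‖S.ker k x y‖ₑ ≤ (D.cellVol k)⁻¹ := by
  by_cases hy : y ∈ D.cell k x
  · have hQ := cubeAt_mem_descendants (j := m) (D.mem_cell_self k x)
    have hR := cubeAt_mem_descendants (j := n) hy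
    have hv := (D.cubeAt k x).vol_pos
    rw [ker, S.kernel_eq_of_mem hy, ← ofReal_norm, norm_mul, norm_mul, norm_inv,
      Complex.norm_real, Real.norm_of_nonneg hv.le, ← D.ofReal_vol_cubeAt k x,
      ← ENNReal.ofReal_inv_of_pos hv]
    refine ENNReal.ofReal_le_ofReal (mul_le_of_le_one_right (by positivity) ?_)
    exact mul_le_one₀ (S.h_le _ (D.cubeAt_mem k x) _ hQ _ hR y) (norm_nonneg _)
      (S.k_le _ (D.cubeAt_mem k x) _ hQ _ hR x)
  · simp [S.ker_eq_zero hy]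

/-- The cube Q' lies m generations below Q, and a generalized Haar function on it is constant on its
children, one generation further down. -/
theorem cellConst_ker_left (k : ℤ) : D.CellConst (k - m - 1) (S.ker k) := by
  intro x z hz
  have e : D.cubeAt k z = D.cubeAt k x := cubeAt_eq_of_mem (D.cell_mono (by omega) x hz)
  have e' : D.cubeAt (k - m) z = D.cubeAt (k - m) x :=
    cubeAt_eq_of_mem (D.cell_mono (by omega) x hz)
  have hQ := cubeAt_mem_descendants (j := m) (D.mem_cell_self k x)
  funext y
  rw [ker, ker, kernel_eq_finsum, kernel_eq_finsum, e, e']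
  congr 1
  refine finsum_mem_congr rfl fun R' hR' => ?_
  congr 1
  refine (S.k_haar _ (D.cubeAt_mem k x) _ hQ _ hR').2 (D.cubeAt (k - m - 1) x) ?_ z hz x
    (D.mem_cell_self _ _)
  exact_mod_cast cubeAt_mem_descendants (j := 1) (D.mem_cell_self (k - m) x)

theorem cellConst_ker_right (k : ℤ) (x : Fin d → ℝ) : D.CellConst (k - n - 1) (S.ker k x) := by
  intro y z hz
  have hQ := cubeAt_mem_descendants (j := m) (D.mem_cell_self k x)
  rw [ker, ker, kernel_eq_finsum, kernel_eq_finsum]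
  congr 1
  refine finsum_mem_congr rfl fun R' hR' => ?_
  rw [S.cellConst_h hQ hR' y z hz]

theorem measurable_ker (k : ℤ) : Measurable (Function.uncurry (S.ker k)) :=
  (S.cellConst_ker_left k).measurable_prod fun x => S.cellConst_ker_right k x

/-- The part of generation `k` of the shift: `𝕊_Q(fσ)(x)` for the cube `Q ∋ x` of generation `k`. -/
def scalePart (σ : Measure (Fin d → ℝ)) (f : (Fin d → ℝ) → ℂ) (k : ℤ) (x : Fin d → ℝ) : ℂ :=
  ∫ y, S.ker k x y * f y ∂σ

theorem cellConst_scalePart (σ : Measure (Fin d → ℝ)) (f : (Fin d → ℝ) → ℂ) (k : ℤ) :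
    D.CellConst (k - m - 1) (S.scalePart σ f k) := fun x z hz => by
  rw [scalePart, scalePart, S.cellConst_ker_left k x z hz]

theorem enorm_scalePart_le (σ : Measure (Fin d → ℝ)) (f : (Fin d → ℝ) → ℂ) (k : ℤ)
    (x : Fin d → ℝ) :
    ‖S.scalePart σ f k x‖ₑ ≤ (D.cellVol k)⁻¹ * ∫⁻ y in D.cell k x, ‖f y‖ₑ ∂σ := by
  refine (enorm_integral_le_lintegral_enorm _).trans ?_
  rw [← lintegral_const_mul' _ _ (ENNReal.inv_ne_top.2 (D.cellVol_ne_zero k)),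
    ← lintegral_indicator (D.measurableSet_cell k x)]
  refine lintegral_mono fun y => ?_
  by_cases hy : y ∈ D.cell k x
  · rw [Set.indicator_of_mem hy, enorm_mul]
    gcongr
    exact S.enorm_ker_le k x y
  · simp [Set.indicator_of_notMem hy, S.ker_eq_zero hy]

theorem integrable_ker_mul {σ : Measure (Fin d → ℝ)} {f : (Fin d → ℝ) → ℂ} {k : ℤ}
    {x : Fin d → ℝ} (hf : IntegrableOn f (D.cell k x) σ) :
    Integrable (fun y => S.ker k x y * f y) σ := by
  have h1 : IntegrableOn (fun y => S.ker k x y * f y) (D.cell k x) σ := by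
    refine Integrable.bdd_mul (c := ((D.cellVol k)⁻¹).toReal) hf
      (S.cellConst_ker_right k x).measurable.aestronglyMeasurable (ae_of_all _ fun y => ?_)
    rw [← toReal_enorm]
    exact ENNReal.toReal_mono (ENNReal.inv_ne_top.2 (D.cellVol_ne_zero k)) (S.enorm_ker_le k x y)
  refine (integrableOn_iff_integrable_of_support_subset fun y hy => ?_).1 h1
  by_contra hn
  simp [S.ker_eq_zero hn] at hy

theorem component_eq_scalePart {σ : Measure (Fin d → ℝ)} {f : (Fin d → ℝ) → ℂ} {k : ℤ}
    {x : Fin d → ℝ} (hf : IntegrableOn f (D.cell k x) σ) :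
    S.component (D.cubeAt k x) σ f x = S.scalePart σ f k x := by
  have hQ := cubeAt_mem_descendants (j := m) (D.mem_cell_self k x)
  have hfin := D.finite_descendants n (D.cubeAt k x)
  have h1 : S.component (D.cubeAt k x) σ f x = ∑ᶠ R' ∈ D.descendants n (D.cubeAt k x),
      (∫ y, f y * S.h (D.cubeAt (k - m) x) R' y ∂σ) / ((D.cubeAt k x).vol : ℂ) *
        S.k R' (D.cubeAt (k - m) x) x := by
    refine finsum_mem_eq_single (f := fun Q' => ∑ᶠ R' ∈ D.descendants n (D.cubeAt k x),
      (∫ y, f y * S.h Q' R' y ∂σ) / ((D.cubeAt k x).vol : ℂ) * S.k R' Q' x) hQ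
        fun Q' hQ' hne => finsum_mem_eq_zero_of_forall_eq_zero fun R' hR' => ?_
    rw [S.k_eq_zero hQ' hR' fun h => hne (descendant_eq_cubeAt hQ' h), mul_zero]
  rw [h1, finsum_mem_eq_finite_toFinset_sum _ hfin, scalePart]
  have h2 : ∀ y, S.ker k x y * f y = ∑ R' ∈ hfin.toFinset,
      ((D.cubeAt k x).vol : ℂ)⁻¹ * S.k R' (D.cubeAt (k - m) x) x *
        (f y * S.h (D.cubeAt (k - m) x) R' y) := by
    intro y
    rw [ker, kernel_eq_finsum, finsum_mem_eq_finite_toFinset_sum _ hfin, Finset.mul_sum,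
      Finset.sum_mul]
    exact Finset.sum_congr rfl fun R' _ => by ring
  simp_rw [h2]
  rw [integral_finsetSum]
  · refine Finset.sum_congr rfl fun R' _ => ?_
    rw [integral_const_mul]
    ring
  · intro R' hR'
    rw [Set.Finite.mem_toFinset] at hR'
    refine Integrable.const_mul ?_ _
    have h3 : IntegrableOn (fun y => f y * S.h (D.cubeAt (k - m) x) R' y) (D.cell k x) σ :=
      Integrable.mul_bdd (c := 1) hf
        (S.cellConst_h hQ hR').measurable.aestronglyMeasurable
        (ae_of_all _ fun y => S.h_le _ (D.cubeAt_mem k x) _ hQ _ hR' y)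
    refine (integrableOn_iff_integrable_of_support_subset fun y hy => ?_).1 h3
    by_contra hn
    simp [S.h_eq_zero hQ hR' fun h => hn (hR'.2.2 h)] at hy

theorem component_eq_zero {Q : Cube d} (hQ : Q ∈ D.cubes) {σ : Measure (Fin d → ℝ)}
    {f : (Fin d → ℝ) → ℂ} {x : Fin d → ℝ} (hx : x ∉ Q.toSet) : S.component Q σ f x = 0 := by
  refine finsum_mem_eq_zero_of_forall_eq_zero fun Q' hQ' =>
    finsum_mem_eq_zero_of_forall_eq_zero fun R' hR' => ?_
  rw [(S.k_haar _ hQ _ hQ' _ hR').1 x fun h => hx (hQ'.2.2 h), mul_zero]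

theorem truncation_eq_sum {σ : Measure (Fin d → ℝ)} {f : (Fin d → ℝ) → ℂ}
    (hf : ∀ k x, IntegrableOn f (D.cell k x) σ) {ε υ : ℝ} {a b : ℤ}
    (hab : ∀ k : ℤ, k ∈ Finset.Icc a b ↔ ε ≤ D.base * (2 : ℝ) ^ k ∧ D.base * (2 : ℝ) ^ k ≤ υ)
    (x : Fin d → ℝ) :
    S.truncation ε υ σ f x = ∑ k ∈ Finset.Icc a b, S.scalePart σ f k x := by
  rw [truncation, finsum_mem_cubes (D := D) (a := a) (b := b) (x := x) (fun Q hQ => hQ.1)]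
  · exact Finset.sum_congr rfl fun k _ => S.component_eq_scalePart (hf k x)
  · intro k hk
    exact ⟨D.cubeAt_mem k x, by rw [side_cubeAt]; exact (hab k).1 hk⟩
  · intro Q hQ hne
    refine ⟨by_contra fun hx => hne (S.component_eq_zero hQ.1 hx), fun k hk => ?_⟩
    rw [hab, ← hk]
    exact hQ.2

end GenHaarShift

/-- The phase is minus the argument, reduced modulo 2π to the half-open interval required of a
linearization. -/
theorem exists_phase (z : ℂ) :
    ∃ ϑ ∈ Set.Ico 0 (2 * Real.pi), Complex.exp (Complex.I * (ϑ : ℂ)) * z = (‖z‖ : ℂ) := by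
  refine ⟨toIcoMod Real.two_pi_pos 0 (-z.arg), ?_, ?_⟩
  · simpa using toIcoMod_mem_Ico Real.two_pi_pos 0 (-z.arg)
  have h1 : Complex.exp (Complex.I * ((toIcoMod Real.two_pi_pos 0 (-z.arg) : ℝ) : ℂ)) =
      Complex.exp (Complex.I * ((-z.arg : ℝ) : ℂ)) := by
    rw [← self_sub_toIcoDiv_zsmul]
    rw [Complex.exp_eq_exp_iff_exists_int]
    refine ⟨-(toIcoDiv Real.two_pi_pos 0 (-z.arg)), ?_⟩
    simp only [zsmul_eq_mul]
    push_cast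
    ring
  rw [h1]
  have h2 : (z.arg : ℂ) * Complex.I + Complex.I * ((-z.arg : ℝ) : ℂ) = 0 := by push_cast; ring
  calc Complex.exp (Complex.I * ((-z.arg : ℝ) : ℂ)) * z
      = Complex.exp (Complex.I * ((-z.arg : ℝ) : ℂ)) *
          (‖z‖ * Complex.exp (z.arg * Complex.I)) := by rw [Complex.norm_mul_exp_arg_mul_I z]
    _ = ‖z‖ := by
      rw [mul_comm, mul_assoc, ← Complex.exp_add, h2, Complex.exp_zero, mul_one]

/-! ### Truncations to finitely many generations. -/

namespace GenHaarShift

variable {d : ℕ} {D : DyadicGrid d} {m n : ℕ} (S : GenHaarShift D m n)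

/-- The maximal truncation over the truncations that use the generations from `lo` to `hi`. -/
def finMax (σ : Measure (Fin d → ℝ)) (f : (Fin d → ℝ) → ℂ) (lo hi : ℤ) (x : Fin d → ℝ) : ℝ≥0∞ :=
  (Finset.Icc lo hi ×ˢ Finset.Icc lo hi).sup fun p =>
    ‖∑ k ∈ Finset.Icc p.1 p.2, S.scalePart σ f k x‖ₑ

variable {S}

theorem enorm_sum_le_finMax {σ : Measure (Fin d → ℝ)} {f : (Fin d → ℝ) → ℂ} {lo hi a b : ℤ}
    (ha : lo ≤ a) (hb : b ≤ hi) (x : Fin d → ℝ) :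
    ‖∑ k ∈ Finset.Icc a b, S.scalePart σ f k x‖ₑ ≤ S.finMax σ f lo hi x := by
  by_cases hab : a ≤ b
  · exact Finset.le_sup (f := fun p : ℤ × ℤ => ‖∑ k ∈ Finset.Icc p.1 p.2, S.scalePart σ f k x‖ₑ)
      (b := (a, b)) (by simp; omega)
  · rw [Finset.Icc_eq_empty hab]; simp

theorem finMax_lt_top (σ : Measure (Fin d → ℝ)) (f : (Fin d → ℝ) → ℂ) (lo hi : ℤ)
    (x : Fin d → ℝ) : S.finMax σ f lo hi x < ⊤ :=
  (Finset.sup_lt_iff (by simp)).2 fun _ _ => enorm_lt_top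

theorem cellConst_finMax (σ : Measure (Fin d → ℝ)) (f : (Fin d → ℝ) → ℂ) (lo hi : ℤ) :
    D.CellConst (lo - m - 1) (S.finMax σ f lo hi) := by
  intro x y hy
  refine Finset.sup_congr rfl fun p hp => ?_
  simp only [Finset.mem_product, Finset.mem_Icc] at hp
  congr 1
  refine Finset.sum_congr rfl fun k hk => ?_
  rw [Finset.mem_Icc] at hk
  exact (S.cellConst_scalePart σ f k).mono (by omega) x y hy

theorem finMax_mono {σ : Measure (Fin d → ℝ)} {f : (Fin d → ℝ) → ℂ} {lo lo' hi hi' : ℤ}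
    (hlo : lo' ≤ lo) (hhi : hi ≤ hi') (x : Fin d → ℝ) :
    S.finMax σ f lo hi x ≤ S.finMax σ f lo' hi' x := by
  refine Finset.sup_le fun p hp => ?_
  simp only [Finset.mem_product, Finset.mem_Icc] at hp
  exact enorm_sum_le_finMax (by omega) (by omega) x

theorem _root_.TwoWeight.DyadicGrid.exists_Icc_iff (D : DyadicGrid d) {ε υ : ℝ} (hε : 0 < ε)
    (hυ : 0 < υ) : ∃ a b : ℤ, ∀ k : ℤ, k ∈ Finset.Icc a b ↔
      ε ≤ D.base * (2 : ℝ) ^ k ∧ D.base * (2 : ℝ) ^ k ≤ υ := by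
  obtain ⟨a, ha, ha'⟩ := exists_mem_Ioc_zpow (div_pos hε D.base_pos) one_lt_two
  obtain ⟨b, hb, hb'⟩ := exists_mem_Ico_zpow (div_pos hυ D.base_pos) one_lt_two
  refine ⟨a + 1, b, fun k => ?_⟩
  rw [Finset.mem_Icc, ← div_le_iff₀' D.base_pos, ← le_div_iff₀' D.base_pos]
  refine and_congr ⟨fun h => ha'.trans (zpow_le_zpow_right₀ one_le_two h), fun h => ?_⟩
    ⟨fun h => (zpow_le_zpow_right₀ one_le_two h).trans hb, fun h => ?_⟩
  · exact Int.add_one_le_iff.2 ((zpow_lt_zpow_iff_right₀ one_lt_two).1 (ha.trans_le h))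
  · exact Int.lt_add_one_iff.1 ((zpow_lt_zpow_iff_right₀ one_lt_two).1 (h.trans_lt hb'))

theorem finMax_le_maxTruncation {σ : Measure (Fin d → ℝ)} {f : (Fin d → ℝ) → ℂ}
    (hf : ∀ k x, IntegrableOn f (D.cell k x) σ) (lo hi : ℤ) (x : Fin d → ℝ) :
    S.finMax σ f lo hi x ≤ S.maxTruncation σ f x := by
  refine Finset.sup_le fun p _ => ?_
  have hb := D.base_pos
  by_cases hab : p.1 ≤ p.2
  · have hk : ∀ k : ℤ, k ∈ Finset.Icc p.1 p.2 ↔ D.base * (2 : ℝ) ^ p.1 ≤ D.base * (2 : ℝ) ^ k ∧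
        D.base * (2 : ℝ) ^ k ≤ D.base * (2 : ℝ) ^ p.2 := fun k => by
      rw [mul_le_mul_iff_right₀ hb, mul_le_mul_iff_right₀ hb,
        zpow_le_zpow_iff_right₀ one_lt_two, zpow_le_zpow_iff_right₀ one_lt_two, Finset.mem_Icc]
    rw [← S.truncation_eq_sum hf hk]
    refine le_iSup₂_of_le (D.base * (2 : ℝ) ^ p.1) (D.base * (2 : ℝ) ^ p.2) ?_
    refine le_iSup₂_of_le (by positivity) ?_ le_rfl
    exact mul_le_mul_of_nonneg_left (zpow_le_zpow_right₀ one_le_two hab) hb.le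
  · simp [Finset.Icc_eq_empty hab]

/-- A truncation depends on its two parameters only through an interval of generations, so the
uncountable supremum is an increasing limit of finite maxima. -/
theorem maxTruncation_eq_iSup {σ : Measure (Fin d → ℝ)} {f : (Fin d → ℝ) → ℂ}
    (hf : ∀ k x, IntegrableOn f (D.cell k x) σ) (x : Fin d → ℝ) :
    S.maxTruncation σ f x = ⨆ K : ℕ, S.finMax σ f (-K) K x := by
  refine le_antisymm ?_ (iSup_le fun K => finMax_le_maxTruncation hf _ _ x)
  refine iSup₂_le fun ε υ => iSup₂_le fun hε hυ => ?_
  obtain ⟨a, b, hab⟩ := D.exists_Icc_iff hε (hε.trans_le hυ)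
  rw [S.truncation_eq_sum hf hab]
  refine le_iSup_of_le (a.natAbs + b.natAbs) (enorm_sum_le_finMax ?_ ?_ x) <;> omega

end GenHaarShift

/-! ### Bounded linearizations and their adjoints. -/

/-- A choice of generations `a(x) ≤ b(x)` between `lo` and `hi` and of a phase, constant on the
cells of generation `s`: the data of a bounded linearization. -/
structure ScaleChoice {d : ℕ} (D : DyadicGrid d) (s lo hi : ℤ) where
  a : (Fin d → ℝ) → ℤ
  b : (Fin d → ℝ) → ℤ
  ϑ : (Fin d → ℝ) → ℝ
  a_const : D.CellConst s a
  b_const : D.CellConst s b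
  ϑ_const : D.CellConst s ϑ
  le_a : ∀ x, lo ≤ a x
  b_le : ∀ x, b x ≤ hi
  ϑ_mem : ∀ x, ϑ x ∈ Set.Ico 0 (2 * Real.pi)

namespace ScaleChoice

variable {d : ℕ} {D : DyadicGrid d} {s lo hi : ℤ} (c : ScaleChoice D s lo hi)

/-- The linearization with the given generations and phase. -/
def toLinearization : Linearization d where
  ε x := D.base * (2 : ℝ) ^ c.a x
  υ x := D.base * (2 : ℝ) ^ c.b x
  ϑ := c.ϑ
  ε_measurable := CellConst.measurable (D := D) (s := s) fun x y hy => by rw [c.a_const x y hy]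
  υ_measurable := CellConst.measurable (D := D) (s := s) fun x y hy => by rw [c.b_const x y hy]
  ϑ_measurable := c.ϑ_const.measurable
  ε_pos _ := mul_pos D.base_pos (by positivity)
  υ_pos _ := mul_pos D.base_pos (by positivity)
  ϑ_mem := c.ϑ_mem

theorem isBounded_toLinearization : c.toLinearization.IsBounded :=
  ⟨D.base * (2 : ℝ) ^ lo, D.base * (2 : ℝ) ^ hi, mul_pos D.base_pos (by positivity), fun x =>
    ⟨mul_le_mul_of_nonneg_left (zpow_le_zpow_right₀ one_le_two (c.le_a x)) D.base_pos.le,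
      mul_le_mul_of_nonneg_left (zpow_le_zpow_right₀ one_le_two (c.b_le x)) D.base_pos.le⟩⟩

/-- The weight with which generation `k` enters the linearization at the point `x`. -/
def coef (k : ℤ) (x : Fin d → ℝ) : ℂ :=
  if c.a x ≤ k ∧ k ≤ c.b x then Complex.exp (Complex.I * (c.ϑ x : ℂ)) else 0

theorem cellConst_coef (k : ℤ) : D.CellConst s (c.coef k) := fun x y hy => by
  rw [coef, coef, c.a_const x y hy, c.b_const x y hy, c.ϑ_const x y hy]

theorem norm_coef_le (k : ℤ) (x : Fin d → ℝ) : ‖c.coef k x‖ ≤ 1 := by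
  rw [coef]
  split_ifs
  · rw [mul_comm, Complex.norm_exp_ofReal_mul_I]
  · simp

end ScaleChoice

namespace GenHaarShift

variable {d : ℕ} {D : DyadicGrid d} {m n : ℕ} (S : GenHaarShift D m n)
  {s lo hi : ℤ} (c : ScaleChoice D s lo hi)

/-- The linearization `𝕃(gσ)`. -/
def lin (σ : Measure (Fin d → ℝ)) (g : (Fin d → ℝ) → ℂ) (x : Fin d → ℝ) : ℂ :=
  Complex.exp (Complex.I * (c.ϑ x : ℂ)) * ∑ k ∈ Finset.Icc (c.a x) (c.b x), S.scalePart σ g k x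

theorem lin_eq_sum (σ : Measure (Fin d → ℝ)) (g : (Fin d → ℝ) → ℂ) (x : Fin d → ℝ) :
    S.lin c σ g x = ∑ k ∈ Finset.Icc lo hi, c.coef k x * S.scalePart σ g k x := by
  have hsub : Finset.Icc (c.a x) (c.b x) ⊆ Finset.Icc lo hi :=
    Finset.Icc_subset_Icc (c.le_a x) (c.b_le x)
  rw [lin, Finset.mul_sum, ← Finset.sum_subset hsub]
  · refine Finset.sum_congr rfl fun k hk => ?_
    rw [Finset.mem_Icc] at hk
    rw [ScaleChoice.coef, if_pos hk]
  · intro k _ hk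
    rw [Finset.mem_Icc] at hk
    rw [ScaleChoice.coef, if_neg hk, zero_mul]

theorem enorm_lin (σ : Measure (Fin d → ℝ)) (g : (Fin d → ℝ) → ℂ) (x : Fin d → ℝ) :
    ‖S.lin c σ g x‖ₑ = ‖∑ k ∈ Finset.Icc (c.a x) (c.b x), S.scalePart σ g k x‖ₑ := by
  rw [lin, ← ofReal_norm, norm_mul, mul_comm Complex.I, Complex.norm_exp_ofReal_mul_I, one_mul,
    ofReal_norm]

theorem enorm_lin_le_finMax (σ : Measure (Fin d → ℝ)) (g : (Fin d → ℝ) → ℂ) (x : Fin d → ℝ) :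
    ‖S.lin c σ g x‖ₑ ≤ S.finMax σ g lo hi x := by
  rw [enorm_lin]
  exact enorm_sum_le_finMax (c.le_a x) (c.b_le x) x

theorem cellConst_lin (σ : Measure (Fin d → ℝ)) (g : (Fin d → ℝ) → ℂ) (hs : s ≤ lo - m - 1) :
    D.CellConst s (S.lin c σ g) := by
  intro x y hy
  rw [lin_eq_sum, lin_eq_sum]
  refine Finset.sum_congr rfl fun k hk => ?_
  rw [Finset.mem_Icc] at hk
  rw [c.cellConst_coef k x y hy, (S.cellConst_scalePart σ g k).mono (by omega) x y hy]

theorem scalePart_add {σ : Measure (Fin d → ℝ)} {f g : (Fin d → ℝ) → ℂ} {k : ℤ} {x : Fin d → ℝ}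
    (hf : IntegrableOn f (D.cell k x) σ) (hg : IntegrableOn g (D.cell k x) σ) :
    S.scalePart σ (fun y => f y + g y) k x = S.scalePart σ f k x + S.scalePart σ g k x := by
  simp only [scalePart, mul_add]
  exact integral_add (S.integrable_ker_mul hf) (S.integrable_ker_mul hg)

theorem lin_add {σ : Measure (Fin d → ℝ)} {f g : (Fin d → ℝ) → ℂ} {x : Fin d → ℝ}
    (hf : ∀ k, IntegrableOn f (D.cell k x) σ) (hg : ∀ k, IntegrableOn g (D.cell k x) σ) :
    S.lin c σ (fun y => f y + g y) x = S.lin c σ f x + S.lin c σ g x := by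
  rw [lin, lin, lin, ← mul_add, ← Finset.sum_add_distrib]
  congr 1
  exact Finset.sum_congr rfl fun k _ => S.scalePart_add (hf k) (hg k)

/-- The formal adjoint of `lin`, as a sum over the generations. -/
def linAdj (w : Measure (Fin d → ℝ)) (φ : (Fin d → ℝ) → ℂ) (y : Fin d → ℝ) : ℂ :=
  ∑ k ∈ Finset.Icc lo hi, ∫ x, S.ker k x y * (c.coef k x * φ x) ∂w

theorem cellConst_linAdj (w : Measure (Fin d → ℝ)) (φ : (Fin d → ℝ) → ℂ) :
    D.CellConst (lo - n - 1) (S.linAdj c w φ) := by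
  intro x y hy
  refine Finset.sum_congr rfl fun k hk => ?_
  rw [Finset.mem_Icc] at hk
  congr 1
  funext z
  rw [(S.cellConst_ker_right k z).mono (by omega) x y hy]

theorem adjoint_eq_linAdj (w : Measure (Fin d → ℝ)) (φ : (Fin d → ℝ) → ℂ) (y : Fin d → ℝ) :
    S.adjoint c.toLinearization w φ y = S.linAdj c w φ y := by
  have hb := D.base_pos
  have hc : ∀ (k : ℤ) x, (c.toLinearization.ε x ≤ D.base * (2 : ℝ) ^ k ∧
      D.base * (2 : ℝ) ^ k ≤ c.toLinearization.υ x) ↔ (c.a x ≤ k ∧ k ≤ c.b x) := by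
    intro k x
    simp only [ScaleChoice.toLinearization]
    rw [mul_le_mul_iff_right₀ hb, mul_le_mul_iff_right₀ hb,
        zpow_le_zpow_iff_right₀ one_lt_two, zpow_le_zpow_iff_right₀ one_lt_two]
  rw [adjoint, linAdj, finsum_mem_cubes (D := D) (a := lo) (b := hi) (x := y) subset_rfl
    (fun k _ => D.cubeAt_mem k y)]
  · refine Finset.sum_congr rfl fun k hk => ?_
    rw [← integral_const_mul]
    have : ∀ x ∉ D.cell k y, S.ker k x y * (c.coef k x * φ x) = 0 := fun x hx => by
      rw [S.ker_eq_zero fun h => hx (mem_cell_comm.1 h), zero_mul]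
    rw [← setIntegral_eq_integral_of_forall_compl_eq_zero this]
    refine setIntegral_congr_fun (D.measurableSet_cell k y) fun x hx => ?_
    simp only [ker, cubeAt_eq_of_mem hx, mul_assoc]
    congr 2
    simp only [Set.indicator, Set.mem_ofPred_eq, side_cubeAt, hc, ScaleChoice.coef]
    split_ifs <;> simp [ScaleChoice.toLinearization]
  · intro Q hQ hne
    refine ⟨by_contra fun hy => hne ?_, fun k hk => by_contra fun hk' => hne ?_⟩
    · obtain ⟨k, hk⟩ := D.side_eq Q hQ
      have h0 : ∀ x, S.kernel Q x y = 0 := fun x =>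
        finsum_mem_eq_zero_of_forall_eq_zero fun Q' hQ' =>
          finsum_mem_eq_zero_of_forall_eq_zero fun R' hR' => by
            rw [(S.h_haar Q hQ Q' hQ' R' hR').1 y fun h => hy (hR'.2.2 h), zero_mul]
      simp [h0]
    · have h0 : {x | c.toLinearization.ε x ≤ Q.side ∧ Q.side ≤ c.toLinearization.υ x} = ∅ := by
        ext x
        simp only [Set.mem_ofPred_eq, hk, hc, Set.mem_empty_iff_false, iff_false]
        rintro ⟨h1, h2⟩
        exact hk' (Finset.mem_Icc.2 ⟨(c.le_a x).trans h1, h2.trans (c.b_le x)⟩)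
      simp [h0]

theorem norm_ker_le (k : ℤ) (x y : Fin d → ℝ) : ‖S.ker k x y‖ ≤ ((D.cellVol k)⁻¹).toReal := by
  rw [← toReal_enorm]
  exact ENNReal.toReal_mono (ENNReal.inv_ne_top.2 (D.cellVol_ne_zero k)) (S.enorm_ker_le k x y)

theorem integrable_ker_coef_mul {w : Measure (Fin d → ℝ)} {φ : (Fin d → ℝ) → ℂ}
    (hφ : Integrable φ w) (k : ℤ) (y : Fin d → ℝ) :
    Integrable (fun x => S.ker k x y * (c.coef k x * φ x)) w := by
  refine Integrable.bdd_mul (c := ((D.cellVol k)⁻¹).toReal) ?_ ?_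
    (ae_of_all _ fun x => S.norm_ker_le k x y)
  · exact Integrable.bdd_mul (c := 1) hφ (c.cellConst_coef k).measurable.aestronglyMeasurable
      (ae_of_all _ fun x => c.norm_coef_le k x)
  · exact ((S.measurable_ker k).comp (measurable_id.prodMk measurable_const)).aestronglyMeasurable

/-- Linearity of the adjoint is needed to expand the indicator of a level in characters. -/
theorem linAdj_sum {ι : Type*} (t : Finset ι) {w : Measure (Fin d → ℝ)}
    {φ : ι → (Fin d → ℝ) → ℂ} (hφ : ∀ i ∈ t, Integrable (φ i) w) (z : ι → ℂ) (y : Fin d → ℝ) :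
    S.linAdj c w (fun x => ∑ i ∈ t, z i * φ i x) y = ∑ i ∈ t, z i * S.linAdj c w (φ i) y := by
  simp only [linAdj, Finset.mul_sum]
  rw [Finset.sum_comm]
  refine Finset.sum_congr rfl fun k _ => ?_
  simp only [← integral_const_mul]
  rw [← integral_finsetSum]
  · congr 1; funext x
    exact Finset.sum_congr rfl fun i _ => by ring
  · exact fun i hi => (S.integrable_ker_coef_mul c (hφ i hi) k y).const_mul _

/-- Only finitely many generations occur and each kernel is bounded, so Fubini applies generation by
generation. -/
theorem integral_lin_mul {σ w : Measure (Fin d → ℝ)} [SFinite σ] [SFinite w]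
    {g φ : (Fin d → ℝ) → ℂ} (hg : Integrable g σ) (hφ : Integrable φ w) :
    ∫ x, S.lin c σ g x * φ x ∂w = ∫ y, g y * S.linAdj c w φ y ∂σ := by
  have hint : ∀ k, Integrable (Function.uncurry fun x y =>
      S.ker k x y * (c.coef k x * φ x * g y)) (w.prod σ) := by
    intro k
    refine Integrable.bdd_mul (c := ((D.cellVol k)⁻¹).toReal) ?_
      (S.measurable_ker k).aestronglyMeasurable (ae_of_all _ fun z => S.norm_ker_le k z.1 z.2)
    exact Integrable.mul_prod (Integrable.bdd_mul (c := 1) hφ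
      (c.cellConst_coef k).measurable.aestronglyMeasurable
      (ae_of_all _ fun x => c.norm_coef_le k x)) hg
  have e1 : ∀ x, S.lin c σ g x * φ x = ∑ k ∈ Finset.Icc lo hi,
      ∫ y, S.ker k x y * (c.coef k x * φ x * g y) ∂σ := by
    intro x
    rw [lin_eq_sum, Finset.sum_mul]
    refine Finset.sum_congr rfl fun k _ => ?_
    rw [scalePart, mul_right_comm, ← integral_const_mul]
    congr 1; funext y; ring
  have e2 : ∀ y, g y * S.linAdj c w φ y = ∑ k ∈ Finset.Icc lo hi,
      ∫ x, S.ker k x y * (c.coef k x * φ x * g y) ∂w := by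
    intro y
    rw [linAdj, Finset.mul_sum]
    refine Finset.sum_congr rfl fun k _ => ?_
    rw [← integral_const_mul]
    congr 1; funext x; ring
  simp_rw [e1, e2]
  have h1 : ∀ k, Integrable (fun x => ∫ y, S.ker k x y * (c.coef k x * φ x * g y) ∂σ) w :=
    fun k => (hint k).integral_prod_left
  have h2 : ∀ k, Integrable (fun y => ∫ x, S.ker k x y * (c.coef k x * φ x * g y) ∂w) σ :=
    fun k => (hint k).integral_prod_right
  rw [integral_finsetSum _ fun k _ => h1 k, integral_finsetSum _ fun k _ => h2 k]
  exact Finset.sum_congr rfl fun k _ => integral_integral_swap (hint k)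

/-- The maximal truncation of a given function is attained by a linearization. -/
theorem exists_scaleChoice (σ : Measure (Fin d → ℝ)) (f : (Fin d → ℝ) → ℂ) (h : lo ≤ hi) :
    ∃ c : ScaleChoice D (lo - m - 1) lo hi,
      ∀ x, S.lin c σ f x = ((S.finMax σ f lo hi x).toReal : ℂ) := by
  classical
  have hex : ∀ x, ∃ p : ℤ × ℤ × ℝ, lo ≤ p.1 ∧ p.2.1 ≤ hi ∧ p.2.2 ∈ Set.Ico 0 (2 * Real.pi) ∧
      Complex.exp (Complex.I * (p.2.2 : ℂ)) * ∑ k ∈ Finset.Icc p.1 p.2.1, S.scalePart σ f k x =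
        ((S.finMax σ f lo hi x).toReal : ℂ) := by
    intro x
    obtain ⟨p, hp, hmax⟩ := Finset.exists_mem_eq_sup (Finset.Icc lo hi ×ˢ Finset.Icc lo hi)
      ⟨(lo, lo), by simp [h]⟩ fun p => ‖∑ k ∈ Finset.Icc p.1 p.2, S.scalePart σ f k x‖ₑ
    obtain ⟨ϑ, hϑ, he⟩ := exists_phase (∑ k ∈ Finset.Icc p.1 p.2, S.scalePart σ f k x)
    simp only [Finset.mem_product, Finset.mem_Icc] at hp
    refine ⟨⟨p.1, p.2, ϑ⟩, hp.1.1, hp.2.2, hϑ, he.trans ?_⟩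
    rw [finMax, hmax, toReal_enorm]
  choose P hP1 hP2 hP3 hP4 using hex
  -- The optimal parameters are taken at one representative of each small cell, which makes the
  -- choice constant on cells and hence measurable.
  let r : Cube d → (Fin d → ℝ) := fun Q =>
    if h : ∃ x, D.cubeAt (lo - m - 1) x = Q then h.choose else 0
  have hr : ∀ x, x ∈ D.cell (lo - m - 1) (r (D.cubeAt (lo - m - 1) x)) := by
    intro x
    have h : ∃ y, D.cubeAt (lo - m - 1) y = D.cubeAt (lo - m - 1) x := ⟨x, rfl⟩
    simp only [r, dif_pos h]
    exact cubeAt_eq_iff.1 h.choose_spec.symm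
  let P' : (Fin d → ℝ) → ℤ × ℤ × ℝ := fun x => P (r (D.cubeAt (lo - m - 1) x))
  have hP' : D.CellConst (lo - m - 1) P' := fun x y hy => by simp only [P', cubeAt_eq_of_mem hy]
  refine ⟨⟨fun x => (P' x).1, fun x => (P' x).2.1, fun x => (P' x).2.2,
    fun x y hy => congrArg (·.1) (hP' x y hy), fun x y hy => congrArg (·.2.1) (hP' x y hy),
    fun x y hy => congrArg (·.2.2) (hP' x y hy), fun x => hP1 _, fun x => hP2 _, fun x => hP3 _⟩,
        fun x => ?_⟩
  rw [cellConst_finMax σ f lo hi _ _ (hr x), ← hP4, lin]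
  refine congrArg _ (Finset.sum_congr rfl fun k hk => ?_)
  rw [Finset.mem_Icc] at hk
  have := hP1 (r (D.cubeAt (lo - m - 1) x))
  exact (S.cellConst_scalePart σ f k).mono (by omega) _ _ (hr x)

end GenHaarShift

/-! ### Dyadic layer-cake sums. -/

section DyadicSums

theorem two_zpow_ne_zero (j : ℤ) : (2 : ℝ≥0∞) ^ j ≠ 0 :=
  (ENNReal.zpow_pos two_ne_zero ENNReal.ofNat_ne_top j).ne'

theorem two_zpow_ne_top (j : ℤ) : (2 : ℝ≥0∞) ^ j ≠ ⊤ :=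
  (ENNReal.zpow_lt_top two_ne_zero ENNReal.ofNat_ne_top j).ne

theorem two_zpow_add (i j : ℤ) : (2 : ℝ≥0∞) ^ (i + j) = 2 ^ i * 2 ^ j :=
  ENNReal.zpow_add two_ne_zero ENNReal.ofNat_ne_top i j

theorem two_zpow_lt_iff {i j : ℤ} : (2 : ℝ≥0∞) ^ i < 2 ^ j ↔ i < j := by
  constructor
  · intro h
    by_contra hij
    exact absurd (ENNReal.zpow_le_of_le (by norm_num) (not_lt.1 hij)) (not_le.2 h)
  · intro h
    refine lt_of_lt_of_le ?_ (ENNReal.zpow_le_of_le (by norm_num) (Int.add_one_le_iff.2 h))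
    rw [two_zpow_add, zpow_one]
    nth_rewrite 1 [← mul_one ((2 : ℝ≥0∞) ^ i)]
    exact ENNReal.mul_lt_mul_right (two_zpow_ne_zero i) (two_zpow_ne_top i) (by norm_num)

/-- The sum is geometric and dominated by its largest term, with 2^J < t ≤ 2^(J+1). -/
theorem tsum_two_zpow_rpow_le (q : ℝ) (hq : 0 < q) : ∃ C : ℝ≥0, ∀ t : ℝ≥0∞,
    ∑' j : ℤ, (if (2 : ℝ≥0∞) ^ j < t then ((2 : ℝ≥0∞) ^ j) ^ q else 0) ≤ C * t ^ q := by
  have hr : (2 : ℝ≥0∞) ^ (-q) < 1 := ENNReal.rpow_lt_one_of_one_lt_of_neg (by norm_num)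
      (by linarith)
  have hC : (1 - (2 : ℝ≥0∞) ^ (-q))⁻¹ ≠ ⊤ := ENNReal.inv_ne_top.2 (tsub_pos_of_lt hr).ne'
  have hC1 : 1 ≤ (1 - (2 : ℝ≥0∞) ^ (-q))⁻¹ := ENNReal.one_le_inv.2 tsub_le_self
  refine ⟨((1 - (2 : ℝ≥0∞) ^ (-q))⁻¹).toNNReal, fun t => ?_⟩
  rw [ENNReal.coe_toNNReal hC]
  rcases eq_or_ne t 0 with rfl | h0
  · simp
  rcases eq_or_ne t ⊤ with rfl | htop
  · rw [ENNReal.top_rpow_of_pos hq, ENNReal.mul_top (by positivity)]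
    exact le_top
  obtain ⟨J, hJ, hJ'⟩ := ENNReal.exists_mem_Ioc_zpow h0 htop (y := 2) (by norm_num) (by norm_num)
  have hinj : Function.Injective fun i : ℕ => J - (i : ℤ) := fun i j h => by
    simp only at h; omega
  rw [← hinj.tsum_eq]
  · calc ∑' i : ℕ, (if (2 : ℝ≥0∞) ^ (J - (i : ℤ)) < t then ((2 : ℝ≥0∞) ^ (J - (i : ℤ))) ^ q else 0)
        ≤ ∑' i : ℕ, t ^ q * ((2 : ℝ≥0∞) ^ (-q)) ^ i := by
          refine ENNReal.tsum_le_tsum fun i => ?_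
          split_ifs with h
          · rw [sub_eq_add_neg, two_zpow_add, ENNReal.mul_rpow_of_nonneg _ _ hq.le]
            refine mul_le_mul' (ENNReal.rpow_le_rpow hJ.le hq.le) (le_of_eq ?_)
            rw [← ENNReal.rpow_intCast, ← ENNReal.rpow_mul, ← ENNReal.rpow_natCast,
              ← ENNReal.rpow_mul]
            push_cast
            ring_nf
          · exact zero_le
      _ = (1 - (2 : ℝ≥0∞) ^ (-q))⁻¹ * t ^ q := by
          rw [ENNReal.tsum_mul_left, ENNReal.tsum_geometric, mul_comm]
  · intro j hj
    simp only [Function.mem_support, ne_eq, ite_eq_right_iff, Classical.not_imp] at hj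
    have := two_zpow_lt_iff.1 (hj.1.trans_le hJ')
    exact ⟨(J - j).toNat, by simp only; omega⟩

theorem rpow_le_tsum_two_zpow {p : ℝ} (hp : 0 < p) {t : ℝ≥0∞} (ht : t ≠ ⊤) :
    t ^ p ≤ ∑' j : ℤ, (if (2 : ℝ≥0∞) ^ j < t ∧ t ≤ 2 ^ (j + 1)
      then ((2 : ℝ≥0∞) ^ (j + 1)) ^ p else 0) := by
  rcases eq_or_ne t 0 with rfl | h0
  · simp [ENNReal.zero_rpow_of_pos hp]
  obtain ⟨J, hJ, hJ'⟩ := ENNReal.exists_mem_Ioc_zpow h0 ht (y := 2) (by norm_num) (by norm_num)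
  refine le_trans ?_ (ENNReal.le_tsum J)
  rw [if_pos ⟨hJ, hJ'⟩]
  exact ENNReal.rpow_le_rpow hJ' hp.le

variable {α : Type*} [MeasurableSpace α]

theorem tsum_measure_lt_le (q : ℝ) (hq : 0 < q) : ∃ C : ℝ≥0, ∀ {α : Type} [MeasurableSpace α]
    (μ : Measure α) (F : α → ℝ≥0∞), Measurable F →
    ∑' j : ℤ, ((2 : ℝ≥0∞) ^ j) ^ q * μ {x | 2 ^ j < F x} ≤ C * ∫⁻ x, F x ^ q ∂μ := by
  obtain ⟨C, hC⟩ := tsum_two_zpow_rpow_le q hq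
  refine ⟨C, fun {α} _ μ F hF => ?_⟩
  have hm : ∀ j : ℤ, MeasurableSet {x | (2 : ℝ≥0∞) ^ j < F x} := fun j =>
    measurableSet_lt measurable_const hF
  have e : ∀ j : ℤ, ((2 : ℝ≥0∞) ^ j) ^ q * μ {x | 2 ^ j < F x} =
      ∫⁻ x, (if (2 : ℝ≥0∞) ^ j < F x then ((2 : ℝ≥0∞) ^ j) ^ q else 0) ∂μ := by
    intro j
    rw [← lintegral_indicator_const (hm j)]
    exact lintegral_congr fun x => by simp [Set.indicator]
  simp_rw [e]
  rw [← lintegral_tsum fun j => (Measurable.ite (hm j) measurable_const measurable_const).aemeasurable,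
    ← lintegral_const_mul' _ _ ENNReal.coe_ne_top]
  exact lintegral_mono fun x => hC (F x)

theorem lintegral_rpow_le_tsum {p : ℝ} (hp : 0 < p) (μ : Measure α) {F : α → ℝ≥0∞}
    (hF : Measurable F) (hfin : ∀ x, F x ≠ ⊤) :
    ∫⁻ x, F x ^ p ∂μ ≤
      ∑' j : ℤ, ((2 : ℝ≥0∞) ^ (j + 1)) ^ p * μ {x | 2 ^ j < F x ∧ F x ≤ 2 ^ (j + 1)} := by
  have hm : ∀ j : ℤ, MeasurableSet {x | (2 : ℝ≥0∞) ^ j < F x ∧ F x ≤ 2 ^ (j + 1)} := fun j =>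
    (measurableSet_lt measurable_const hF).inter (measurableSet_le hF measurable_const)
  have e : ∀ j : ℤ, ((2 : ℝ≥0∞) ^ (j + 1)) ^ p * μ {x | 2 ^ j < F x ∧ F x ≤ 2 ^ (j + 1)} =
      ∫⁻ x, (if (2 : ℝ≥0∞) ^ j < F x ∧ F x ≤ 2 ^ (j + 1)
        then ((2 : ℝ≥0∞) ^ (j + 1)) ^ p else 0) ∂μ := by
    intro j
    rw [← lintegral_indicator_const (hm j)]
    exact lintegral_congr fun x => by simp [Set.indicator]
  simp_rw [e]
  rw [← lintegral_tsum fun j => (Measurable.ite (hm j) measurable_const measurable_const).aemeasurable]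
  exact lintegral_mono fun x => rpow_le_tsum_two_zpow hp (hfin x)

end DyadicSums

/-! ### Maximal cells and the dyadic maximal function. -/

namespace DyadicGrid

variable {d : ℕ} (D : DyadicGrid d)

/-- The points that lie in a cell of generation between `s` and `hi` with the property `P`. -/
def hitSet (s hi : ℤ) (P : ℤ → (Fin d → ℝ) → Prop) : Set (Fin d → ℝ) :=
  {y | ∃ i, s ≤ i ∧ i ≤ hi ∧ P i y}

/-- The generation of the largest cell around `y` with the property `P`. -/
def topScale (s hi : ℤ) (P : ℤ → (Fin d → ℝ) → Prop) (y : Fin d → ℝ) : ℤ :=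
  sSup {i | s ≤ i ∧ i ≤ hi ∧ P i y}

variable {D} {s hi : ℤ} {P : ℤ → (Fin d → ℝ) → Prop}

theorem topScale_spec {y : Fin d → ℝ} (hy : y ∈ hitSet s hi P) :
    s ≤ topScale s hi P y ∧ topScale s hi P y ≤ hi ∧ P (topScale s hi P y) y := by
  have h : topScale s hi P y ∈ {i | s ≤ i ∧ i ≤ hi ∧ P i y} :=
    Int.csSup_mem hy ⟨hi, fun i hi => hi.2.1⟩
  exact h

theorem le_topScale {y : Fin d → ℝ} {i : ℤ} (h₁ : s ≤ i) (h₂ : i ≤ hi) (h₃ : P i y) :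
    i ≤ topScale s hi P y := le_csSup ⟨hi, fun _ hi => hi.2.1⟩ ⟨h₁, h₂, h₃⟩

theorem topScale_eq (hP : ∀ i, D.CellConst i (P i)) {y z : Fin d → ℝ} (hy : y ∈ hitSet s hi P)
    (hz : z ∈ D.cell (topScale s hi P y) y) : topScale s hi P z = topScale s hi P y := by
  obtain ⟨h1, h2, h3⟩ := topScale_spec hy
  have h4 : P (topScale s hi P y) z := by rw [hP _ _ _ hz]; exact h3
  refine le_antisymm ?_ (le_topScale h1 h2 h4)
  obtain ⟨g1, g2, g3⟩ := topScale_spec (P := P) ⟨_, h1, h2, h4⟩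
  by_contra hlt
  have hz' : z ∈ D.cell (topScale s hi P z) y := D.cell_mono (by omega) y hz
  rw [hP _ _ _ hz'] at g3
  exact hlt (le_topScale g1 g2 g3)

theorem isStopping_topScale (hP : ∀ i, D.CellConst i (P i)) :
    D.IsStopping (hitSet s hi P) (topScale s hi P) where
  subset y hy z hz := by
    obtain ⟨h1, h2, h3⟩ := topScale_spec hy
    exact ⟨_, h1, h2, by rw [hP _ _ _ hz]; exact h3⟩
  const y hy z hz := topScale_eq hP hy hz

theorem cellConst_topScale (hP : ∀ i, D.CellConst i (P i)) : D.CellConst s (topScale s hi P) := by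
  intro y z hz
  have : {i | s ≤ i ∧ i ≤ hi ∧ P i z} = {i | s ≤ i ∧ i ≤ hi ∧ P i y} := by
    ext i
    simp only [Set.mem_ofPred_eq]
    refine and_congr_right fun h1 => and_congr_right fun _ => ?_
    rw [hP i y z (D.cell_mono h1 y hz)]
  rw [topScale, topScale, this]

variable (D)

/-- The average of `g` with respect to `σ` over the cell of generation `i` around `y`. -/
def avg (σ : Measure (Fin d → ℝ)) (g : (Fin d → ℝ) → ℝ≥0∞) (i : ℤ) (y : Fin d → ℝ) : ℝ≥0∞ :=
  (σ (D.cell i y))⁻¹ * ∫⁻ z in D.cell i y, g z ∂σ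

/-- The supremum of the averages over the cells of generation between `i` and `hi`. -/
def supAvg (σ : Measure (Fin d → ℝ)) (g : (Fin d → ℝ) → ℝ≥0∞) (hi i : ℤ) (y : Fin d → ℝ) :
    ℝ≥0∞ := (Finset.Icc i hi).sup fun l => D.avg σ g l y

variable {D} {σ : Measure (Fin d → ℝ)} {g : (Fin d → ℝ) → ℝ≥0∞}

theorem cellConst_avg (i : ℤ) : D.CellConst i (D.avg σ g i) := fun x y hy => by
  rw [avg, avg, cell_eq_of_mem hy]

theorem cellConst_supAvg (i : ℤ) : D.CellConst i (D.supAvg σ g hi i) := fun x y hy =>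
  Finset.sup_congr rfl fun l hl =>
    (cellConst_avg l).mono (Finset.mem_Icc.1 hl).1 x y hy

theorem supAvg_anti {i j : ℤ} (h : i ≤ j) (y : Fin d → ℝ) :
    D.supAvg σ g hi j y ≤ D.supAvg σ g hi i y :=
  Finset.sup_mono (Finset.Icc_subset_Icc_left h)

theorem avg_le_supAvg {i l : ℤ} (h : i ≤ l) (h' : l ≤ hi) (y : Fin d → ℝ) :
    D.avg σ g l y ≤ D.supAvg σ g hi i y :=
  Finset.le_sup (f := fun l => D.avg σ g l y) (Finset.mem_Icc.2 ⟨h, h'⟩)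

theorem avg_lt_top (hg : ∀ i y, ∫⁻ z in D.cell i y, g z ∂σ < ⊤) (i : ℤ) (y : Fin d → ℝ) :
    D.avg σ g i y < ⊤ := by
  rw [avg]
  rcases eq_or_ne (σ (D.cell i y)) 0 with h | h
  · simp [Measure.restrict_eq_zero.2 h]
  · exact ENNReal.mul_lt_top (ENNReal.inv_lt_top.2 (pos_iff_ne_zero.2 h)) (hg i y)

theorem supAvg_lt_top (hg : ∀ i y, ∫⁻ z in D.cell i y, g z ∂σ < ⊤) (i : ℤ) (y : Fin d → ℝ) :
    D.supAvg σ g hi i y < ⊤ :=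
  (Finset.sup_lt_iff (by simp)).2 fun _ _ => avg_lt_top hg _ _

theorem setOf_lt_supAvg (t : ℝ≥0∞) (s : ℤ) : {y | t < D.supAvg σ g hi s y} =
    hitSet s hi fun i y => t < D.avg σ g i y := by
  ext y
  simp only [Set.mem_ofPred_eq, supAvg, Finset.lt_sup_iff, Finset.mem_Icc, hitSet, and_assoc]

/-- The weak type inequality for the dyadic maximal function. -/
theorem mul_measure_lt_supAvg_le [IsLocallyFiniteMeasure σ] (hg : Measurable g) (t : ℝ≥0∞)
    (ht : t ≠ ⊤) (s : ℤ) : t * σ {y | 2 * t < D.supAvg σ g hi s y} ≤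
      ∫⁻ y in {y | t < g y}, g y ∂σ := by
  rw [setOf_lt_supAvg]
  have hst : D.IsStopping (hitSet s hi fun i y => 2 * t < D.avg σ g i y) _ :=
    isStopping_topScale fun i x y hy => by simp only [cellConst_avg i x y hy]
  have hmg : MeasurableSet {y | t < g y} := measurableSet_lt measurable_const hg
  have key := hst.measure_le (μ := t • σ) (ν := σ.withDensity ({y | t < g y}.indicator g)) ?_
  · rw [Measure.smul_apply, smul_eq_mul, withDensity_apply _ hst.measurableSet] at key
    refine key.trans ((setLIntegral_le_lintegral _ _).trans ?_)
    rw [lintegral_indicator hmg]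
  · intro y hy
    obtain ⟨-, -, h⟩ := topScale_spec hy
    set i := topScale s hi (fun i y => 2 * t < D.avg σ g i y) y
    rw [Measure.smul_apply, smul_eq_mul, withDensity_apply _ (D.measurableSet_cell _ _)]
    -- On a maximal cell with average above 2t, the part of g below t accounts for at most half of
    -- the integral; the term t σ(Q) is then cancelled.
    have h1 : ∫⁻ z in D.cell i y, g z ∂σ ≤
        (∫⁻ z in D.cell i y, {y | t < g y}.indicator g z ∂σ) + t * σ (D.cell i y) := by
      rw [← setLIntegral_const, ← lintegral_add_right _ measurable_const]
      refine lintegral_mono fun z => ?_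
      by_cases hz : t < g z
      · simp [Set.indicator, hz]
      · simp only [Set.indicator, Set.mem_ofPred_eq, hz, if_false, zero_add]
        exact not_lt.1 hz
    rcases eq_or_ne (σ (D.cell i y)) 0 with h0 | h0
    · simp [h0]
    have h2 : 2 * t * σ (D.cell i y) ≤ ∫⁻ z in D.cell i y, g z ∂σ := by
      have h3 := mul_le_mul_left h.le (σ (D.cell i y))
      rwa [avg, mul_comm (σ _)⁻¹, mul_assoc (∫⁻ _ in _, _ ∂_), ENNReal.inv_mul_cancel h0
        (D.measure_cell_lt_top σ i y).ne, mul_one] at h3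
    have h4 : t * σ (D.cell i y) + t * σ (D.cell i y) ≤
        (∫⁻ z in D.cell i y, {y | t < g y}.indicator g z ∂σ) + t * σ (D.cell i y) := by
      refine le_trans (le_of_eq ?_) (h2.trans h1)
      ring
    exact (ENNReal.add_le_add_iff_right
      (ENNReal.mul_ne_top ht (D.measure_cell_lt_top σ i y).ne)).1 h4

/-- The strong type inequality for the dyadic maximal function, in terms of the level sets. -/
theorem tsum_measure_lt_supAvg_le (p : ℝ) (hp : 1 < p) : ∃ C : ℝ≥0, ∀ {d : ℕ} (D : DyadicGrid d)
    (σ : Measure (Fin d → ℝ)) [IsLocallyFiniteMeasure σ] (g : (Fin d → ℝ) → ℝ≥0∞),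
    Measurable g → ∀ hi s : ℤ,
    ∑' j : ℤ, ((2 : ℝ≥0∞) ^ j) ^ p * σ {y | 2 ^ j < D.supAvg σ g hi s y} ≤
      C * ∫⁻ y, g y ^ p ∂σ := by
  obtain ⟨C, hC⟩ := tsum_measure_lt_le (p - 1) (by linarith)
  refine ⟨2 ^ p * C, fun {d} D σ _ g hg hi s => ?_⟩
  -- The weak type bound costs one factor 2^j, so the layer-cake sum is used with exponent p - 1 for
  -- the measure g dσ.
  have hstep : ∀ j : ℤ, ((2 : ℝ≥0∞) ^ (j + 1)) ^ p * σ {y | 2 ^ (j + 1) < D.supAvg σ g hi s y} ≤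
      2 ^ p * (((2 : ℝ≥0∞) ^ j) ^ (p - 1) * σ.withDensity g {y | 2 ^ j < g y}) := by
    intro j
    have h1 := mul_measure_lt_supAvg_le (D := D) (σ := σ) (hi := hi) hg ((2 : ℝ≥0∞) ^ j)
      (two_zpow_ne_top j) s
    have e : (2 : ℝ≥0∞) ^ (j + 1) = 2 * 2 ^ j := by rw [two_zpow_add, zpow_one, mul_comm]
    have e2 : ((2 : ℝ≥0∞) ^ j) ^ p = (2 ^ j) ^ (p - 1) * 2 ^ j := by
      nth_rewrite 3 [← ENNReal.rpow_one ((2 : ℝ≥0∞) ^ j)]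
      rw [← ENNReal.rpow_add _ _ (two_zpow_ne_zero j) (two_zpow_ne_top j)]
      ring_nf
    rw [e, ENNReal.mul_rpow_of_nonneg _ _ (by linarith), mul_assoc, e2, mul_assoc,
      withDensity_apply _ (measurableSet_lt measurable_const hg)]
    gcongr
  rw [← (Equiv.addRight (1 : ℤ)).tsum_eq]
  simp only [Equiv.coe_addRight]
  refine (ENNReal.tsum_le_tsum hstep).trans ?_
  rw [ENNReal.tsum_mul_left]
  refine (mul_le_mul_right (hC _ g hg) _).trans (le_of_eq ?_)
  rw [lintegral_withDensity_eq_lintegral_mul _ hg (hg.pow_const _)]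
  have : ∀ y, (g * fun a => g a ^ (p - 1)) y = g y ^ p := by
    intro y
    simp only [Pi.mul_apply]
    rcases eq_or_ne (g y) 0 with h0 | h0
    · rw [h0, zero_mul, ENNReal.zero_rpow_of_pos (by linarith)]
    rcases eq_or_ne (g y) ⊤ with h1 | h1
    · rw [h1, ENNReal.top_rpow_of_pos (by linarith), ENNReal.top_rpow_of_pos (by linarith)]
      simp
    · nth_rewrite 1 [← ENNReal.rpow_one (g y)]
      rw [← ENNReal.rpow_add _ _ h0 h1]
      ring_nf
  simp_rw [this]
  rw [ENNReal.coe_mul, mul_assoc, ENNReal.coe_rpow_of_nonneg _ (by linarith)]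
  rfl

/-- The dyadic version of the maximal function of `fσ`, over the generations from `s` to `hi`. -/
def dyadicMax (D : DyadicGrid d) (σ : Measure (Fin d → ℝ)) (f : (Fin d → ℝ) → ℂ) (s hi : ℤ)
    (x : Fin d → ℝ) : ℝ≥0∞ :=
  (Finset.Icc s hi).sup fun k => (D.cellVol k)⁻¹ * ∫⁻ y in D.cell k x, ‖f y‖ₑ ∂σ

theorem cellConst_dyadicMax (f : (Fin d → ℝ) → ℂ) (s hi : ℤ) :
    D.CellConst s (D.dyadicMax σ f s hi) := fun x y hy =>
  Finset.sup_congr rfl fun l hl => by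
    rw [cell_eq_of_mem (D.cell_mono (Finset.mem_Icc.1 hl).1 x hy)]

theorem le_dyadicMax (f : (Fin d → ℝ) → ℂ) {s hi k : ℤ} (h₁ : s ≤ k) (h₂ : k ≤ hi)
    (x : Fin d → ℝ) : (D.cellVol k)⁻¹ * ∫⁻ y in D.cell k x, ‖f y‖ₑ ∂σ ≤ D.dyadicMax σ f s hi x :=
  Finset.le_sup (f := fun k => (D.cellVol k)⁻¹ * ∫⁻ y in D.cell k x, ‖f y‖ₑ ∂σ)
    (Finset.mem_Icc.2 ⟨h₁, h₂⟩)

theorem dyadicMax_le_maximalFunction (f : (Fin d → ℝ) → ℂ) (s hi : ℤ) (x : Fin d → ℝ) :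
    D.dyadicMax σ f s hi x ≤ maximalFunction σ f x := by
  refine Finset.sup_le fun k _ => le_iSup₂_of_le (D.cubeAt k x) (D.mem_cell_self k x) ?_
  rw [ofReal_vol_cubeAt]
  rfl

end DyadicGrid

/-- The constant is exactly one since 1/2 + 1/4 + ... ≤ 1. The induction carries the last term a
second time, so that two copies of a term fit into its predecessor. -/
theorem DyadicGrid.sum_inv_cellVol_le {d : ℕ} (D : DyadicGrid d) (hd : 0 < d) (q b : ℤ) :
    ∑ j ∈ Finset.Icc (q + 1) b, (D.cellVol j)⁻¹ ≤ (D.cellVol q)⁻¹ := by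
  rcases lt_or_ge b q with h | h
  · rw [Finset.Icc_eq_empty (by omega)]; simp
  suffices H : ∑ j ∈ Finset.Icc (q + 1) b, (D.cellVol j)⁻¹ + (D.cellVol b)⁻¹ ≤ (D.cellVol q)⁻¹ from
    le_self_add.trans H
  induction b, h using Int.leInduction with
  | base => rw [Finset.Icc_eq_empty (by omega)]; simp
  | succ b hb ih =>
    have e : Finset.Icc (q + 1) (b + 1) = insert (b + 1) (Finset.Icc (q + 1) b) := by
      ext j; simp only [Finset.mem_insert, Finset.mem_Icc]; omega
    have h2 : (D.cellVol (b + 1))⁻¹ + (D.cellVol (b + 1))⁻¹ ≤ (D.cellVol b)⁻¹ := by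
      have := D.inv_cellVol_add_le hd b 1
      rw [pow_one, Nat.cast_one] at this
      rw [← two_mul]
      refine (mul_le_mul_right this 2).trans (le_of_eq ?_)
      rw [← mul_assoc, ENNReal.mul_inv_cancel (by norm_num) (by norm_num), one_mul]
    rw [e, Finset.sum_insert (by simp), add_comm (D.cellVol (b + 1))⁻¹, add_assoc]
    exact (add_le_add_right h2 _).trans ih

/-! ### Level sets, their maximal cells, and the maximum principle. -/

/-- A shift, two weights and a function, together with a linearization that attains the maximal
truncation of the function over the generations from `lo` to `hi`. -/
structure ShiftSetup {d : ℕ} (D : DyadicGrid d) (m n : ℕ) where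
  S : GenHaarShift D m n
  σ : Measure (Fin d → ℝ)
  w : Measure (Fin d → ℝ)
  finite_σ : IsLocallyFiniteMeasure σ
  finite_w : IsLocallyFiniteMeasure w
  dim_pos : 0 < d
  p : ℝ
  one_lt_p : 1 < p
  f : (Fin d → ℝ) → ℂ
  measurable_f : Measurable f
  memLp_f : MemLp f (ENNReal.ofReal p) σ
  lo : ℤ
  hi : ℤ
  lo_le : lo ≤ hi
  c : ScaleChoice D (lo - m - 1) lo hi
  lin_eq : ∀ x, S.lin c σ f x = ((S.finMax σ f lo hi x).toReal : ℂ)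

attribute [instance] ShiftSetup.finite_σ ShiftSetup.finite_w

namespace ShiftSetup

variable {d : ℕ} {D : DyadicGrid d} {m n : ℕ} (A : ShiftSetup D m n)

theorem integrableOn_cell {g : (Fin d → ℝ) → ℂ} (hg : MemLp g (ENNReal.ofReal A.p) A.σ) (k : ℤ)
    (x : Fin d → ℝ) : IntegrableOn g (D.cell k x) A.σ := by
  have : IsFiniteMeasure (A.σ.restrict (D.cell k x)) :=
    ⟨by rw [Measure.restrict_apply_univ]; exact D.measure_cell_lt_top A.σ k x⟩
  exact (hg.restrict _).integrable (by
    rw [← ENNReal.ofReal_one]; exact ENNReal.ofReal_le_ofReal A.one_lt_p.le)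

/-- The maximal truncation of `f`. -/
def Sf : (Fin d → ℝ) → ℝ≥0∞ := A.S.finMax A.σ A.f A.lo A.hi

/-- The dyadic maximal function of `fσ`. -/
def Mf : (Fin d → ℝ) → ℝ≥0∞ := D.dyadicMax A.σ A.f (A.lo - m - 1) A.hi

/-- The set where the maximal truncation exceeds `2^k`. -/
def Ω (k : ℤ) : Set (Fin d → ℝ) := {x | (2 : ℝ≥0∞) ^ k < A.Sf x}

theorem Ω_anti {k l : ℤ} (h : k ≤ l) : A.Ω l ⊆ A.Ω k := fun _ hx =>
  (ENNReal.zpow_le_of_le (by norm_num) h).trans_lt hx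

theorem cellConst_Sf : D.CellConst (A.lo - m - 1) A.Sf := GenHaarShift.cellConst_finMax _ _ _ _

theorem cellConst_Mf : D.CellConst (A.lo - m - 1) A.Mf := cellConst_dyadicMax _ _ _

theorem cellConst_mem_Ω (k : ℤ) : D.CellConst (A.lo - m - 1) (· ∈ A.Ω k) := fun x y hy => by
  simp only [Ω, Set.mem_ofPred_eq, A.cellConst_Sf x y hy]

/-- The generation of the maximal cube in `Ω k` around a point. -/
def gen (k : ℤ) : (Fin d → ℝ) → ℤ :=
  topScale (A.lo - m - 1) A.hi fun i x => D.cell i x ⊆ A.Ω k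

theorem cellConst_subset (k i : ℤ) : D.CellConst i (fun x => D.cell i x ⊆ A.Ω k) :=
  fun x y hy => by simp only [cell_eq_of_mem hy]

/-- Since `Sf` is constant on cells of generation `lo - m - 1`, each point of the level set has at
least that cell inside it, so every point lies in a maximal cell. -/
theorem hitSet_eq (k : ℤ) :
    hitSet (A.lo - m - 1) A.hi (fun i x => D.cell i x ⊆ A.Ω k) = A.Ω k := by
  ext x
  refine ⟨fun ⟨i, _, _, h⟩ => h (D.mem_cell_self i x), fun hx => ⟨A.lo - m - 1, le_rfl, ?_, ?_⟩⟩
  · have := A.lo_le; omega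
  · intro y hy
    have := A.cellConst_mem_Ω k x y hy
    simp only [eq_iff_iff] at this
    exact this.2 hx

theorem isStopping_gen (k : ℤ) : D.IsStopping (A.Ω k) (A.gen k) := by
  have := isStopping_topScale (s := A.lo - m - 1) (hi := A.hi) (A.cellConst_subset k)
  rwa [hitSet_eq] at this

theorem measurableSet_Ω (k : ℤ) : MeasurableSet (A.Ω k) := (A.isStopping_gen k).measurableSet

theorem cellConst_gen (k : ℤ) : D.CellConst (A.lo - m - 1) (A.gen k) :=
  cellConst_topScale (A.cellConst_subset k)

variable {A}

theorem gen_spec {k : ℤ} {x : Fin d → ℝ} (hx : x ∈ A.Ω k) :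
    A.lo - m - 1 ≤ A.gen k x ∧ A.gen k x ≤ A.hi ∧ D.cell (A.gen k x) x ⊆ A.Ω k :=
  topScale_spec (by rwa [hitSet_eq])

theorem gen_eq {k : ℤ} {x y : Fin d → ℝ} (hx : x ∈ A.Ω k) (hy : y ∈ D.cell (A.gen k x) x) :
    A.gen k y = A.gen k x := (A.isStopping_gen k).const x hx y hy

theorem gen_anti {k l : ℤ} (h : k ≤ l) {x : Fin d → ℝ} (hx : x ∈ A.Ω l) :
    A.gen l x ≤ A.gen k x := by
  obtain ⟨h1, h2, h3⟩ := gen_spec hx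
  exact le_topScale h1 h2 (h3.trans (A.Ω_anti h))

theorem exists_notMem_of_gen_lt {k : ℤ} {x : Fin d → ℝ} (hx : x ∈ A.Ω k)
    (h : A.gen k x < A.hi) : ∃ z ∈ D.cell (A.gen k x + 1) x, z ∉ A.Ω k := by
  by_contra! hcon
  have := le_topScale (s := A.lo - m - 1) (hi := A.hi) (P := fun i x => D.cell i x ⊆ A.Ω k)
    (y := x) (i := A.gen k x + 1) (by have := (gen_spec hx).1; omega) h hcon
  change A.gen k x + 1 ≤ A.gen k x at this
  omega

variable (A)

/-- The scales above a cube contribute at most the maximal function, for a function on the cube. -/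
theorem sum_enorm_scalePart_le {g : (Fin d → ℝ) → ℂ} {q a b : ℤ} {x : Fin d → ℝ}
    (hq : A.lo - m - 1 ≤ q) (hq' : q ≤ A.hi) (ha : q < a)
    (hg : ∀ y, ‖g y‖ₑ ≤ (D.cell q x).indicator (fun y => ‖A.f y‖ₑ) y) :
    ∑ j ∈ Finset.Icc a b, ‖A.S.scalePart A.σ g j x‖ₑ ≤ A.Mf x := by
  calc ∑ j ∈ Finset.Icc a b, ‖A.S.scalePart A.σ g j x‖ₑ
      ≤ ∑ j ∈ Finset.Icc (q + 1) b, (D.cellVol j)⁻¹ * ∫⁻ y in D.cell q x, ‖A.f y‖ₑ ∂A.σ := by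
        refine (Finset.sum_le_sum_of_subset (Finset.Icc_subset_Icc_left ha)).trans
          (Finset.sum_le_sum fun j _ => (A.S.enorm_scalePart_le _ _ _ _).trans ?_)
        refine mul_le_mul_right ((setLIntegral_le_lintegral _ _).trans ?_) _
        rw [← lintegral_indicator (D.measurableSet_cell q x)]
        exact lintegral_mono hg
    _ ≤ (D.cellVol q)⁻¹ * ∫⁻ y in D.cell q x, ‖A.f y‖ₑ ∂A.σ := by
        rw [← Finset.sum_mul]
        exact mul_le_mul_left (D.sum_inv_cellVol_le A.dim_pos q b) _
    _ ≤ A.Mf x := le_dyadicMax A.f hq hq' x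

theorem enorm_scalePart_le_Mf {g : (Fin d → ℝ) → ℂ} {j : ℤ} {x : Fin d → ℝ}
    (hj : A.lo - m - 1 ≤ j) (hj' : j ≤ A.hi) (hg : ∀ y, ‖g y‖ₑ ≤ ‖A.f y‖ₑ) :
    ‖A.S.scalePart A.σ g j x‖ₑ ≤ A.Mf x :=
  (A.S.enorm_scalePart_le _ _ _ _).trans
    ((mul_le_mul_right (lintegral_mono hg) _).trans (le_dyadicMax A.f hj hj' x))

/-- The few generations for which no comparison or cancellation is available are paid for one by
one; this is where the complexity enters the estimate. -/
theorem sum_enorm_scalePart_Ioc_le {g : (Fin d → ℝ) → ℂ} {t : Finset ℤ} {q : ℤ} {N : ℕ}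
    {x : Fin d → ℝ} (ht : ∀ j ∈ t, A.lo ≤ j ∧ j ≤ A.hi ∧ q < j ∧ j ≤ q + N)
    (hg : ∀ y, ‖g y‖ₑ ≤ ‖A.f y‖ₑ) :
    ∑ j ∈ t, ‖A.S.scalePart A.σ g j x‖ₑ ≤ N * A.Mf x := by
  have hcard : t.card ≤ N := by
    have : t ⊆ Finset.Ioc q (q + N) := fun j hj => by
      have := ht j hj
      simp only [Finset.mem_Ioc]; omega
    simpa using Finset.card_le_card this
  refine (Finset.sum_le_card_nsmul _ _ (A.Mf x) fun j hj => ?_).trans ?_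
  · obtain ⟨h1, h2, -⟩ := ht j hj
    exact A.enorm_scalePart_le_Mf (by omega) h2 hg
  · rw [nsmul_eq_mul]
    gcongr

theorem scalePart_eq_zero {g : (Fin d → ℝ) → ℂ} {j : ℤ} {x : Fin d → ℝ}
    (hg : ∀ y ∈ D.cell j x, g y = 0) : A.S.scalePart A.σ g j x = 0 := by
  rw [GenHaarShift.scalePart]
  refine integral_eq_zero_of_ae (ae_of_all _ fun y => ?_)
  by_cases hy : y ∈ D.cell j x
  · simp [hg y hy]
  · simp [A.S.ker_eq_zero hy]

theorem enorm_indicator_le (s : Set (Fin d → ℝ)) (g : (Fin d → ℝ) → ℂ) (y : Fin d → ℝ) :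
    ‖s.indicator g y‖ₑ ≤ ‖g y‖ₑ := by
  by_cases h : y ∈ s <;> simp [h]

theorem memLp_indicator_f {s : Set (Fin d → ℝ)} (hs : MeasurableSet s) :
    MemLp (s.indicator A.f) (ENNReal.ofReal A.p) A.σ := A.memLp_f.indicator hs

/-- The maximum principle: off the maximal cube `Q ∋ x` of `Ω k`, the function `f` contributes at
most `2^k`, up to the maximal function. -/
theorem enorm_lin_compl_le {k : ℤ} {x : Fin d → ℝ} (hx : x ∈ A.Ω k) :
    ‖A.S.lin A.c A.σ ((D.cell (A.gen k x) x)ᶜ.indicator A.f) x‖ₑ ≤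
      2 ^ k + (m + 2) * A.Mf x := by
  obtain ⟨hq, hq', -⟩ := gen_spec hx
  set q := A.gen k x with hqdef
  set Q := D.cell q x with hQ
  rw [A.S.enorm_lin]
  set a := A.c.a x
  set b := A.c.b x
  have ha : A.lo ≤ a := A.c.le_a x
  have hb : b ≤ A.hi := A.c.b_le x
  have hzero : ∀ j ≤ q, A.S.scalePart A.σ (Qᶜ.indicator A.f) j x = 0 := fun j hj =>
    A.scalePart_eq_zero fun y hy => by
      rw [Set.indicator_of_notMem]
      simpa using D.cell_mono hj x hy
  have hsplit : ∑ j ∈ Finset.Icc a b, A.S.scalePart A.σ (Qᶜ.indicator A.f) j x =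
      ∑ j ∈ Finset.Icc (max a (q + 1)) b, A.S.scalePart A.σ (Qᶜ.indicator A.f) j x := by
    symm
    refine Finset.sum_subset (Finset.Icc_subset_Icc_left (le_max_left _ _)) fun j hj hj' => ?_
    rw [Finset.mem_Icc] at hj hj'
    exact hzero j (by omega)
  rw [hsplit]
  -- A maximal cell of top generation need not have a parent leaving Ω_k, but then no scale of the
  -- truncation lies above it.
  rcases hq'.eq_or_lt with h | h
  · rw [Finset.Icc_eq_empty (by omega)]; simp
  obtain ⟨z, hz, hzΩ⟩ := exists_notMem_of_gen_lt hx h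
  have hzS : A.Sf z ≤ 2 ^ k := not_lt.1 hzΩ
  have hsub : ∀ j, A.S.scalePart A.σ (Qᶜ.indicator A.f) j x =
      A.S.scalePart A.σ A.f j x - A.S.scalePart A.σ (Q.indicator A.f) j x := by
    intro j
    rw [eq_sub_iff_add_eq, ← A.S.scalePart_add
      (A.integrableOn_cell (A.memLp_indicator_f (D.measurableSet_cell q x).compl) j x)
      (A.integrableOn_cell (A.memLp_indicator_f (D.measurableSet_cell q x)) j x)]
    congr 1
    funext y
    exact congrFun (Set.indicator_compl_add_self Q A.f) y
  simp_rw [hsub]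
  rw [Finset.sum_sub_distrib]
  set a' := max a (q + 1)
  have hH : ‖∑ j ∈ Finset.Icc a' b, A.S.scalePart A.σ (Q.indicator A.f) j x‖ₑ ≤ A.Mf x := by
    refine (enorm_sum_le _ _).trans (A.sum_enorm_scalePart_le hq hq' (by omega) fun y => ?_)
    rw [enorm_indicator_eq_indicator_enorm]
  have hF : ‖∑ j ∈ Finset.Icc a' b, A.S.scalePart A.σ A.f j x‖ₑ ≤
      2 ^ k + (m + 1 : ℕ) * A.Mf x := by
    -- From generation q + m + 2 on, the parts of the shift are constant on the parent of Q, so x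
    -- may be replaced by z, where every truncation is at most 2^k. The m + 1 generations in between
    -- are bounded by `Mf` each.
    rw [← Finset.sum_filter_add_sum_filter_not _ (fun j => q + m + 1 < j)]
    refine (enorm_add_le _ _).trans (add_le_add ?_ ((enorm_sum_le _ _).trans
      (A.sum_enorm_scalePart_Ioc_le (q := q) (fun j hj => ?_) fun _ => le_rfl)))
    · refine le_trans (le_of_eq ?_) ((GenHaarShift.enorm_sum_le_finMax
        (a := max a' (q + m + 2)) (b := b) (by omega) hb z).trans hzS)
      have e : (Finset.Icc a' b).filter (fun j => q + m + 1 < j) =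
          Finset.Icc (max a' (q + m + 2)) b := by
        ext j; simp only [Finset.mem_filter, Finset.mem_Icc]; omega
      rw [e]
      congr 1
      refine Finset.sum_congr rfl fun j hj => ?_
      rw [Finset.mem_Icc] at hj
      exact ((A.S.cellConst_scalePart A.σ A.f j).mono (by omega) x z hz).symm
    · simp only [Finset.mem_filter, Finset.mem_Icc] at hj
      push_cast
      omega
  calc _ ≤ _ := enorm_sub_le
    _ ≤ (2 ^ k + (m + 1 : ℕ) * A.Mf x) + A.Mf x := add_le_add hF hH
    _ = _ := by push_cast; ring

/-- The points of `Ω (k + 2)` whose maximal cube is not much smaller than that in `Ω k`. -/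
def shallowSet (k : ℤ) : Set (Fin d → ℝ) := {y ∈ A.Ω (k + 2) | A.gen k y ≤ A.gen (k + 2) y + n}

theorem cellConst_mem_shallowSet (k : ℤ) :
    D.CellConst (A.lo - m - 1) (· ∈ A.shallowSet k) := fun x y hy => by
  have := A.cellConst_mem_Ω (k + 2) x y hy
  simp only at this
  simp only [shallowSet, Set.mem_ofPred_eq, this, A.cellConst_gen k x y hy,
    A.cellConst_gen (k + 2) x y hy]

/-- A common cell no larger than the maximal cell of y would lie in Ω_k and so put x there. Hence y
is visible from x only at scales above its maximal cell. -/
theorem notMem_cell_of_notMem_Ω {k j : ℤ} {x y : Fin d → ℝ} (hx : x ∉ A.Ω k) (hy : y ∈ A.Ω k)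
    (hj : j ≤ A.gen k y) : y ∉ D.cell j x := fun h =>
  hx ((gen_spec hy).2.2 (D.cell_mono hj y (mem_cell_comm.1 h)))

/-- Up to generation q - n nothing of the shallow set is visible from x; the next n generations cost
`Mf` each, and those above q together cost one more by geometric decay. -/
theorem enorm_lin_shallow_le {k : ℤ} {x : Fin d → ℝ} (hx : x ∈ A.Ω k) (hx' : x ∉ A.Ω (k + 2)) :
    ‖A.S.lin A.c A.σ ((D.cell (A.gen k x) x ∩ A.shallowSet k).indicator A.f) x‖ₑ ≤
      (n + 1) * A.Mf x := by
  obtain ⟨hq, hq', -⟩ := gen_spec hx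
  set q := A.gen k x with hqdef
  set B := D.cell q x ∩ A.shallowSet k with hB
  have ha : A.lo ≤ A.c.a x := A.c.le_a x
  have hb : A.c.b x ≤ A.hi := A.c.b_le x
  have hzero : ∀ j ≤ q - n, A.S.scalePart A.σ (B.indicator A.f) j x = 0 := by
    refine fun j hj => A.scalePart_eq_zero fun y hy => Set.indicator_of_notMem ?_ _
    rintro ⟨h1, h2, h3⟩
    rw [gen_eq hx h1] at h3
    exact A.notMem_cell_of_notMem_Ω hx' h2 (by omega) hy
  rw [A.S.enorm_lin]
  refine (enorm_sum_le _ _).trans ?_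
  have e : ∑ j ∈ Finset.Icc (A.c.a x) (A.c.b x), ‖A.S.scalePart A.σ (B.indicator A.f) j x‖ₑ =
      ∑ j ∈ Finset.Icc (max (A.c.a x) (q - n + 1)) (A.c.b x),
        ‖A.S.scalePart A.σ (B.indicator A.f) j x‖ₑ := by
    symm
    refine Finset.sum_subset (Finset.Icc_subset_Icc_left (le_max_left _ _)) fun j hj hj' => ?_
    rw [Finset.mem_Icc] at hj hj'
    rw [hzero j (by omega), enorm_zero]
  rw [e, ← Finset.sum_filter_add_sum_filter_not _ (fun j => j ≤ q), add_mul, one_mul]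
  refine add_le_add (A.sum_enorm_scalePart_Ioc_le (q := q - n) (fun j hj => ?_) fun y =>
    enorm_indicator_le _ _ y) ?_
  · simp only [Finset.mem_filter, Finset.mem_Icc] at hj
    omega
  · refine le_trans (Finset.sum_le_sum_of_subset (t := Finset.Icc (q + 1) (A.c.b x)) ?_)
      (A.sum_enorm_scalePart_le hq hq' (by omega) fun y => ?_)
    · intro j hj
      simp only [Finset.mem_filter, Finset.mem_Icc] at hj ⊢
      omega
    · rw [enorm_indicator_eq_indicator_enorm]
      exact Set.indicator_le_indicator_of_subset Set.inter_subset_left (fun _ => by simp) y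

end ShiftSetup

/-! ### Averages over reference cells, and the good and bad parts of the deep set. -/

namespace ShiftSetup

variable {d : ℕ} {D : DyadicGrid d} {m n : ℕ} (A : ShiftSetup D m n)

/-- The averages of `|f|` with respect to `σ`, maximized over the generations above `i`. -/
def af (i : ℤ) : (Fin d → ℝ) → ℝ≥0∞ := D.supAvg A.σ (fun y => ‖A.f y‖ₑ) A.hi i

theorem cellConst_af (i : ℤ) : D.CellConst i (A.af i) := cellConst_supAvg i

theorem af_anti {i j : ℤ} (h : i ≤ j) (y : Fin d → ℝ) : A.af j y ≤ A.af i y := supAvg_anti h y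

theorem af_ne_top (i : ℤ) (y : Fin d → ℝ) : A.af i y ≠ ⊤ :=
  (supAvg_lt_top (fun i y => (A.integrableOn_cell A.memLp_f i y).hasFiniteIntegral) i y).ne

/-- The generation of the cells on which `f` may be replaced by its average. -/
def refGen (k : ℤ) (y : Fin d → ℝ) : ℤ := A.gen (k + 2) y - n

/-- The average of `f` over the cell of generation `refGen`. -/
def refAvg (k : ℤ) (y : Fin d → ℝ) : ℂ :=
  ((A.σ (D.cell (A.refGen k y) y)).toReal : ℂ)⁻¹ * ∫ z in D.cell (A.refGen k y) y, A.f z ∂A.σ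

/-- The points of `Ω (k + 2)` whose maximal cube is much smaller than that in `Ω k`. -/
def deepSet (k : ℤ) : Set (Fin d → ℝ) := {y ∈ A.Ω (k + 2) | A.gen (k + 2) y + n < A.gen k y}

/-- The points of the deep set at which the averages of `f` have increased. -/
def badSet (k : ℤ) : Set (Fin d → ℝ) :=
  {y ∈ A.deepSet k | 2 * A.af (A.gen k y) y < A.af (A.refGen k y) y}

/-- The points of the deep set at which the averages of `f` have not increased. -/
def goodSet (k : ℤ) : Set (Fin d → ℝ) := A.deepSet k \ A.badSet k

variable {A}

theorem cell_refGen_subset {k : ℤ} (y : Fin d → ℝ) :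
    D.cell (A.refGen k y) y ⊆ D.cell (A.gen (k + 2) y) y :=
  D.cell_mono (by unfold refGen; omega) y

theorem gen_add_two_eq {k : ℤ} {y z : Fin d → ℝ} (hy : y ∈ A.Ω (k + 2))
    (hz : z ∈ D.cell (A.refGen k y) y) : A.gen (k + 2) z = A.gen (k + 2) y :=
  gen_eq hy (cell_refGen_subset y hz)

theorem refGen_eq {k : ℤ} {y z : Fin d → ℝ} (hy : y ∈ A.Ω (k + 2))
    (hz : z ∈ D.cell (A.refGen k y) y) : A.refGen k z = A.refGen k y := by
  rw [refGen, refGen, gen_add_two_eq hy hz]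

theorem mem_cell_gen {k : ℤ} {y z : Fin d → ℝ} (hy : y ∈ A.Ω (k + 2))
    (hz : z ∈ D.cell (A.refGen k y) y) : z ∈ D.cell (A.gen k y) y :=
  D.cell_mono (gen_anti (by omega) hy) y (cell_refGen_subset y hz)

theorem gen_eq_of_mem {k : ℤ} {y z : Fin d → ℝ} (hy : y ∈ A.Ω (k + 2))
    (hz : z ∈ D.cell (A.refGen k y) y) : A.gen k z = A.gen k y :=
  gen_eq (A.Ω_anti (by omega) hy) (mem_cell_gen hy hz)

theorem cell_refGen_subset_Ω {k : ℤ} {y : Fin d → ℝ} (hy : y ∈ A.Ω (k + 2)) :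
    D.cell (A.refGen k y) y ⊆ A.Ω (k + 2) :=
  (cell_refGen_subset y).trans (gen_spec hy).2.2

theorem cell_refGen_subset_deepSet {k : ℤ} {y : Fin d → ℝ} (hy : y ∈ A.deepSet k) :
    D.cell (A.refGen k y) y ⊆ A.deepSet k := fun z hz =>
  ⟨cell_refGen_subset_Ω hy.1 hz, by
    rw [gen_add_two_eq hy.1 hz, gen_eq_of_mem hy.1 hz]; exact hy.2⟩

theorem af_eq_af {k : ℤ} {y z : Fin d → ℝ} (hy : y ∈ A.Ω (k + 2))
    (hz : z ∈ D.cell (A.refGen k y) y) :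
    A.af (A.gen k z) z = A.af (A.gen k y) y ∧ A.af (A.refGen k z) z = A.af (A.refGen k y) y := by
  rw [gen_eq_of_mem hy hz, refGen_eq hy hz]
  exact ⟨A.cellConst_af _ _ _ (mem_cell_gen hy hz), A.cellConst_af _ _ _ hz⟩

theorem cell_refGen_subset_badSet {k : ℤ} {y : Fin d → ℝ} (hy : y ∈ A.badSet k) :
    D.cell (A.refGen k y) y ⊆ A.badSet k := fun z hz =>
  ⟨cell_refGen_subset_deepSet hy.1 hz, by
    rw [(af_eq_af hy.1.1 hz).1, (af_eq_af hy.1.1 hz).2]; exact hy.2⟩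

theorem cell_refGen_subset_goodSet {k : ℤ} {y : Fin d → ℝ} (hy : y ∈ A.goodSet k) :
    D.cell (A.refGen k y) y ⊆ A.goodSet k := fun z hz =>
  ⟨cell_refGen_subset_deepSet hy.1 hz, fun h => hy.2
    ⟨hy.1, by rw [← (af_eq_af hy.1.1 hz).1, ← (af_eq_af hy.1.1 hz).2]; exact h.2⟩⟩

variable (A)

theorem isStopping_inter {k : ℤ} {q : ℤ} {x : Fin d → ℝ} (hx : x ∈ A.Ω k)
    (hq : q = A.gen k x) {B : Set (Fin d → ℝ)} (hB : B ⊆ A.Ω (k + 2))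
    (h : ∀ y ∈ B, D.cell (A.refGen k y) y ⊆ B) :
    D.IsStopping (D.cell q x ∩ B) (A.refGen k) where
  subset y hy := Set.subset_inter (fun z hz => by
    subst hq
    have := mem_cell_gen (hB hy.2) hz
    rw [gen_eq hx hy.1] at this
    rwa [cell_eq_of_mem hy.1] at this) (h y hy.2)
  const _ hy _ hz := refGen_eq (hB hy.2) hz

theorem isStopping_of_subset {k : ℤ} {B : Set (Fin d → ℝ)} (hB : B ⊆ A.Ω (k + 2))
    (h : ∀ y ∈ B, D.cell (A.refGen k y) y ⊆ B) : D.IsStopping B (A.refGen k) where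
  subset := h
  const _ hy _ hz := refGen_eq (hB hy) hz

theorem measurableSet_badSet (k : ℤ) : MeasurableSet (A.badSet k) :=
  (A.isStopping_of_subset (fun _ h => h.1.1)
    fun _ h => cell_refGen_subset_badSet h).measurableSet

theorem measurableSet_goodSet (k : ℤ) : MeasurableSet (A.goodSet k) :=
  (A.isStopping_of_subset (fun _ h => h.1.1)
    fun _ h => cell_refGen_subset_goodSet h).measurableSet

theorem measurableSet_shallowSet (k : ℤ) : MeasurableSet (A.shallowSet k) :=
  (A.cellConst_mem_shallowSet k).measurableSet

theorem le_refGen {k : ℤ} {y : Fin d → ℝ} (hy : y ∈ A.Ω (k + 2)) :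
    A.lo - m - 1 - n ≤ A.refGen k y := by
  have := (gen_spec hy).1
  unfold refGen; omega

theorem cellConst_indicator_refAvg {k : ℤ} {B : Set (Fin d → ℝ)} (hB : B ⊆ A.Ω (k + 2))
    (h : ∀ y ∈ B, D.cell (A.refGen k y) y ⊆ B) :
    D.CellConst (A.lo - m - 1 - n) (B.indicator (A.refAvg k)) := by
  have key : ∀ x y, x ∈ B → y ∈ D.cell (A.lo - m - 1 - n) x →
      B.indicator (A.refAvg k) y = B.indicator (A.refAvg k) x := by
    intro x y hx hy
    have hy' := D.cell_mono (A.le_refGen (hB hx)) x hy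
    rw [Set.indicator_of_mem hx, Set.indicator_of_mem (h x hx hy'), refAvg, refAvg,
      refGen_eq (hB hx) hy', cell_eq_of_mem hy']
  intro x y hy
  by_cases hx : x ∈ B
  · exact key x y hx hy
  by_cases hyB : y ∈ B
  · exact (key y x hyB (mem_cell_comm.1 hy)).symm
  · rw [Set.indicator_of_notMem hx, Set.indicator_of_notMem hyB]

theorem enorm_refAvg_le {k : ℤ} {y : Fin d → ℝ} (hy : y ∈ A.Ω (k + 2)) :
    ‖A.refAvg k y‖ₑ ≤ A.af (A.refGen k y) y := by
  have hle : A.refGen k y ≤ A.hi := by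
    have := (gen_spec hy).2.1
    unfold refGen; omega
  refine le_trans ?_ (avg_le_supAvg le_rfl hle y)
  rw [refAvg, avg, enorm_mul]
  have hfin := (D.measure_cell_lt_top A.σ (A.refGen k y) y).ne
  refine mul_le_mul' ?_ (enorm_integral_le_lintegral_enorm _)
  rcases eq_or_ne (A.σ (D.cell (A.refGen k y) y)) 0 with h0 | h0
  · simp [h0]
  · rw [enorm_inv (by simp [ENNReal.toReal_eq_zero_iff, h0, hfin]), ← ofReal_norm,
      Complex.norm_real, Real.norm_of_nonneg ENNReal.toReal_nonneg, ENNReal.ofReal_toReal hfin]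

/-- The bound no longer depends on the position of y inside its maximal cell of Ω_k, so it can be
taken out of the integral after duality. -/
theorem enorm_refAvg_le_of_mem_goodSet {k : ℤ} {y : Fin d → ℝ} (hy : y ∈ A.goodSet k) :
    ‖A.refAvg k y‖ₑ ≤ 2 * A.af (A.gen k y) y :=
  (A.enorm_refAvg_le hy.1.1).trans (not_lt.1 fun h => hy.2 ⟨hy.1, h⟩)

/-- Only finiteness is extracted here from the maximal theorem; it puts the averaged parts of f in
L^p(σ), so that the testing condition may be applied to them. -/
theorem lintegral_af_rpow_lt_top (i : ℤ) : ∫⁻ y, A.af i y ^ A.p ∂A.σ < ⊤ := by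
  have hp0 : 0 < A.p := one_pos.trans A.one_lt_p
  obtain ⟨C, hC⟩ := tsum_measure_lt_supAvg_le A.p A.one_lt_p
  have hf : ∫⁻ y, ‖A.f y‖ₑ ^ A.p ∂A.σ < ⊤ := by
    have := lintegral_rpow_enorm_lt_top_of_eLpNorm_lt_top (by simpa using hp0) (by simp)
      A.memLp_f.eLpNorm_lt_top
    rwa [ENNReal.toReal_ofReal hp0.le] at this
  refine (lintegral_rpow_le_tsum hp0 A.σ (A.cellConst_af i).measurable (A.af_ne_top i)).trans_lt ?_
  have h2 : ∀ j : ℤ, ((2 : ℝ≥0∞) ^ (j + 1)) ^ A.p *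
      A.σ {x | 2 ^ j < A.af i x ∧ A.af i x ≤ 2 ^ (j + 1)} ≤
        2 ^ A.p * (((2 : ℝ≥0∞) ^ j) ^ A.p * A.σ {x | 2 ^ j < A.af i x}) := by
    intro j
    rw [two_zpow_add, zpow_one, mul_comm (_ ^ j), ENNReal.mul_rpow_of_nonneg _ _ hp0.le, mul_assoc]
    gcongr
    exact And.left
  refine (ENNReal.tsum_le_tsum h2).trans_lt ?_
  rw [ENNReal.tsum_mul_left]
  refine ENNReal.mul_lt_top (ENNReal.rpow_lt_top_of_nonneg hp0.le (by simp))
    ((hC D A.σ _ A.measurable_f.enorm A.hi i).trans_lt ?_)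
  exact ENNReal.mul_lt_top ENNReal.coe_lt_top hf

theorem memLp_indicator_refAvg {k : ℤ} {B : Set (Fin d → ℝ)} (hB : B ⊆ A.Ω (k + 2))
    (h : ∀ y ∈ B, D.cell (A.refGen k y) y ⊆ B) :
    MemLp (B.indicator (A.refAvg k)) (ENNReal.ofReal A.p) A.σ := by
  have hp0 : 0 < A.p := one_pos.trans A.one_lt_p
  refine ⟨(A.cellConst_indicator_refAvg hB h).measurable.aestronglyMeasurable, ?_⟩
  refine (eLpNorm_lt_top_iff_lintegral_rpow_enorm_lt_top (by simpa using hp0) (by simp)).2 ?_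
  rw [ENNReal.toReal_ofReal hp0.le]
  refine (lintegral_mono fun y => ?_).trans_lt (A.lintegral_af_rpow_lt_top (A.lo - m - 1 - n))
  refine ENNReal.rpow_le_rpow ?_ hp0.le
  by_cases hy : y ∈ B
  · rw [Set.indicator_of_mem hy]
    exact (A.enorm_refAvg_le (hB hy)).trans (A.af_anti (A.le_refGen (hB hy)) y)
  · simp [hy]

/-- On the reference cells the kernel is constant, for points off `Ω (k + 2)`. -/
theorem ker_eq_of_mem_cell_refGen {k j : ℤ} {x y z : Fin d → ℝ} (hx : x ∉ A.Ω (k + 2))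
    (hy : y ∈ A.Ω (k + 2)) (hz : z ∈ D.cell (A.refGen k y) y) :
    A.S.ker j x z = A.S.ker j x y := by
  have hzΩ := cell_refGen_subset_Ω hy hz
  have hzg := gen_add_two_eq hy hz
  -- Small scales do not see the cell from x. At larger ones j - n - 1 ≥ gen - n, and the kernel is
  -- constant on cells of generation j - n - 1; this is why `refGen` is n below the maximal cell.
  by_cases hj : j ≤ A.gen (k + 2) y
  · rw [A.S.ker_eq_zero (A.notMem_cell_of_notMem_Ω hx hy hj),
      A.S.ker_eq_zero (A.notMem_cell_of_notMem_Ω hx hzΩ (by omega))]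
  · exact (A.S.cellConst_ker_right j x).mono (by unfold refGen; omega) y z hz

/-- The set D.cell q x ∩ B is a disjoint union of reference cells on which the kernel is constant,
and on each of them f and its average have the same integral. -/
theorem scalePart_refAvg_eq {k j q : ℤ} {x : Fin d → ℝ} (hx : x ∈ A.Ω k)
    (hx' : x ∉ A.Ω (k + 2)) (hq : q = A.gen k x) {B : Set (Fin d → ℝ)} (hB : B ⊆ A.Ω (k + 2))
    (h : ∀ y ∈ B, D.cell (A.refGen k y) y ⊆ B) :
    A.S.scalePart A.σ ((D.cell q x ∩ B).indicator A.f) j x =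
      A.S.scalePart A.σ ((D.cell q x ∩ B).indicator (A.refAvg k)) j x := by
  have hst := A.isStopping_inter hx hq hB h
  have hr : MemLp ((D.cell q x ∩ B).indicator (A.refAvg k)) (ENNReal.ofReal A.p) A.σ := by
    rw [← Set.indicator_indicator]
    exact (A.memLp_indicator_refAvg hB h).indicator (D.measurableSet_cell q x)
  have e : ∀ g : (Fin d → ℝ) → ℂ, A.S.scalePart A.σ ((D.cell q x ∩ B).indicator g) j x =
      ∫ y in D.cell q x ∩ B, A.S.ker j x y * g y ∂A.σ := by
    intro g
    rw [GenHaarShift.scalePart, ← integral_indicator hst.measurableSet]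
    congr 1; funext y
    by_cases hy : y ∈ D.cell q x ∩ B <;> simp [hy]
  have e' : ∀ g : (Fin d → ℝ) → ℂ,
      MemLp ((D.cell q x ∩ B).indicator g) (ENNReal.ofReal A.p) A.σ →
      IntegrableOn (fun y => A.S.ker j x y * g y) (D.cell q x ∩ B) A.σ := by
    intro g hg
    rw [← integrable_indicator_iff hst.measurableSet]
    refine (A.S.integrable_ker_mul (k := j) (x := x) (A.integrableOn_cell hg j x)).congr
      (ae_of_all _ fun y => ?_)
    by_cases hy : y ∈ D.cell q x ∩ B <;> simp [hy]
  rw [e, e]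
  refine hst.integral_congr (e' _ (A.memLp_indicator_f hst.measurableSet)) (e' _ hr) fun y hy => ?_
  have hyΩ := hB hy.2
  set R := D.cell (A.refGen k y) y with hR
  have hRm : MeasurableSet R := D.measurableSet_cell _ _
  have hfin := (D.measure_cell_lt_top A.σ (A.refGen k y) y).ne
  have h1 : ∫ z in R, A.S.ker j x z * A.f z ∂A.σ = A.S.ker j x y * ∫ z in R, A.f z ∂A.σ := by
    rw [← integral_const_mul]
    exact setIntegral_congr_fun hRm fun z hz => by
      simp only [A.ker_eq_of_mem_cell_refGen hx' hyΩ hz]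
  have h2 : ∫ z in R, A.S.ker j x z * A.refAvg k z ∂A.σ =
      ∫ z in R, A.S.ker j x y * A.refAvg k y ∂A.σ := by
    refine setIntegral_congr_fun hRm fun z hz => ?_
    simp only [A.ker_eq_of_mem_cell_refGen hx' hyΩ hz, refAvg, refGen_eq hyΩ hz]
    rw [cell_eq_of_mem hz]
  rw [h1, h2, setIntegral_const, refAvg, ← hR]
  rcases eq_or_ne (A.σ R) 0 with h0 | h0
  · simp [Measure.real, h0, Measure.restrict_eq_zero.2 h0]
  · have : ((A.σ R).toReal : ℂ) ≠ 0 :=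
      Complex.ofReal_ne_zero.2 (ENNReal.toReal_ne_zero.2 ⟨h0, hfin⟩)
    rw [Measure.real, Complex.real_smul]
    field_simp

/-- The part of `f`, at level `k`, that is controlled by the testing condition. -/
def testPart (k : ℤ) (y : Fin d → ℝ) : ℂ :=
  (A.Ω k \ A.Ω (k + 2)).indicator A.f y + (A.badSet k).indicator (A.refAvg k) y

/-- The part of `f`, at level `k`, that is controlled by the adjoint. -/
def goodPart (k : ℤ) : (Fin d → ℝ) → ℂ := (A.goodSet k).indicator (A.refAvg k)

theorem memLp_goodPart (k : ℤ) : MemLp (A.goodPart k) (ENNReal.ofReal A.p) A.σ :=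
  A.memLp_indicator_refAvg (fun _ h => h.1.1) fun _ h => cell_refGen_subset_goodSet h

theorem memLp_badPart (k : ℤ) :
    MemLp ((A.badSet k).indicator (A.refAvg k)) (ENNReal.ofReal A.p) A.σ :=
  A.memLp_indicator_refAvg (fun _ h => h.1.1) fun _ h => cell_refGen_subset_badSet h

theorem memLp_testPart (k : ℤ) : MemLp (A.testPart k) (ENNReal.ofReal A.p) A.σ :=
  (A.memLp_indicator_f ((A.measurableSet_Ω k).diff (A.measurableSet_Ω (k + 2)))).add
    (A.memLp_badPart k)

theorem lin_congr {g h : (Fin d → ℝ) → ℂ} {x : Fin d → ℝ}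
    (hgh : ∀ j, A.S.scalePart A.σ g j x = A.S.scalePart A.σ h j x) :
    A.S.lin A.c A.σ g x = A.S.lin A.c A.σ h x := by
  rw [GenHaarShift.lin, GenHaarShift.lin]
  simp_rw [hgh]

theorem lin_add_of_memLp {g h : (Fin d → ℝ) → ℂ} (hg : MemLp g (ENNReal.ofReal A.p) A.σ)
    (hh : MemLp h (ENNReal.ofReal A.p) A.σ) (x : Fin d → ℝ) :
    A.S.lin A.c A.σ (fun y => g y + h y) x = A.S.lin A.c A.σ g x + A.S.lin A.c A.σ h x :=
  A.S.lin_add A.c (fun k => A.integrableOn_cell hg k x) fun k => A.integrableOn_cell hh k x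

/-- What is left over is the piece of f off Q and the shallow piece; their costs m + 2 and n + 1 add
up to m + n + 3. -/
theorem enorm_lin_sub_le {k : ℤ} {x : Fin d → ℝ} (hx : x ∈ A.Ω k) (hx' : x ∉ A.Ω (k + 2)) :
    ‖A.S.lin A.c A.σ A.f x -
      (A.S.lin A.c A.σ ((D.cell (A.gen k x) x).indicator (A.testPart k)) x +
        A.S.lin A.c A.σ ((D.cell (A.gen k x) x).indicator (A.goodPart k)) x)‖ₑ ≤
      2 ^ k + (m + n + 3) * A.Mf x := by
  set Q := D.cell (A.gen k x) x with hQ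
  have hQm : MeasurableSet Q := D.measurableSet_cell _ _
  have hQΩ : Q ⊆ A.Ω k := (gen_spec hx).2.2
  set T := A.Ω k \ A.Ω (k + 2) with hT
  have hTm : MeasurableSet T := (A.measurableSet_Ω k).diff (A.measurableSet_Ω (k + 2))
  have hbad := A.measurableSet_badSet k
  have hgood := A.measurableSet_goodSet k
  have hsh := A.measurableSet_shallowSet k
  have hdec : A.f = fun y => ((Qᶜ.indicator A.f y + (Q ∩ A.shallowSet k).indicator A.f y) +
      ((Q ∩ T).indicator A.f y + (Q ∩ A.badSet k).indicator A.f y)) +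
        (Q ∩ A.goodSet k).indicator A.f y := by
    funext y
    by_cases hy : y ∈ Q
    swap
    · simp [hy]
    by_cases h1 : y ∈ A.Ω (k + 2)
    swap
    · have h2 : y ∈ T := ⟨hQΩ hy, h1⟩
      have h3 : y ∉ A.shallowSet k := fun h => h1 h.1
      have h4 : y ∉ A.badSet k := fun h => h1 h.1.1
      have h5 : y ∉ A.goodSet k := fun h => h1 h.1.1
      simp [hy, h2, h3, h4, h5]
    have h2 : y ∉ T := fun h => h.2 h1
    by_cases h3 : A.gen k y ≤ A.gen (k + 2) y + n
    · have h3' : y ∈ A.shallowSet k := ⟨h1, h3⟩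
      have h4 : y ∉ A.badSet k := fun h => not_lt.2 h3 h.1.2
      have h5 : y ∉ A.goodSet k := fun h => not_lt.2 h3 h.1.2
      simp [hy, h2, h3', h4, h5]
    have h3' : y ∉ A.shallowSet k := fun h => h3 h.2
    have h6 : y ∈ A.deepSet k := ⟨h1, not_le.1 h3⟩
    by_cases h4 : y ∈ A.badSet k
    · have h5 : y ∉ A.goodSet k := fun h => h.2 h4
      simp [hy, h2, h3', h4, h5]
    · have h5 : y ∈ A.goodSet k := ⟨h6, h4⟩
      simp [hy, h2, h3', h4, h5]
  have m1 := A.memLp_indicator_f hQm.compl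
  have m2 := A.memLp_indicator_f (hQm.inter hsh)
  have m3 := A.memLp_indicator_f (hQm.inter hTm)
  have m4 := A.memLp_indicator_f (hQm.inter hbad)
  have m5 := A.memLp_indicator_f (hQm.inter hgood)
  have e1 : A.S.lin A.c A.σ A.f x =
      ((A.S.lin A.c A.σ (Qᶜ.indicator A.f) x +
        A.S.lin A.c A.σ ((Q ∩ A.shallowSet k).indicator A.f) x) +
      (A.S.lin A.c A.σ ((Q ∩ T).indicator A.f) x +
        A.S.lin A.c A.σ ((Q ∩ A.badSet k).indicator A.f) x)) +
        A.S.lin A.c A.σ ((Q ∩ A.goodSet k).indicator A.f) x := by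
    conv_lhs => rw [hdec]
    have m12 : MemLp (fun y => Qᶜ.indicator A.f y + (Q ∩ A.shallowSet k).indicator A.f y)
      (ENNReal.ofReal A.p) A.σ := m1.add m2
    have m34 : MemLp (fun y => (Q ∩ T).indicator A.f y + (Q ∩ A.badSet k).indicator A.f y)
      (ENNReal.ofReal A.p) A.σ := m3.add m4
    have m14 : MemLp (fun y => (Qᶜ.indicator A.f y + (Q ∩ A.shallowSet k).indicator A.f y) +
        ((Q ∩ T).indicator A.f y + (Q ∩ A.badSet k).indicator A.f y))
      (ENNReal.ofReal A.p) A.σ := m12.add m34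
    rw [A.lin_add_of_memLp m14 m5, A.lin_add_of_memLp m12 m34, A.lin_add_of_memLp m1 m2,
      A.lin_add_of_memLp m3 m4]
  have e2 : A.S.lin A.c A.σ (Q.indicator (A.testPart k)) x =
      A.S.lin A.c A.σ ((Q ∩ T).indicator A.f) x +
        A.S.lin A.c A.σ ((Q ∩ A.badSet k).indicator A.f) x := by
    have h1 : Q.indicator (A.testPart k) = fun y => (Q ∩ T).indicator A.f y +
        (Q ∩ A.badSet k).indicator (A.refAvg k) y := by
      funext y
      by_cases hy : y ∈ Q <;> by_cases hy' : y ∈ T <;> by_cases hy'' : y ∈ A.badSet k <;>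
        simp [hy, testPart, hy', hy'', ← hT]
    have m6 : MemLp ((Q ∩ A.badSet k).indicator (A.refAvg k)) (ENNReal.ofReal A.p) A.σ := by
      rw [← Set.indicator_indicator]
      exact (A.memLp_badPart k).indicator hQm
    rw [h1, A.lin_add_of_memLp m3 m6]
    congr 1
    exact A.lin_congr fun j => (A.scalePart_refAvg_eq hx hx' rfl (fun _ h => h.1.1)
      fun _ h => cell_refGen_subset_badSet h).symm
  have e3 : A.S.lin A.c A.σ (Q.indicator (A.goodPart k)) x =
      A.S.lin A.c A.σ ((Q ∩ A.goodSet k).indicator A.f) x := by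
    rw [goodPart, Set.indicator_indicator]
    exact A.lin_congr fun j => (A.scalePart_refAvg_eq hx hx' rfl (fun _ h => h.1.1)
      fun _ h => cell_refGen_subset_goodSet h).symm
  have e4 : A.S.lin A.c A.σ A.f x - (A.S.lin A.c A.σ (Q.indicator (A.testPart k)) x +
      A.S.lin A.c A.σ (Q.indicator (A.goodPart k)) x) =
      A.S.lin A.c A.σ (Qᶜ.indicator A.f) x +
        A.S.lin A.c A.σ ((Q ∩ A.shallowSet k).indicator A.f) x := by
    rw [e1, e2, e3]; ring
  rw [e4]
  refine (enorm_add_le _ _).trans ((add_le_add (A.enorm_lin_compl_le hx)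
    (A.enorm_lin_shallow_le hx hx')).trans (le_of_eq ?_))
  ring

end ShiftSetup

/-! ### The estimate on one maximal cell. -/

/-- A finite best constant is itself admissible. Finiteness of the infimum is needed when a = 0,
where it supplies an admissible constant and hence b = 0. -/
theorem le_sInf_mul {s : Set ℝ≥0∞} (hs : sInf s ≠ ⊤) {a b : ℝ≥0∞} (ha : a ≠ ⊤)
    (h : ∀ T ∈ s, b ≤ T * a) : b ≤ sInf s * a := by
  rcases eq_or_ne a 0 with rfl | h0
  · obtain ⟨T, hT⟩ : s.Nonempty := by
      by_contra hne
      rw [Set.not_nonempty_iff_eq_empty.1 hne, sInf_empty] at hs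
      exact hs rfl
    simpa using h T hT
  · rw [← ENNReal.div_le_iff h0 ha]
    exact le_sInf fun T hT => ENNReal.div_le_of_le_mul (h T hT)

theorem ofReal_two_zpow (k : ℤ) : ENNReal.ofReal ((2 : ℝ) ^ k) = 2 ^ k := by
  rw [← Real.rpow_intCast, ← ENNReal.ofReal_rpow_of_pos two_pos, ENNReal.rpow_intCast,
    ENNReal.ofReal_ofNat]

theorem toReal_two_zpow (k : ℤ) : ((2 : ℝ≥0∞) ^ k).toReal = 2 ^ k := by
  rw [← ofReal_two_zpow, ENNReal.toReal_ofReal (by positivity)]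

theorem exists_enorm_lin_le {d : ℕ} {D : DyadicGrid d} {m n : ℕ} (S : GenHaarShift D m n)
    {s lo hi : ℤ} (c : ScaleChoice D s lo hi) {σ : Measure (Fin d → ℝ)} {g : (Fin d → ℝ) → ℂ}
    (hg : Integrable g σ) : ∃ C : ℝ, ∀ x, ‖S.lin c σ g x‖ ≤ C := by
  have hfin : ∑ k ∈ Finset.Icc lo hi, (D.cellVol k)⁻¹ * ∫⁻ y, ‖g y‖ₑ ∂σ < ⊤ :=
    ENNReal.sum_lt_top.2 fun k _ => ENNReal.mul_lt_top
      (ENNReal.inv_lt_top.2 (pos_iff_ne_zero.2 (D.cellVol_ne_zero k))) hg.hasFiniteIntegral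
  refine ⟨(∑ k ∈ Finset.Icc lo hi, (D.cellVol k)⁻¹ * ∫⁻ y, ‖g y‖ₑ ∂σ).toReal, fun x => ?_⟩
  rw [← toReal_enorm]
  refine ENNReal.toReal_mono hfin.ne ?_
  rw [S.lin_eq_sum]
  refine (enorm_sum_le _ _).trans (Finset.sum_le_sum fun k _ => ?_)
  rw [enorm_mul]
  have h1 : ‖c.coef k x‖ₑ ≤ 1 := by
    rw [← ofReal_norm, ← ENNReal.ofReal_one]
    exact ENNReal.ofReal_le_ofReal (c.norm_coef_le k x)
  calc _ ≤ 1 * ‖S.scalePart σ g k x‖ₑ := mul_le_mul_left h1 _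
    _ ≤ _ := by
      rw [one_mul]
      exact (S.enorm_scalePart_le σ g k x).trans
        (mul_le_mul_right (setLIntegral_le_lintegral _ _) _)

namespace ShiftSetup

variable {d : ℕ} {D : DyadicGrid d} {m n : ℕ} (A : ShiftSetup D m n)

/-- The points of level `k` at which the maximal function is small. -/
def E (k : ℤ) : Set (Fin d → ℝ) :=
  {x | (2 : ℝ≥0∞) ^ (k + 1) < A.Sf x ∧ A.Sf x ≤ 2 ^ (k + 2) ∧ (m + n + 3) * A.Mf x ≤ 2 ^ (k - 1)}

theorem cellConst_mem_E (k : ℤ) : D.CellConst (A.lo - m - 1) (· ∈ A.E k) := fun x y hy => by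
  simp only [E, Set.mem_ofPred_eq, A.cellConst_Sf x y hy, A.cellConst_Mf x y hy]

theorem measurableSet_E (k : ℤ) : MeasurableSet (A.E k) := (A.cellConst_mem_E k).measurableSet

theorem E_subset_Ω (k : ℤ) : A.E k ⊆ A.Ω k := fun _ hx => A.Ω_anti (by omega) hx.1

theorem notMem_Ω_of_mem_E {k : ℤ} {x : Fin d → ℝ} (hx : x ∈ A.E k) : x ∉ A.Ω (k + 2) :=
  not_lt.2 hx.2.1

/-- The maximal cube of `Ω k` around `x`. -/
def maxCell (k : ℤ) (x : Fin d → ℝ) : Set (Fin d → ℝ) := D.cell (A.gen k x) x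

theorem measurableSet_maxCell (k : ℤ) (x : Fin d → ℝ) : MeasurableSet (A.maxCell k x) :=
  D.measurableSet_cell _ _

theorem maxCell_eq {k : ℤ} {x y : Fin d → ℝ} (hx : x ∈ A.Ω k) (hy : y ∈ A.maxCell k x) :
    A.maxCell k y = A.maxCell k x := by
  rw [maxCell, maxCell, gen_eq hx hy]
  exact cell_eq_of_mem hy

/-- The real part of the good term, not its modulus, is kept: it commutes with integration, so
duality can be applied with the plain indicator of E_k ∩ Q. -/
theorem two_zpow_le_norm_add_re {k : ℤ} {x : Fin d → ℝ} (hx : x ∈ A.E k) :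
    (2 : ℝ) ^ (k - 1) ≤ ‖A.S.lin A.c A.σ ((A.maxCell k x).indicator (A.testPart k)) x‖ +
        (A.S.lin A.c A.σ ((A.maxCell k x).indicator (A.goodPart k)) x).re := by
  have h := A.enorm_lin_sub_le (A.E_subset_Ω k hx) (A.notMem_Ω_of_mem_E hx)
  change ‖A.S.lin A.c A.σ A.f x -
      (A.S.lin A.c A.σ ((A.maxCell k x).indicator (A.testPart k)) x +
        A.S.lin A.c A.σ ((A.maxCell k x).indicator (A.goodPart k)) x)‖ₑ ≤ _ at h
  set u := A.S.lin A.c A.σ ((A.maxCell k x).indicator (A.testPart k)) x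
  set v := A.S.lin A.c A.σ ((A.maxCell k x).indicator (A.goodPart k)) x
  have h2 := h.trans (add_le_add_right hx.2.2 _)
  rw [A.lin_eq] at h2
  have hS : (2 : ℝ) ^ (k + 1) ≤ (A.Sf x).toReal := by
    have := ENNReal.toReal_mono (GenHaarShift.finMax_lt_top _ _ _ _ x).ne hx.1.le
    rwa [toReal_two_zpow] at this
  have h3 : ‖((A.Sf x).toReal : ℂ) - (u + v)‖ ≤ (2 : ℝ) ^ k + 2 ^ (k - 1) := by
    have := ENNReal.toReal_mono (ENNReal.add_ne_top.2 ⟨two_zpow_ne_top k, two_zpow_ne_top _⟩) h2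
    rw [toReal_enorm, ENNReal.toReal_add (two_zpow_ne_top k) (two_zpow_ne_top _),
      toReal_two_zpow, toReal_two_zpow] at this
    exact this
  have h4 := (Complex.re_le_norm _).trans h3
  simp only [Complex.sub_re, Complex.ofReal_re, Complex.add_re] at h4
  have h5 : u.re ≤ ‖u‖ := Complex.re_le_norm u
  have e1 : (2 : ℝ) ^ (k + 1) = 4 * 2 ^ (k - 1) := by
    rw [show k + 1 = (k - 1) + 2 by ring, zpow_add₀ two_ne_zero]; norm_num; ring
  have e2 : (2 : ℝ) ^ k = 2 * 2 ^ (k - 1) := by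
    rw [show k = (k - 1) + 1 by ring, zpow_add₀ two_ne_zero]; norm_num; ring
  -- In units of 2^(k-1): `Sf` is at least 4, the part off Q costs 2, the maximal function costs 1,
  -- and 1 remains.
  linarith

/-- The adjoint of the linearization, on the part of level `k` of the maximal cube around `x`. -/
def adjMass (k : ℤ) (x : Fin d → ℝ) : ℝ≥0∞ :=
  ∫⁻ y in A.maxCell k x, ‖A.S.linAdj A.c A.w ((A.E k ∩ A.maxCell k x).indicator 1) y‖ₑ ∂A.σ

theorem measure_maxCell_lt_top (μ : Measure (Fin d → ℝ)) [IsLocallyFiniteMeasure μ] (k : ℤ)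
    (x : Fin d → ℝ) : μ (A.maxCell k x) < ⊤ := D.measure_cell_lt_top μ _ _

theorem integrable_indicator_maxCell {g : (Fin d → ℝ) → ℂ}
    (hg : MemLp g (ENNReal.ofReal A.p) A.σ) (k : ℤ) (x : Fin d → ℝ) :
    Integrable ((A.maxCell k x).indicator g) A.σ :=
  (integrable_indicator_iff (A.measurableSet_maxCell k x)).2 (A.integrableOn_cell hg _ _)

theorem two_zpow_mul_measure_le {k : ℤ} {x : Fin d → ℝ} (hx : x ∈ A.Ω k) :
    (2 : ℝ≥0∞) ^ (k - 1) * A.w (A.E k ∩ A.maxCell k x) ≤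
      ∫⁻ z in A.maxCell k x,
        ‖A.S.lin A.c A.σ ((A.maxCell k x).indicator (A.testPart k)) z‖ₑ ∂A.w +
      2 * A.af (A.gen k x) x * A.adjMass k x := by
  set Q := A.maxCell k x with hQ
  have hQm : MeasurableSet Q := A.measurableSet_maxCell k x
  set E' := A.E k ∩ Q with hE'
  have hE'm : MeasurableSet E' := (A.measurableSet_E k).inter hQm
  have hE'fin : A.w E' < ⊤ :=
    (measure_mono Set.inter_subset_right).trans_lt (A.measure_maxCell_lt_top A.w k x)
  set u := A.S.lin A.c A.σ (Q.indicator (A.testPart k))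
  set v := A.S.lin A.c A.σ (Q.indicator (A.goodPart k)) with hv
  have hgi := A.integrable_indicator_maxCell (A.memLp_goodPart k) k x
  have hlin : ∀ g, Integrable g A.σ → IntegrableOn (A.S.lin A.c A.σ g) E' A.w := by
    intro g hg
    obtain ⟨C, hC⟩ := exists_enorm_lin_le A.S A.c hg
    exact Measure.integrableOn_of_bounded hE'fin.ne
      (A.S.cellConst_lin A.c A.σ g le_rfl).measurable.aestronglyMeasurable (ae_of_all _ hC)
  have hu : IntegrableOn u E' A.w :=
    hlin _ (A.integrable_indicator_maxCell (A.memLp_testPart k) k x)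
  have hvi : IntegrableOn v E' A.w := hlin _ hgi
  have hpt : ∀ z ∈ E', (2 : ℝ) ^ (k - 1) ≤ ‖u z‖ + (v z).re := by
    intro z hz
    have := A.two_zpow_le_norm_add_re hz.1
    rwa [A.maxCell_eq hx hz.2] at this
  have hreal : (2 : ℝ) ^ (k - 1) * A.w.real E' ≤ ∫ z in E', ‖u z‖ ∂A.w + ‖∫ z in E', v z ∂A.w‖ := by
    have h1 := setIntegral_mono_on (integrableOn_const (C := (2 : ℝ) ^ (k - 1)) hE'fin.ne)
      (hu.norm.add hvi.re) hE'm hpt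
    rw [setIntegral_const, smul_eq_mul, mul_comm] at h1
    refine h1.trans ?_
    have h2 : ∫ z in E', (‖u z‖ + (v z).re) ∂A.w =
        ∫ z in E', ‖u z‖ ∂A.w + ∫ z in E', (v z).re ∂A.w := integral_add hu.norm hvi.re
    refine h2.le.trans (add_le_add_right ?_ _)
    have h3 : ∫ z in E', (v z).re ∂A.w = (∫ z in E', v z ∂A.w).re := integral_re hvi
    rw [h3]
    exact Complex.re_le_norm _
  have h1 : (2 : ℝ≥0∞) ^ (k - 1) * A.w E' ≤
      ∫⁻ z in E', ‖u z‖ₑ ∂A.w + ‖∫ z in E', v z ∂A.w‖ₑ := by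
    have h2 := ENNReal.ofReal_le_ofReal hreal
    rw [ENNReal.ofReal_add (by positivity) (norm_nonneg _), ENNReal.ofReal_mul (by positivity),
      ofReal_integral_norm_eq_lintegral_enorm hu, ofReal_norm,
      ofReal_two_zpow] at h2
    rwa [Measure.real, ENNReal.ofReal_toReal hE'fin.ne] at h2
  refine h1.trans (add_le_add (lintegral_mono_set Set.inter_subset_right) ?_)
  have hφ : Integrable (E'.indicator (1 : (Fin d → ℝ) → ℂ)) A.w :=
    (integrable_indicator_iff hE'm).2 (integrableOn_const (C := (1 : ℂ)) hE'fin.ne)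
  -- Moving the linearization to the indicator of E_k ∩ Q leaves the good part as a factor bounded
  -- by a constant on Q.
  have hdual := A.S.integral_lin_mul A.c hgi hφ
  have h2 : ∫ z in E', v z ∂A.w = ∫ z, v z * E'.indicator (1 : (Fin d → ℝ) → ℂ) z ∂A.w := by
    rw [← integral_indicator hE'm]
    congr 1; funext z
    by_cases hz : z ∈ E' <;> simp [hz]
  rw [h2, hv, hdual]
  refine (enorm_integral_le_lintegral_enorm _).trans ?_
  rw [adjMass, ← lintegral_const_mul' _ _ (ENNReal.mul_ne_top (by simp) (A.af_ne_top _ _)),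
    ← lintegral_indicator (A.measurableSet_maxCell k x)]
  refine lintegral_mono fun y => ?_
  by_cases hy : y ∈ Q
  · rw [Set.indicator_of_mem hy, Set.indicator_of_mem hy, enorm_mul]
    refine mul_le_mul_left ?_ _
    by_cases hyg : y ∈ A.goodSet k
    · rw [goodPart, Set.indicator_of_mem hyg]
      refine (A.enorm_refAvg_le_of_mem_goodSet hyg).trans (le_of_eq ?_)
      rw [gen_eq hx hy, A.cellConst_af _ _ _ hy]
    · simp [goodPart, hyg]
  · rw [Set.indicator_of_notMem hy, Set.indicator_of_notMem hy]
    simp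

/-- The local estimate, with the testing condition inserted. -/
theorem local_estimate {T : ℝ≥0∞} (hT : ∀ Q ∈ D.cubes, ∀ g : (Fin d → ℝ) → ℂ,
      MemLp g (ENNReal.ofReal A.p) A.σ → ∫⁻ x in Q.toSet, A.S.maxTruncation A.σ
        (Q.toSet.indicator g) x ∂A.w ≤
          T * eLpNorm g (ENNReal.ofReal A.p) A.σ * A.w Q.toSet ^ (1 - 1 / A.p))
    {k : ℤ} {x : Fin d → ℝ} (hx : x ∈ A.Ω k) :
    (2 : ℝ≥0∞) ^ (k - 1) * A.w (A.E k ∩ A.maxCell k x) ≤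
      T * (∫⁻ y in A.maxCell k x, ‖A.testPart k y‖ₑ ^ A.p ∂A.σ) ^ (1 / A.p) *
        A.w (A.maxCell k x) ^ (1 - 1 / A.p) +
      2 * A.af (A.gen k x) x * A.adjMass k x := by
  have hp0 : 0 < A.p := one_pos.trans A.one_lt_p
  have hQm := A.measurableSet_maxCell k x
  have hG : MemLp ((A.maxCell k x).indicator (A.testPart k)) (ENNReal.ofReal A.p) A.σ :=
    (A.memLp_testPart k).indicator hQm
  refine (A.two_zpow_mul_measure_le hx).trans (add_le_add_left ?_ _)
  have h := hT _ (D.cubeAt_mem (A.gen k x) x) _ hG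
  change ∫⁻ z in A.maxCell k x, A.S.maxTruncation A.σ ((A.maxCell k x).indicator
    ((A.maxCell k x).indicator (A.testPart k))) z ∂A.w ≤
      T * _ * A.w (A.maxCell k x) ^ (1 - 1 / A.p) at h
  rw [Set.indicator_indicator, Set.inter_self, eLpNorm_indicator_eq_eLpNorm_restrict hQm,
    eLpNorm_eq_lintegral_rpow_enorm_toReal (by simpa using hp0) (by simp),
    ENNReal.toReal_ofReal hp0.le] at h
  refine le_trans (lintegral_mono fun z => ?_) h
  exact (A.S.enorm_lin_le_finMax _ _ _ _).trans
    (GenHaarShift.finMax_le_maxTruncation (fun k x => A.integrableOn_cell hG k x) _ _ _)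

end ShiftSetup

/-! ### Summation over maximal cells, and the sum of the test parts. -/

/-- Here e = w(E_k ∩ Q) and q = w(Q). Once q is comparable to e, write e = e^(1/p) e^(1-1/p), divide
by the second factor and raise to the power p; the result is additive over cells. -/
theorem rpow_mul_le_of_mul_le {p : ℝ} (hp : 1 < p) {a e q x y K : ℝ≥0∞} (he : e ≠ 0)
    (he' : e ≠ ⊤) (hK : 1 ≤ K) (hq : q ≤ K * e) (h : a * e ≤ x * q ^ (1 - 1 / p) + y * q) :
    a ^ p * e ≤ K ^ p * (2 ^ (p - 1) * (x ^ p + y ^ p * e)) := by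
  have hp0 : 0 < p := one_pos.trans hp
  have hr : 0 ≤ 1 - 1 / p := by rw [sub_nonneg, div_le_one hp0]; exact hp.le
  set s := e ^ (1 / p) with hs
  set r := e ^ (1 - 1 / p) with hrdef
  have hsr : e = s * r := by
    rw [hs, hrdef, ← ENNReal.rpow_add _ _ he he']; simp
  have hr0 : r ≠ 0 := by simp [hrdef, he, he']
  have hr1 : r ≠ ⊤ := ENNReal.rpow_ne_top_of_nonneg hr he'
  have hsp : s ^ p = e := by
    rw [hs, ← ENNReal.rpow_mul, one_div_mul_cancel hp0.ne', ENNReal.rpow_one]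
  have hqr : q ^ (1 - 1 / p) ≤ K * r := by
    refine (ENNReal.rpow_le_rpow hq hr).trans ?_
    rw [ENNReal.mul_rpow_of_nonneg _ _ hr]
    refine mul_le_mul_left ?_ _
    calc K ^ (1 - 1 / p) ≤ K ^ (1 : ℝ) :=
          ENNReal.rpow_le_rpow_of_exponent_le hK (by simp [hp0.le])
      _ = K := ENNReal.rpow_one K
  have h1 : a * s * r ≤ K * (x + y * s) * r := by
    calc a * s * r = a * e := by rw [hsr]; ring
      _ ≤ x * (K * r) + y * (K * e) := h.trans (by gcongr)
      _ = K * (x + y * s) * r := by rw [hsr]; ring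
  have h2 : a * s ≤ K * (x + y * s) := (ENNReal.mul_le_mul_iff_left hr0 hr1).1 h1
  calc a ^ p * e = (a * s) ^ p := by rw [ENNReal.mul_rpow_of_nonneg _ _ hp0.le, hsp]
    _ ≤ (K * (x + y * s)) ^ p := ENNReal.rpow_le_rpow h2 hp0.le
    _ = K ^ p * (x + y * s) ^ p := ENNReal.mul_rpow_of_nonneg _ _ hp0.le
    _ ≤ K ^ p * (2 ^ (p - 1) * (x ^ p + (y * s) ^ p)) := by
        gcongr
        exact ENNReal.rpow_add_le_mul_rpow_add_rpow _ _ hp.le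
    _ = _ := by rw [ENNReal.mul_rpow_of_nonneg y s hp0.le, hsp]

theorem sum_measure_le_of_card_le {α ι : Type*} [MeasurableSpace α] {μ : Measure α} (t : Finset ι)
    {s : ι → Set α} (hs : ∀ i, MeasurableSet (s i)) {U : Set α} (hU : MeasurableSet U)
    (hsU : ∀ i, s i ⊆ U) {N : ℕ}
    (hN : ∀ x, ∀ t' ⊆ t, (∀ i ∈ t', x ∈ s i) → t'.card ≤ N) :
    ∑ i ∈ t, μ (s i) ≤ N * μ U := by
  classical
  calc ∑ i ∈ t, μ (s i) = ∫⁻ x, ∑ i ∈ t, (s i).indicator 1 x ∂μ := by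
        rw [lintegral_finsetSum _ fun i _ => measurable_one.indicator (hs i)]
        exact Finset.sum_congr rfl fun i _ => (lintegral_indicator_one (hs i)).symm
    _ ≤ ∫⁻ x, N * U.indicator 1 x ∂μ := by
        refine lintegral_mono fun x => ?_
        simp only [Set.indicator_apply, Pi.one_apply, Finset.sum_ite, Finset.sum_const_zero,
          add_zero, Finset.sum_const, nsmul_eq_mul, mul_one]
        have hcard := hN x (t.filter fun i => x ∈ s i) (Finset.filter_subset _ _)
          fun i hi => (Finset.mem_filter.1 hi).2
        by_cases hx : x ∈ U
        · simp only [hx, if_true, mul_one]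
          exact_mod_cast hcard
        · have : t.filter (fun i => x ∈ s i) = ∅ :=
            Finset.filter_eq_empty_iff.2 fun i _ hi => hx (hsU i hi)
          simp [this]
    _ = N * μ U := by
        rw [lintegral_const_mul _ (measurable_one.indicator hU), lintegral_indicator_one hU]

theorem card_le_two {t : Finset ℤ} (h : ∀ a ∈ t, ∀ b ∈ t, b < a + 2) : t.card ≤ 2 := by
  rcases t.eq_empty_or_nonempty with rfl | hne
  · simp
  have : t ⊆ Finset.Icc (t.min' hne) (t.min' hne + 1) := fun b hb => by
    have h1 := t.min'_le b hb
    have h2 := h _ (t.min'_mem hne) b hb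
    rw [Finset.mem_Icc]; omega
  have := Finset.card_le_card this
  rw [Int.card_Icc] at this
  omega

/-- Every element must lie within one of the minimum or of the maximum. -/
theorem card_le_four {t : Finset ℤ}
    (h : ∀ a ∈ t, ∀ b ∈ t, ∀ c ∈ t, a + 2 ≤ b → b + 2 ≤ c → False) : t.card ≤ 4 := by
  rcases t.eq_empty_or_nonempty with rfl | hne
  · simp
  have : t ⊆ Finset.Icc (t.min' hne) (t.min' hne + 1) ∪
      Finset.Icc (t.max' hne - 1) (t.max' hne) := fun b hb => by
    have h1 := t.min'_le b hb
    have h2 := t.le_max' b hb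
    have h3 := h _ (t.min'_mem hne) b hb _ (t.max'_mem hne)
    simp only [Finset.mem_union, Finset.mem_Icc]
    by_contra hcon
    exact h3 (by omega) (by omega)
  have := (Finset.card_le_card this).trans (Finset.card_union_le _ _)
  rw [Int.card_Icc, Int.card_Icc] at this
  omega

namespace ShiftSetup

variable {d : ℕ} {D : DyadicGrid d} {m n : ℕ} (A : ShiftSetup D m n)

theorem p_pos : 0 < A.p := one_pos.trans A.one_lt_p

/-- The average of the adjoint over the maximal cube around `x`. -/
def adjAvg (k : ℤ) (x : Fin d → ℝ) : ℝ≥0∞ := (A.w (A.maxCell k x))⁻¹ * A.adjMass k x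

/-- The points of level `k` whose maximal cube has a large part in level `k`. -/
def largeSet (K : ℝ≥0∞) (k : ℤ) : Set (Fin d → ℝ) :=
  {x ∈ A.E k | A.w (A.maxCell k x) ≤ K * A.w (A.E k ∩ A.maxCell k x)}

theorem cellConst_maxCell {k : ℤ} {x y : Fin d → ℝ} (hx : x ∈ A.Ω k)
    (hy : y ∈ D.cell (A.lo - m - 1) x) : A.maxCell k y = A.maxCell k x :=
  A.maxCell_eq hx (D.cell_mono (gen_spec hx).1 x hy)

/-- Functions and sets defined in terms of the maximal cubes are constant on the smallest cells. -/
theorem cellConst_indicator {β : Type*} [Zero β] {k : ℤ} {B : Set (Fin d → ℝ)} (hB : B ⊆ A.Ω k)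
    (hBc : D.CellConst (A.lo - m - 1) (· ∈ B)) {F : (Fin d → ℝ) → β}
    (hF : ∀ x ∈ A.Ω k, ∀ y ∈ D.cell (A.lo - m - 1) x, F y = F x) :
    D.CellConst (A.lo - m - 1) (B.indicator F) := by
  intro x y hy
  have h := hBc x y hy
  simp only [eq_iff_iff] at h
  by_cases hx : x ∈ B
  · rw [Set.indicator_of_mem hx, Set.indicator_of_mem (h.2 hx), hF x (hB hx) y hy]
  · rw [Set.indicator_of_notMem hx, Set.indicator_of_notMem fun hy => hx (h.1 hy)]

theorem cellConst_mem_of {B : Set (Fin d → ℝ)}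
    (h : ∀ x ∈ B, D.cell (A.lo - m - 1) x ⊆ B) : D.CellConst (A.lo - m - 1) (· ∈ B) :=
  fun x y hy => propext ⟨fun hyB => h y hyB (mem_cell_comm.1 hy), fun hxB => h x hxB hy⟩

theorem mem_E_of_mem {k : ℤ} {x y : Fin d → ℝ} (hx : x ∈ A.E k)
    (hy : y ∈ D.cell (A.lo - m - 1) x) : y ∈ A.E k := by
  have := A.cellConst_mem_E k x y hy
  simp only [eq_iff_iff] at this
  exact this.2 hx

theorem measurableSet_largeSet (K : ℝ≥0∞) (k : ℤ) : MeasurableSet (A.largeSet K k) := by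
  refine (A.cellConst_mem_of (B := A.largeSet K k)
    fun x hx y hy => ⟨A.mem_E_of_mem hx.1 hy, ?_⟩).measurableSet
  rw [A.cellConst_maxCell (A.E_subset_Ω k hx.1) hy]
  exact hx.2

theorem af_gen_eq {k : ℤ} {x y : Fin d → ℝ} (hx : x ∈ A.Ω k) (hy : y ∈ A.maxCell k x) :
    A.af (A.gen k y) y = A.af (A.gen k x) x := by
  rw [gen_eq hx hy]
  exact A.cellConst_af _ _ _ hy

theorem adjAvg_eq {k : ℤ} {x y : Fin d → ℝ} (hx : x ∈ A.Ω k) (hy : y ∈ A.maxCell k x) :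
    A.adjAvg k y = A.adjAvg k x := by
  rw [adjAvg, adjAvg, adjMass, adjMass, A.maxCell_eq hx hy]

/-- The points in small parts of maximal cubes. -/
theorem measure_diff_largeSet_le {K : ℝ≥0∞} (hK : K ≠ 0) (hK' : K ≠ ⊤) (k : ℤ) :
    A.w (A.E k \ A.largeSet K k) ≤ K⁻¹ * A.w (A.Ω k) := by
  have hm : MeasurableSet (A.E k \ A.largeSet K k) :=
    (A.measurableSet_E k).diff (A.measurableSet_largeSet K k)
  have key := (A.isStopping_gen k).measure_le (μ := A.w.restrict (A.E k \ A.largeSet K k))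
    (ν := K⁻¹ • A.w) ?_
  · rw [Measure.smul_apply, smul_eq_mul, Measure.restrict_apply' hm,
      Set.inter_eq_right.2 (Set.sdiff_subset.trans (A.E_subset_Ω k))] at key
    exact key
  · intro x hx
    change A.w.restrict _ (A.maxCell k x) ≤ (K⁻¹ • A.w) (A.maxCell k x)
    rw [Measure.restrict_apply' hm, Measure.smul_apply, smul_eq_mul]
    -- Membership in the large set depends only on the maximal cell, so one such point z shows that
    -- the whole cell violates the largeness condition.
    rcases (A.maxCell k x ∩ (A.E k \ A.largeSet K k)).eq_empty_or_nonempty with h | ⟨z, hz, hzE,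
        hzL⟩
    · rw [h]; simp
    · have h1 : K * A.w (A.E k ∩ A.maxCell k x) ≤ A.w (A.maxCell k x) := by
        by_contra hcon
        refine hzL ⟨hzE, ?_⟩
        rw [A.maxCell_eq hx hz]
        exact (not_le.1 hcon).le
      rw [mul_comm, ← div_eq_mul_inv, ENNReal.le_div_iff_mul_le (Or.inl hK) (Or.inl hK'), mul_comm]
      refine le_trans (mul_le_mul_right (measure_mono ?_) _) h1
      exact fun y hy => ⟨hy.2.1, hy.1⟩

/-- The estimate of one level, for the large parts of the maximal cubes. -/
theorem two_zpow_rpow_mul_measure_largeSet_le {T : ℝ≥0∞}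
    (hT : ∀ Q ∈ D.cubes, ∀ g : (Fin d → ℝ) → ℂ,
      MemLp g (ENNReal.ofReal A.p) A.σ → ∫⁻ x in Q.toSet, A.S.maxTruncation A.σ
        (Q.toSet.indicator g) x ∂A.w ≤
          T * eLpNorm g (ENNReal.ofReal A.p) A.σ * A.w Q.toSet ^ (1 - 1 / A.p))
    {K : ℝ≥0∞} (hK : 1 ≤ K) (k : ℤ) :
    ((2 : ℝ≥0∞) ^ (k - 1)) ^ A.p * A.w (A.largeSet K k) ≤
      K ^ A.p * (2 ^ (A.p - 1) * (T ^ A.p * ∫⁻ y, ‖A.testPart k y‖ₑ ^ A.p ∂A.σ +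
        2 ^ A.p * ∫⁻ x, (A.E k).indicator
          (fun x => A.af (A.gen k x) x ^ A.p * A.adjAvg k x ^ A.p) x ∂A.w)) := by
  have hp0 := A.p_pos
  set F : (Fin d → ℝ) → ℝ≥0∞ := (A.E k).indicator
    (fun x => A.af (A.gen k x) x ^ A.p * A.adjAvg k x ^ A.p) with hF
  have hm := A.measurableSet_largeSet K k
  -- Both sides are written as measures, so that summing the local estimates over the maximal cells
  -- becomes a comparison of measures on Ω_k.
  have key := (A.isStopping_gen k).measure_le
    (μ := ((2 : ℝ≥0∞) ^ (k - 1)) ^ A.p • A.w.restrict (A.largeSet K k))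
    (ν := K ^ A.p • (2 : ℝ≥0∞) ^ (A.p - 1) • (T ^ A.p •
      A.σ.withDensity (fun y => ‖A.testPart k y‖ₑ ^ A.p) +
        (2 : ℝ≥0∞) ^ A.p • A.w.withDensity F)) ?_
  · simp only [Measure.smul_apply, Measure.add_apply, smul_eq_mul] at key
    rw [Measure.restrict_apply' hm, Set.inter_eq_right.2 fun x hx => A.E_subset_Ω k hx.1,
      withDensity_apply _ (A.measurableSet_Ω k), withDensity_apply _ (A.measurableSet_Ω k)] at key
    refine key.trans ?_
    gcongr <;> exact Measure.restrict_le_self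
  · intro x hx
    change _ * A.w.restrict (A.largeSet K k) (A.maxCell k x) ≤ _
    change _ ≤ (_ : Measure (Fin d → ℝ)) (A.maxCell k x)
    simp only [Measure.smul_apply, Measure.add_apply, smul_eq_mul]
    have hQm := A.measurableSet_maxCell k x
    rw [Measure.restrict_apply' hm, withDensity_apply _ hQm, withDensity_apply _ hQm]
    set Q := A.maxCell k x with hQ
    rcases (Q ∩ A.largeSet K k).eq_empty_or_nonempty with h | ⟨z, hz, hzE, hzL⟩
    · rw [h]; simp
    rw [A.maxCell_eq hx hz] at hzL
    have hsub : Q ∩ A.largeSet K k ⊆ A.E k ∩ Q := fun y hy => ⟨hy.2.1, hy.1⟩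
    refine (mul_le_mul_right (measure_mono hsub) _).trans ?_
    have hQfin := A.measure_maxCell_lt_top A.w k x
    rcases eq_or_ne (A.w (A.E k ∩ Q)) 0 with h0 | h0
    · rw [h0]; simp
    have hfin : A.w (A.E k ∩ Q) ≠ ⊤ :=
      ((measure_mono Set.inter_subset_right).trans_lt hQfin).ne
    have hQ0 : A.w Q ≠ 0 := fun h => h0 (measure_mono_null Set.inter_subset_right h)
    have hmass : A.adjMass k x = A.adjAvg k x * A.w Q := by
      rw [adjAvg, mul_right_comm, ENNReal.inv_mul_cancel hQ0 hQfin.ne, one_mul]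
    have hloc := A.local_estimate hT hx
    rw [hmass, ← mul_assoc] at hloc
    have h1 := rpow_mul_le_of_mul_le A.one_lt_p h0 hfin hK hzL hloc
    rw [ENNReal.mul_rpow_of_nonneg _ _ hp0.le, ← ENNReal.rpow_mul, one_div_mul_cancel hp0.ne',
      ENNReal.rpow_one, ENNReal.mul_rpow_of_nonneg _ _ hp0.le,
      ENNReal.mul_rpow_of_nonneg _ _ hp0.le] at h1
    have h2 : ∫⁻ y in Q, F y ∂A.w =
        A.af (A.gen k x) x ^ A.p * A.adjAvg k x ^ A.p * A.w (A.E k ∩ Q) := by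
      rw [hF, ← lintegral_indicator hQm, Set.indicator_indicator, Set.inter_comm Q,
        lintegral_indicator ((A.measurableSet_E k).inter hQm), ← setLIntegral_const]
      refine setLIntegral_congr_fun ((A.measurableSet_E k).inter hQm) fun y hy => ?_
      simp only [A.af_gen_eq hx hy.2, A.adjAvg_eq hx hy.2]
    rw [h2]
    refine h1.trans (le_of_eq ?_)
    ring

theorem enorm_testPart_rpow_le (k : ℤ) (y : Fin d → ℝ) :
    ‖A.testPart k y‖ₑ ^ A.p ≤ (A.Ω k \ A.Ω (k + 2)).indicator (fun y => ‖A.f y‖ₑ ^ A.p) y +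
      (A.badSet k).indicator (fun y => A.af (A.refGen k y) y) y ^ A.p := by
  have hp0 := A.p_pos
  by_cases hy : y ∈ A.badSet k
  · have h1 : y ∉ A.Ω k \ A.Ω (k + 2) := fun h => h.2 hy.1.1
    rw [testPart, Set.indicator_of_mem hy, Set.indicator_of_notMem h1, Set.indicator_of_notMem h1,
      Set.indicator_of_mem hy, zero_add, zero_add]
    exact ENNReal.rpow_le_rpow (A.enorm_refAvg_le hy.1.1) hp0.le
  · rw [testPart, Set.indicator_of_notMem hy, Set.indicator_of_notMem hy, add_zero,
      ENNReal.zero_rpow_of_pos hp0, add_zero]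
    by_cases h1 : y ∈ A.Ω k \ A.Ω (k + 2)
    · rw [Set.indicator_of_mem h1, Set.indicator_of_mem h1]
    · rw [Set.indicator_of_notMem h1, Set.indicator_of_notMem h1]
      simp [hp0]

theorem cellConst_indicator_af (k : ℤ) : D.CellConst (A.lo - m - 1 - n)
    ((A.badSet k).indicator fun y => A.af (A.refGen k y) y) := by
  have key : ∀ x y, x ∈ A.badSet k → y ∈ D.cell (A.lo - m - 1 - n) x →
      y ∈ A.badSet k ∧ A.af (A.refGen k y) y = A.af (A.refGen k x) x := by
    intro x y hx hy
    have hy' := D.cell_mono (A.le_refGen hx.1.1) x hy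
    exact ⟨cell_refGen_subset_badSet hx hy', (af_eq_af hx.1.1 hy').2⟩
  intro x y hy
  by_cases hx : x ∈ A.badSet k
  · obtain ⟨h1, h2⟩ := key x y hx hy
    rw [Set.indicator_of_mem hx, Set.indicator_of_mem h1, h2]
  · have h1 : y ∉ A.badSet k := fun h => hx (key y x h (mem_cell_comm.1 hy)).1
    rw [Set.indicator_of_notMem hx, Set.indicator_of_notMem h1]

/-- Depth at the middle level puts the maximal cell of level k₃ inside the reference cell of level
k₁. The average 2^j reached there is then more than doubled at k₃, hence exceeds 2^(j+1). -/
theorem not_mem_badSet_of_le {k₁ k₂ k₃ j : ℤ} (h₁₂ : k₁ + 2 ≤ k₂) (h₂₃ : k₂ + 2 ≤ k₃)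
    {y : Fin d → ℝ} (h₂ : y ∈ A.badSet k₂) (h₃ : y ∈ A.badSet k₃)
    (hj : (2 : ℝ≥0∞) ^ j < A.af (A.refGen k₁ y) y)
    (hj' : A.af (A.refGen k₃ y) y ≤ 2 ^ (j + 1)) : False := by
  have e1 : A.gen k₂ y ≤ A.gen (k₁ + 2) y := gen_anti h₁₂ (A.Ω_anti (by omega) h₂.1.1)
  have e2 : A.gen k₃ y ≤ A.gen (k₂ + 2) y := gen_anti h₂₃ (A.Ω_anti (by omega) h₃.1.1)
  have e3 := h₂.1.2
  have e4 : A.gen k₃ y ≤ A.refGen k₁ y := by unfold refGen; omega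
  have e5 := hj.trans_le (A.af_anti e4 y)
  have e6 := h₃.2.trans_le hj'
  rw [two_zpow_add, zpow_one, mul_comm] at e6
  exact absurd e6 (not_lt.2 (mul_le_mul_left e5.le 2))

/-- The parts controlled by the testing condition add up. -/
theorem exists_sum_testPart_le (p : ℝ) (hp : 1 < p) : ∃ C : ℝ≥0, ∀ {d : ℕ} {D : DyadicGrid d}
    {m n : ℕ} (A : ShiftSetup D m n), A.p = p → ∀ t : Finset ℤ,
    ∑ k ∈ t, ∫⁻ y, ‖A.testPart k y‖ₑ ^ p ∂A.σ ≤ C * ∫⁻ y, ‖A.f y‖ₑ ^ p ∂A.σ := by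
  obtain ⟨C, hC⟩ := tsum_measure_lt_supAvg_le p hp
  refine ⟨2 + 4 * 2 ^ p * C, fun {d D m n} A hAp t => ?_⟩
  subst hAp
  have hp0 := A.p_pos
  have hΩm : ∀ k, MeasurableSet (A.Ω k \ A.Ω (k + 2)) := fun k =>
    (A.measurableSet_Ω k).diff (A.measurableSet_Ω (k + 2))
  have hFm : ∀ k, Measurable ((A.badSet k).indicator fun y => A.af (A.refGen k y) y) := fun k =>
    (A.cellConst_indicator_af k).measurable
  have h1 : ∑ k ∈ t, ∫⁻ y, (A.Ω k \ A.Ω (k + 2)).indicator (fun y => ‖A.f y‖ₑ ^ A.p) y ∂A.σ ≤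
      (2 : ℕ) * ∫⁻ y, ‖A.f y‖ₑ ^ A.p ∂A.σ := by
    have e : ∀ k, ∫⁻ y, (A.Ω k \ A.Ω (k + 2)).indicator (fun y => ‖A.f y‖ₑ ^ A.p) y ∂A.σ =
        A.σ.withDensity (fun y => ‖A.f y‖ₑ ^ A.p) (A.Ω k \ A.Ω (k + 2)) := fun k => by
      rw [withDensity_apply _ (hΩm k), lintegral_indicator (hΩm k)]
    simp_rw [e]
    refine (sum_measure_le_of_card_le t hΩm MeasurableSet.univ (fun _ => Set.subset_univ _)
      (N := 2) fun x t' _ ht' => card_le_two fun a ha b hb => ?_).trans (le_of_eq ?_)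
    · exact two_zpow_lt_iff.1 ((ht' b hb).1.trans_le (not_lt.1 (ht' a ha).2))
    · rw [withDensity_apply _ MeasurableSet.univ, Measure.restrict_univ]
  have h2 : ∑ k ∈ t, ∫⁻ y, (A.badSet k).indicator (fun y => A.af (A.refGen k y) y) y ^ A.p ∂A.σ ≤
      4 * 2 ^ A.p * C * ∫⁻ y, ‖A.f y‖ₑ ^ A.p ∂A.σ := by
    calc _ ≤ ∑ k ∈ t, ∑' j : ℤ, ((2 : ℝ≥0∞) ^ (j + 1)) ^ A.p *
          A.σ {y | 2 ^ j < (A.badSet k).indicator (fun y => A.af (A.refGen k y) y) y ∧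
            (A.badSet k).indicator (fun y => A.af (A.refGen k y) y) y ≤ 2 ^ (j + 1)} := by
          refine Finset.sum_le_sum fun k _ => lintegral_rpow_le_tsum hp0 A.σ (hFm k) fun y => ?_
          by_cases hy : y ∈ A.badSet k
          · rw [Set.indicator_of_mem hy]; exact A.af_ne_top _ _
          · simp [hy]
      _ = ∑' j : ℤ, ((2 : ℝ≥0∞) ^ (j + 1)) ^ A.p * ∑ k ∈ t,
          A.σ {y | 2 ^ j < (A.badSet k).indicator (fun y => A.af (A.refGen k y) y) y ∧
            (A.badSet k).indicator (fun y => A.af (A.refGen k y) y) y ≤ 2 ^ (j + 1)} := by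
          simp_rw [Finset.mul_sum]
          exact (Summable.tsum_finsetSum fun _ _ => ENNReal.summable).symm
      -- For fixed j each point lies in at most four of the sets. Merging them into one superlevel
      -- set of the maximal averages brings in the strong maximal theorem.
      _ ≤ ∑' j : ℤ, 4 * 2 ^ A.p * (((2 : ℝ≥0∞) ^ j) ^ A.p *
            A.σ {y | 2 ^ j < A.af (A.lo - m - 1 - n) y}) := by
          refine ENNReal.tsum_le_tsum fun j => ?_
          have h3 : ∑ k ∈ t, A.σ {y | (2 : ℝ≥0∞) ^ j <
                (A.badSet k).indicator (fun y => A.af (A.refGen k y) y) y ∧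
              (A.badSet k).indicator (fun y => A.af (A.refGen k y) y) y ≤ 2 ^ (j + 1)} ≤
              (4 : ℕ) * A.σ {y | 2 ^ j < A.af (A.lo - m - 1 - n) y} := by
            have hmem : ∀ k y, (2 : ℝ≥0∞) ^ j <
                (A.badSet k).indicator (fun y => A.af (A.refGen k y) y) y → y ∈ A.badSet k := by
              intro k y hy
              by_contra hn
              simp [hn] at hy
            refine sum_measure_le_of_card_le t
              (fun k => (measurableSet_lt measurable_const (hFm k)).inter
                (measurableSet_le (hFm k) measurable_const))
              (measurableSet_lt measurable_const (A.cellConst_af _).measurable) ?_ ?_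
            · rintro k y ⟨hy, -⟩
              have hyb := hmem k y hy
              rw [Set.mem_ofPred_eq, Set.indicator_of_mem hyb] at hy
              exact hy.trans_le (A.af_anti (A.le_refGen hyb.1.1) y)
            · refine fun y t' _ ht' => card_le_four fun a ha b hb c hc hab hbc => ?_
              have hya := hmem a y (ht' a ha).1
              have hyc := hmem c y (ht' c hc).1
              refine A.not_mem_badSet_of_le hab hbc (hmem b y (ht' b hb).1) hyc (j := j) ?_ ?_
              · have := (ht' a ha).1
                rwa [Set.mem_ofPred_eq, Set.indicator_of_mem hya] at this
              · have := (ht' c hc).2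
                rwa [Set.mem_ofPred_eq, Set.indicator_of_mem hyc] at this
          refine (mul_le_mul_right h3 _).trans (le_of_eq ?_)
          rw [two_zpow_add, zpow_one, ENNReal.mul_rpow_of_nonneg _ _ hp0.le]
          push_cast
          ring
      _ ≤ _ := by
          rw [ENNReal.tsum_mul_left, mul_assoc _ (C : ℝ≥0∞)]
          exact mul_le_mul_right (hC D A.σ _ A.measurable_f.enorm A.hi _) _
  calc _ ≤ ∑ k ∈ t, (∫⁻ y, (A.Ω k \ A.Ω (k + 2)).indicator (fun y => ‖A.f y‖ₑ ^ A.p) y ∂A.σ +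
        ∫⁻ y, (A.badSet k).indicator (fun y => A.af (A.refGen k y) y) y ^ A.p ∂A.σ) := by
        refine Finset.sum_le_sum fun k _ => ?_
        rw [← lintegral_add_right _ ((hFm k).pow_const _)]
        exact lintegral_mono fun y => A.enorm_testPart_rpow_le k y
    _ ≤ _ := by
        rw [Finset.sum_add_distrib]
        refine (add_le_add h1 h2).trans (le_of_eq ?_)
        push_cast
        rw [ENNReal.coe_rpow_of_nonneg _ hp0.le]
        push_cast
        ring

end ShiftSetup

/-! ### Characters, and the adjoint on a fixed family of test functions. -/

/-- Orthogonal families of unimodular functions on a finite set of integers. -/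
theorem exists_characters (t : Finset ℤ) : ∃ (N : ℕ) (_ : N ≠ 0) (χ : Fin N → ℤ → ℂ),
    (∀ i k, ‖χ i k‖ = 1) ∧ ∀ k ∈ t, ∀ l ∈ t,
      ∑ i, (starRingEnd ℂ) (χ i k) * χ i l = if k = l then (N : ℂ) else 0 := by
  set B := ∑ k ∈ t, k.natAbs with hB
  have hle : ∀ k ∈ t, k.natAbs ≤ B := fun k hk =>
    Finset.single_le_sum (f := fun k : ℤ => k.natAbs) (fun _ _ => Nat.zero_le _) hk
  -- Differences of elements of t are at most 2B in absolute value, so distinct elements remain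
  -- distinct modulo N.
  set N := 2 * B + 1 with hN
  have : NeZero N := ⟨by omega⟩
  let e : Fin N ≃ ZMod N := (ZMod.finEquiv N).toEquiv
  refine ⟨N, by omega, fun i k => ZMod.stdAddChar (e i * (k : ZMod N)), fun i k =>
    AddChar.norm_apply _ _, fun k hk l hl => ?_⟩
  have h1 : ∀ i, (starRingEnd ℂ) (ZMod.stdAddChar (e i * (k : ZMod N))) *
      ZMod.stdAddChar (e i * (l : ZMod N)) =
        ZMod.stdAddChar (e i * ((l - k : ℤ) : ZMod N)) := by
    intro i
    rw [← AddChar.map_neg_eq_conj, ← AddChar.map_add_eq_mul]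
    congr 1
    push_cast
    ring
  simp_rw [h1]
  rw [e.sum_comp (fun a => ZMod.stdAddChar (a * ((l - k : ℤ) : ZMod N))),
    AddChar.sum_mulShift _ (ZMod.isPrimitive_stdAddChar N)]
  have h2 : ((l - k : ℤ) : ZMod N) = 0 ↔ k = l := by
    rw [ZMod.intCast_zmod_eq_zero_iff_dvd]
    refine ⟨fun h => ?_, fun h => by simp [h]⟩
    have hk' := hle k hk
    have hl' := hle l hl
    have := Int.eq_zero_of_abs_lt_dvd h (by rw [abs_lt]; omega)
    omega
  simp only [h2, ZMod.card]
  split_ifs <;> simp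

namespace ShiftSetup

variable {d : ℕ} {D : DyadicGrid d} {m n : ℕ} (A : ShiftSetup D m n)

theorem eq_of_mem_E {k l : ℤ} {x : Fin d → ℝ} (hk : x ∈ A.E k) (hl : x ∈ A.E l) : k = l := by
  have h1 := two_zpow_lt_iff.1 (hk.1.trans_le hl.2.1)
  have h2 := two_zpow_lt_iff.1 (hl.1.trans_le hk.2.1)
  omega

/-- The combination of the indicators of the levels with the given coefficients. -/
def levelSum (t : Finset ℤ) (z : ℤ → ℂ) (x : Fin d → ℝ) : ℂ :=
  ∑ l ∈ t, z l * (A.E l).indicator 1 x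

theorem measurable_levelSum (t : Finset ℤ) (z : ℤ → ℂ) : Measurable (A.levelSum t z) :=
  Finset.measurable_fun_sum t fun l _ =>
    (measurable_one.indicator (A.measurableSet_E l)).const_mul _

theorem norm_levelSum_le (t : Finset ℤ) {z : ℤ → ℂ} (hz : ∀ l, ‖z l‖ = 1) (x : Fin d → ℝ) :
    ‖A.levelSum t z x‖ ≤ 1 := by
  by_cases h : ∃ l ∈ t, x ∈ A.E l
  · obtain ⟨l, hl, hx⟩ := h
    rw [levelSum, Finset.sum_eq_single_of_mem l hl fun k _ hkl => by
      rw [Set.indicator_of_notMem fun hk => hkl (A.eq_of_mem_E hk hx), mul_zero]]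
    simp [hx, hz]
  · rw [levelSum, Finset.sum_eq_zero fun l hl => by
      rw [Set.indicator_of_notMem fun hx => h ⟨l, hl, hx⟩, mul_zero]]
    simp

/-- The average of the adjoint of `φw` over the maximal cube around `x`. -/
def adjAvgOf (φ : (Fin d → ℝ) → ℂ) (k : ℤ) (x : Fin d → ℝ) : ℝ≥0∞ :=
  (A.w (A.maxCell k x))⁻¹ *
    ∫⁻ y in A.maxCell k x, ‖A.S.linAdj A.c A.w ((A.maxCell k x).indicator φ) y‖ₑ ∂A.σ

/-- Orthogonality recovers one level from the N combinations of all levels. The combinations do not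
depend on k; only their unimodular coefficients do. -/
theorem indicator_E_inter_eq {t : Finset ℤ} {N : ℕ} (hN : N ≠ 0) {χ : Fin N → ℤ → ℂ}
    (hχ : ∀ k ∈ t, ∀ l ∈ t,
      ∑ i, (starRingEnd ℂ) (χ i k) * χ i l = if k = l then (N : ℂ) else 0) {k : ℤ} (hk : k ∈ t)
    (Q : Set (Fin d → ℝ)) : (A.E k ∩ Q).indicator (1 : (Fin d → ℝ) → ℂ) = fun y =>
      ∑ i, ((N : ℂ)⁻¹ * (starRingEnd ℂ) (χ i k)) * Q.indicator (A.levelSum t (χ i)) y := by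
  funext y
  by_cases hy : y ∈ Q
  swap
  · simp [hy]
  have h1 : ∑ i, ((N : ℂ)⁻¹ * (starRingEnd ℂ) (χ i k)) * A.levelSum t (χ i) y =
      (A.E k).indicator 1 y := by
    calc _ = ∑ l ∈ t, (N : ℂ)⁻¹ * (∑ i, (starRingEnd ℂ) (χ i k) * χ i l) *
          (A.E l).indicator 1 y := by
          simp only [levelSum, Finset.mul_sum, Finset.sum_mul]
          rw [Finset.sum_comm]
          exact Finset.sum_congr rfl fun l _ => Finset.sum_congr rfl fun i _ => by ring
      _ = (N : ℂ)⁻¹ * (∑ i, (starRingEnd ℂ) (χ i k) * χ i k) * (A.E k).indicator 1 y :=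
          Finset.sum_eq_single_of_mem k hk fun l hl hlk => by
            rw [hχ k hk l hl, if_neg (Ne.symm hlk)]; simp
      _ = _ := by
          rw [hχ k hk k hk, if_pos rfl, inv_mul_cancel₀ (by exact_mod_cast hN), one_mul]
  simp only [Set.indicator_of_mem hy]
  rw [h1]
  by_cases hyE : y ∈ A.E k <;> simp [hy, hyE]

/-- Linearity and the triangle inequality bound the average for one level by a mean over the
characters, and Jensen's inequality moves the power p inside with no dependence on N. -/
theorem adjAvg_rpow_le {t : Finset ℤ} {N : ℕ} (hN : N ≠ 0) {χ : Fin N → ℤ → ℂ}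
    (hχ1 : ∀ i k, ‖χ i k‖ = 1) (hχ : ∀ k ∈ t, ∀ l ∈ t,
      ∑ i, (starRingEnd ℂ) (χ i k) * χ i l = if k = l then (N : ℂ) else 0) {k : ℤ} (hk : k ∈ t)
    (x : Fin d → ℝ) : A.adjAvg k x ^ A.p ≤
      ∑ i, (N : ℝ≥0∞)⁻¹ * A.adjAvgOf (A.levelSum t (χ i)) k x ^ A.p := by
  have hw : ∑ _i : Fin N, (N : ℝ≥0∞)⁻¹ = 1 := by
    rw [Finset.sum_const, Finset.card_univ, Fintype.card_fin, nsmul_eq_mul]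
    exact ENNReal.mul_inv_cancel (by exact_mod_cast hN) (by simp)
  refine le_trans (ENNReal.rpow_le_rpow ?_ A.p_pos.le)
    (ENNReal.rpow_arith_mean_le_arith_mean_rpow _ _ _ hw A.one_lt_p.le)
  set Q := A.maxCell k x with hQ
  have hQm := A.measurableSet_maxCell k x
  have hint : ∀ i ∈ Finset.univ, Integrable (Q.indicator (A.levelSum t (χ i))) A.w := fun i _ =>
    (integrable_indicator_iff hQm).2 (Measure.integrableOn_of_bounded
      (A.measure_maxCell_lt_top A.w k x).ne (A.measurable_levelSum t (χ i)).aestronglyMeasurable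
      (ae_of_all _ fun y => A.norm_levelSum_le t (hχ1 i) y))
  have h1 : A.adjMass k x ≤ ∑ i, (N : ℝ≥0∞)⁻¹ *
      ∫⁻ y in Q, ‖A.S.linAdj A.c A.w (Q.indicator (A.levelSum t (χ i))) y‖ₑ ∂A.σ := by
    rw [adjMass, ← hQ, A.indicator_E_inter_eq hN hχ hk Q]
    simp_rw [A.S.linAdj_sum A.c Finset.univ hint]
    have hm : ∀ i, Measurable fun y =>
        ‖A.S.linAdj A.c A.w (Q.indicator (A.levelSum t (χ i))) y‖ₑ := fun i =>
      (A.S.cellConst_linAdj A.c A.w _).measurable.enorm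
    simp_rw [← lintegral_const_mul _ (hm _)]
    rw [← lintegral_finsetSum _ fun i _ => (hm i).const_mul _]
    refine lintegral_mono fun y => (enorm_sum_le _ _).trans (Finset.sum_le_sum fun i _ => ?_)
    rw [enorm_mul]
    refine mul_le_mul_left (le_of_eq ?_) _
    have : ‖(N : ℂ)⁻¹ * (starRingEnd ℂ) (χ i k)‖ = (N : ℝ)⁻¹ := by
      rw [norm_mul, RCLike.norm_conj, hχ1, mul_one, norm_inv, Complex.norm_natCast]
    rw [← ofReal_norm, this, ENNReal.ofReal_inv_of_pos (by positivity), ENNReal.ofReal_natCast]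
  rw [adjAvg]
  refine (mul_le_mul_right h1 _).trans (le_of_eq ?_)
  rw [Finset.mul_sum]
  refine Finset.sum_congr rfl fun i _ => ?_
  rw [adjAvgOf]
  ring

theorem adjAvgOf_eq (φ : (Fin d → ℝ) → ℂ) {k : ℤ} {x y : Fin d → ℝ} (hx : x ∈ A.Ω k)
    (hy : y ∈ D.cell (A.lo - m - 1) x) : A.adjAvgOf φ k y = A.adjAvgOf φ k x := by
  rw [adjAvgOf, adjAvgOf, A.cellConst_maxCell hx hy]

/-- The points of level `k` around which the averages of `f` reach `2^j`. -/
def reachSet (j k : ℤ) : Set (Fin d → ℝ) := {x ∈ A.E k | (2 : ℝ≥0∞) ^ j < A.af (A.gen k x) x}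

theorem cellConst_mem_reachSet (j k : ℤ) : D.CellConst (A.lo - m - 1) (· ∈ A.reachSet j k) :=
  A.cellConst_mem_of fun x hx y hy => ⟨A.mem_E_of_mem hx.1 hy, by
    have hxΩ := A.E_subset_Ω k hx.1
    rw [A.af_gen_eq hxΩ (D.cell_mono (gen_spec hxΩ).1 x hy)]
    exact hx.2⟩

theorem measurable_indicator_reachSet (j k : ℤ) {F : (Fin d → ℝ) → ℝ≥0∞}
    (hF : ∀ x ∈ A.Ω k, ∀ y ∈ D.cell (A.lo - m - 1) x, F y = F x) :
    Measurable ((A.reachSet j k).indicator F) :=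
  (A.cellConst_indicator (fun _ hx => A.E_subset_Ω k hx.1) (A.cellConst_mem_reachSet j k)
    hF).measurable

/-- The set where the averages of f exceed 2^j is the disjoint union of its maximal cells, which
serve as the cubes Q₀ of the nonstandard condition. -/
theorem sum_lintegral_reachSet_le {M : ℝ≥0∞}
    (hM : ∀ φ : (Fin d → ℝ) → ℂ, Measurable φ → (∀ x, ‖φ x‖ ≤ 1) →
      ∀ Q₀ ∈ D.cubes, ∫⁻ x in Q₀.toSet, (⨆ (Q : Cube d) (_ : Q ∈ D.cubes)
        (_ : Q.toSet ⊆ Q₀.toSet) (_ : x ∈ Q.toSet), ((A.w Q.toSet)⁻¹ * ∫⁻ y in Q.toSet,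
          ‖A.S.linAdj A.c A.w (Q.toSet.indicator φ) y‖ₑ ∂A.σ) ^ A.p) ∂A.w ≤ M * A.σ Q₀.toSet)
    (t : Finset ℤ) (j : ℤ) :
    ∑ k ∈ t, ∫⁻ x, (A.reachSet j k).indicator (fun x => A.adjAvg k x ^ A.p) x ∂A.w ≤
      M * A.σ {y | 2 ^ j < A.af (A.lo - m - 1) y} := by
  obtain ⟨N, hN, χ, hχ1, hχ⟩ := exists_characters t
  have hP : ∀ i, D.CellConst i fun y => (2 : ℝ≥0∞) ^ j < D.avg A.σ (fun y => ‖A.f y‖ₑ) i y :=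
    fun i x y hy => by simp only [cellConst_avg i x y hy]
  have hst := isStopping_topScale (s := A.lo - m - 1) (hi := A.hi) hP
  set τ := topScale (A.lo - m - 1) A.hi
    fun i y => (2 : ℝ≥0∞) ^ j < D.avg A.σ (fun y => ‖A.f y‖ₑ) i y with hτ
  have hU : {y | (2 : ℝ≥0∞) ^ j < A.af (A.lo - m - 1) y} = _ :=
    setOf_lt_supAvg (D := D) (σ := A.σ) (g := fun y => ‖A.f y‖ₑ) (hi := A.hi) _ _
  have hadj : ∀ k, Measurable
      ((A.reachSet j k).indicator fun x => A.adjAvg k x ^ A.p) := fun k =>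
    A.measurable_indicator_reachSet j k fun x hx y hy => by
      rw [A.adjAvg_eq hx (D.cell_mono (gen_spec hx).1 x hy)]
  have hadjOf : ∀ i k, Measurable ((A.reachSet j k).indicator
      fun x => A.adjAvgOf (A.levelSum t (χ i)) k x ^ A.p) := fun i k =>
    A.measurable_indicator_reachSet j k fun x hx y hy => by rw [A.adjAvgOf_eq _ hx hy]
  have key := hst.measure_le (ν := M • A.σ) (μ := A.w.withDensity fun x =>
    ∑ k ∈ t, (A.reachSet j k).indicator (fun x => A.adjAvg k x ^ A.p) x) ?_
  · rw [hU, ← lintegral_finsetSum _ fun k _ => hadj k]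
    rw [withDensity_apply _ hst.measurableSet, Measure.smul_apply, smul_eq_mul] at key
    refine le_trans (le_of_eq ?_) key
    symm
    refine setLIntegral_eq_of_support_subset fun x hx => ?_
    rw [← hU]
    obtain ⟨k, -, hk⟩ := Finset.exists_ne_zero_of_sum_ne_zero hx
    have hxk : x ∈ A.reachSet j k := Set.mem_of_indicator_ne_zero hk
    exact hxk.2.trans_le (A.af_anti (gen_spec (A.E_subset_Ω k hxk.1)).1 x)
  · intro x₀ hx₀
    have hFm := D.measurableSet_cell (τ x₀) x₀
    rw [withDensity_apply _ hFm, Measure.smul_apply, smul_eq_mul]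
    have hNi : (∑ _i : Fin N, (N : ℝ≥0∞)⁻¹) = 1 := by
      rw [Finset.sum_const, Finset.card_univ, Fintype.card_fin, nsmul_eq_mul]
      exact ENNReal.mul_inv_cancel (by exact_mod_cast hN) (by simp)
    calc _ ≤ ∫⁻ x in D.cell (τ x₀) x₀, ∑ i, (N : ℝ≥0∞)⁻¹ * ∑ k ∈ t, (A.reachSet j k).indicator
            (fun x => A.adjAvgOf (A.levelSum t (χ i)) k x ^ A.p) x ∂A.w := by
          refine lintegral_mono fun x => ?_
          simp only [Finset.mul_sum]
          rw [Finset.sum_comm]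
          refine Finset.sum_le_sum fun k hk => ?_
          by_cases hx : x ∈ A.reachSet j k
          · simp only [Set.indicator_of_mem hx]
            exact A.adjAvg_rpow_le hN hχ1 hχ hk x
          · simp [hx]
      _ = ∑ i, (N : ℝ≥0∞)⁻¹ * ∫⁻ x in D.cell (τ x₀) x₀, ∑ k ∈ t, (A.reachSet j k).indicator
            (fun x => A.adjAvgOf (A.levelSum t (χ i)) k x ^ A.p) x ∂A.w := by
          have hms : ∀ i, Measurable fun x => ∑ k ∈ t, (A.reachSet j k).indicator
              (fun x => A.adjAvgOf (A.levelSum t (χ i)) k x ^ A.p) x := fun i =>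
            Finset.measurable_fun_sum t fun k _ => hadjOf i k
          rw [lintegral_finsetSum _ fun i _ => (hms i).const_mul _]
          exact Finset.sum_congr rfl fun i _ => lintegral_const_mul _ (hms i)
      _ ≤ ∑ _i : Fin N, (N : ℝ≥0∞)⁻¹ * (M * A.σ (D.cell (τ x₀) x₀)) := by
          refine Finset.sum_le_sum fun i _ => mul_le_mul_right (le_trans ?_
            (hM _ (A.measurable_levelSum t (χ i)) (A.norm_levelSum_le t (hχ1 i)) _
              (D.cubeAt_mem (τ x₀) x₀))) _
          refine setLIntegral_mono' hFm fun x hx => ?_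
          -- The levels are disjoint, so at most one k contributes at x and the sum over k is
          -- bounded by a supremum over cubes.
          by_cases hk : ∃ k ∈ t, x ∈ A.reachSet j k
          · obtain ⟨k, hk, hxk⟩ := hk
            rw [Finset.sum_eq_single_of_mem k hk fun l _ hlk =>
              Set.indicator_of_notMem (fun hl => hlk (A.eq_of_mem_E hl.1 hxk.1)) _,
              Set.indicator_of_mem hxk]
            refine le_iSup₂_of_le (D.cubeAt (A.gen k x) x) (D.cubeAt_mem _ _)
              (le_iSup₂_of_le ?_ (D.mem_cell_self _ _) le_rfl)
            have hxΩ := A.E_subset_Ω k hxk.1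
            have hx2 : (2 : ℝ≥0∞) ^ j < (Finset.Icc (A.gen k x) A.hi).sup
              (fun l => D.avg A.σ (fun y => ‖A.f y‖ₑ) l x) := hxk.2
            obtain ⟨l, hl, hl'⟩ := Finset.lt_sup_iff.1 hx2
            rw [Finset.mem_Icc] at hl
            -- The average exceeds 2^j at a generation l no smaller than that of Q; maximality of Q₀
            -- gives l ≤ τ, hence Q ⊆ Q₀.
            have h1 : l ≤ τ x := le_topScale ((gen_spec hxΩ).1.trans hl.1) hl.2 hl'
            rw [hst.const x₀ hx₀ x hx] at h1
            exact cell_subset_of_mem (hl.1.trans h1) hx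
          · rw [Finset.sum_eq_zero fun k hkt =>
              Set.indicator_of_notMem (fun h => hk ⟨k, hkt, h⟩) _]
            exact zero_le
      _ = M * A.σ (D.cell (τ x₀) x₀) := by rw [← Finset.sum_mul, hNi, one_mul]

end ShiftSetup

/-! ### The Carleson embedding, and the estimate for finitely many scales. -/

namespace ShiftSetup

/-- The Carleson embedding for the averages of the adjoint. -/
theorem exists_tsum_adjAvg_le (p : ℝ) (hp : 1 < p) : ∃ C : ℝ≥0, ∀ {d : ℕ} {D : DyadicGrid d}
    {m n : ℕ} (A : ShiftSetup D m n), A.p = p → ∀ {M : ℝ≥0∞},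
    (∀ φ : (Fin d → ℝ) → ℂ, Measurable φ → (∀ x, ‖φ x‖ ≤ 1) →
      ∀ Q₀ ∈ D.cubes, ∫⁻ x in Q₀.toSet, (⨆ (Q : Cube d) (_ : Q ∈ D.cubes)
        (_ : Q.toSet ⊆ Q₀.toSet) (_ : x ∈ Q.toSet), ((A.w Q.toSet)⁻¹ * ∫⁻ y in Q.toSet,
          ‖A.S.linAdj A.c A.w (Q.toSet.indicator φ) y‖ₑ ∂A.σ) ^ A.p) ∂A.w ≤ M * A.σ Q₀.toSet) →
    ∑' k, ∫⁻ x, (A.E k).indicator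
        (fun x => A.af (A.gen k x) x ^ A.p * A.adjAvg k x ^ A.p) x ∂A.w ≤
      C * (M * ∫⁻ y, ‖A.f y‖ₑ ^ A.p ∂A.σ) := by
  obtain ⟨C, hC⟩ := tsum_measure_lt_supAvg_le p hp
  refine ⟨2 ^ p * C, fun {d D m n} A hAp M hM => ?_⟩
  subst hAp
  have hp0 := A.p_pos
  have hadj : ∀ j k, Measurable
      ((A.reachSet j k).indicator fun x => A.adjAvg k x ^ A.p) := fun j k =>
    A.measurable_indicator_reachSet j k fun x hx y hy => by
      rw [A.adjAvg_eq hx (D.cell_mono (gen_spec hx).1 x hy)]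
  have hpt : ∀ k x, (A.E k).indicator
      (fun x => A.af (A.gen k x) x ^ A.p * A.adjAvg k x ^ A.p) x ≤
      ∑' j : ℤ, ((2 : ℝ≥0∞) ^ (j + 1)) ^ A.p *
        (A.reachSet j k).indicator (fun x => A.adjAvg k x ^ A.p) x := by
    intro k x
    by_cases hx : x ∈ A.E k
    · rw [Set.indicator_of_mem hx]
      refine (mul_le_mul_left (rpow_le_tsum_two_zpow hp0 (A.af_ne_top _ x)) _).trans ?_
      rw [← ENNReal.tsum_mul_right]
      refine ENNReal.tsum_le_tsum fun j => ?_
      split_ifs with h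
      · have hxr : x ∈ A.reachSet j k := ⟨hx, h.1⟩
        rw [Set.indicator_of_mem hxr]
      · simp
    · rw [Set.indicator_of_notMem hx]; exact zero_le
  rw [ENNReal.tsum_eq_iSup_sum]
  refine iSup_le fun t => ?_
  calc _ ≤ ∑ k ∈ t, ∑' j : ℤ, ((2 : ℝ≥0∞) ^ (j + 1)) ^ A.p *
        ∫⁻ x, (A.reachSet j k).indicator (fun x => A.adjAvg k x ^ A.p) x ∂A.w := by
        refine Finset.sum_le_sum fun k _ => (lintegral_mono (hpt k)).trans (le_of_eq ?_)
        rw [lintegral_tsum fun j => ((hadj j k).const_mul _).aemeasurable]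
        exact tsum_congr fun j => lintegral_const_mul _ (hadj j k)
    _ = ∑' j : ℤ, ((2 : ℝ≥0∞) ^ (j + 1)) ^ A.p * ∑ k ∈ t,
        ∫⁻ x, (A.reachSet j k).indicator (fun x => A.adjAvg k x ^ A.p) x ∂A.w := by
        simp_rw [Finset.mul_sum]
        exact (Summable.tsum_finsetSum fun _ _ => ENNReal.summable).symm
    _ ≤ ∑' j : ℤ, (2 ^ A.p * M) * (((2 : ℝ≥0∞) ^ j) ^ A.p *
          A.σ {y | 2 ^ j < A.af (A.lo - m - 1) y}) := by
        refine ENNReal.tsum_le_tsum fun j => ?_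
        refine (mul_le_mul_right (A.sum_lintegral_reachSet_le hM t j) _).trans (le_of_eq ?_)
        rw [two_zpow_add, zpow_one, ENNReal.mul_rpow_of_nonneg _ _ hp0.le]
        ring
    _ ≤ (2 ^ A.p * M) * (C * ∫⁻ y, ‖A.f y‖ₑ ^ A.p ∂A.σ) := by
        rw [ENNReal.tsum_mul_left]
        exact mul_le_mul_right (hC D A.σ _ A.measurable_f.enorm A.hi _) _
    _ = _ := by
        push_cast
        rw [ENNReal.coe_rpow_of_nonneg _ hp0.le]
        push_cast
        ring

variable {d : ℕ} {D : DyadicGrid d} {m n : ℕ} (A : ShiftSetup D m n)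

/-- This crude bound depends on the number of scales. It serves only to show that the integral to be
absorbed is finite. -/
theorem Sf_le_card_mul_Mf (x : Fin d → ℝ) :
    A.Sf x ≤ (Finset.Icc A.lo A.hi).card * A.Mf x := by
  refine Finset.sup_le fun q hq => ?_
  simp only [Finset.mem_product, Finset.mem_Icc] at hq
  calc _ ≤ ∑ k ∈ Finset.Icc q.1 q.2, ‖A.S.scalePart A.σ A.f k x‖ₑ := enorm_sum_le _ _
    _ ≤ ∑ k ∈ Finset.Icc A.lo A.hi, ‖A.S.scalePart A.σ A.f k x‖ₑ :=
        Finset.sum_le_sum_of_subset (Finset.Icc_subset_Icc hq.1.1 hq.2.2)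
    _ ≤ ∑ _k ∈ Finset.Icc A.lo A.hi, A.Mf x := by
        refine Finset.sum_le_sum fun k hk => ?_
        rw [Finset.mem_Icc] at hk
        exact A.enorm_scalePart_le_Mf (by omega) hk.2 fun _ => le_rfl
    _ = _ := by rw [Finset.sum_const, nsmul_eq_mul]

theorem lintegral_f_rpow_lt_top : ∫⁻ y, ‖A.f y‖ₑ ^ A.p ∂A.σ < ⊤ := by
  have := lintegral_rpow_enorm_lt_top_of_eLpNorm_lt_top (by simpa using A.p_pos) (by simp)
    A.memLp_f.2
  rwa [ENNReal.toReal_ofReal A.p_pos.le] at this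

theorem measure_level_le {K : ℝ≥0∞} (hK : K ≠ 0) (hK' : K ≠ ⊤) (k : ℤ) :
    A.w {x | (2 : ℝ≥0∞) ^ (k + 1) < A.Sf x ∧ A.Sf x ≤ 2 ^ (k + 1 + 1)} ≤
      A.w {x | (2 : ℝ≥0∞) ^ (k - 1) < (m + n + 3) * A.Mf x} +
        (K⁻¹ * A.w (A.Ω k) + A.w (A.largeSet K k)) := by
  have hsub : {x | (2 : ℝ≥0∞) ^ (k + 1) < A.Sf x ∧ A.Sf x ≤ 2 ^ (k + 1 + 1)} ⊆
      {x | (2 : ℝ≥0∞) ^ (k - 1) < (m + n + 3) * A.Mf x} ∪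
        ((A.E k \ A.largeSet K k) ∪ A.largeSet K k) := by
    rintro x ⟨h1, h2⟩
    by_cases h3 : (2 : ℝ≥0∞) ^ (k - 1) < (m + n + 3) * A.Mf x
    · exact Or.inl h3
    · refine Or.inr ?_
      by_cases h4 : x ∈ A.largeSet K k
      · exact Or.inr h4
      · exact Or.inl ⟨⟨h1, by rwa [show k + 2 = k + 1 + 1 by ring], not_lt.1 h3⟩, h4⟩
  exact (measure_mono hsub).trans ((measure_union_le _ _).trans (add_le_add_right
    ((measure_union_le _ _).trans (add_le_add_left (A.measure_diff_largeSet_le hK hK' k) _)) _))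

theorem exists_lintegral_Sf_le (p : ℝ) (hp : 1 < p) : ∃ C : ℝ≥0, ∀ {d : ℕ} {D : DyadicGrid d}
    {m n : ℕ} (A : ShiftSetup D m n), A.p = p → ∀ {T M B : ℝ≥0∞}, B ≠ ⊤ →
    ∫⁻ x, A.Mf x ^ A.p ∂A.w ≤ B * ∫⁻ y, ‖A.f y‖ₑ ^ A.p ∂A.σ →
    (∀ Q ∈ D.cubes, ∀ g : (Fin d → ℝ) → ℂ, MemLp g (ENNReal.ofReal A.p) A.σ →
      ∫⁻ x in Q.toSet, A.S.maxTruncation A.σ (Q.toSet.indicator g) x ∂A.w ≤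
        T * eLpNorm g (ENNReal.ofReal A.p) A.σ * A.w Q.toSet ^ (1 - 1 / A.p)) →
    (∀ φ : (Fin d → ℝ) → ℂ, Measurable φ → (∀ x, ‖φ x‖ ≤ 1) →
      ∀ Q₀ ∈ D.cubes, ∫⁻ x in Q₀.toSet, (⨆ (Q : Cube d) (_ : Q ∈ D.cubes)
        (_ : Q.toSet ⊆ Q₀.toSet) (_ : x ∈ Q.toSet), ((A.w Q.toSet)⁻¹ * ∫⁻ y in Q.toSet,
          ‖A.S.linAdj A.c A.w (Q.toSet.indicator φ) y‖ₑ ∂A.σ) ^ A.p) ∂A.w ≤ M * A.σ Q₀.toSet) →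
    ∫⁻ x, A.Sf x ^ A.p ∂A.w ≤
      C * (((m + n + 3) ^ A.p * B + T ^ A.p + M) * ∫⁻ y, ‖A.f y‖ₑ ^ A.p ∂A.σ) := by
  obtain ⟨C₁, hC₁⟩ := tsum_measure_lt_le p (by linarith)
  obtain ⟨C₂, hC₂⟩ := exists_sum_testPart_le p hp
  obtain ⟨C₃, hC₃⟩ := exists_tsum_adjAvg_le p hp
  have hp0 : 0 < p := one_pos.trans hp
  obtain ⟨a, ha⟩ : ∃ a : ℝ≥0, (a : ℝ≥0∞) = 8 ^ p :=
    ⟨8 ^ p, by rw [ENNReal.coe_rpow_of_nonneg _ hp0.le]; rfl⟩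
  obtain ⟨b, hb⟩ : ∃ b : ℝ≥0, (b : ℝ≥0∞) = 4 ^ p :=
    ⟨4 ^ p, by rw [ENNReal.coe_rpow_of_nonneg _ hp0.le]; rfl⟩
  obtain ⟨e, he⟩ : ∃ e : ℝ≥0, (e : ℝ≥0∞) = 2 ^ p :=
    ⟨2 ^ p, by rw [ENNReal.coe_rpow_of_nonneg _ hp0.le]; rfl⟩
  -- The cells with a small share of E_k contribute at most b K⁻¹ C₁ times the left side, which this
  -- K makes at most one half; the added 1 gives K ≥ 1.
  set K : ℝ≥0 := 2 * b * C₁ + 1 with hK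
  have hK1 : (1 : ℝ≥0∞) ≤ K := by
    rw [hK]; push_cast; exact le_add_self
  have hK0 : (K : ℝ≥0∞) ≠ 0 := (zero_lt_one.trans_le hK1).ne'
  have hbK : (b : ℝ≥0∞) * (K : ℝ≥0∞)⁻¹ * C₁ ≤ 2⁻¹ := by
    have h1 : 2 * (b : ℝ≥0∞) * C₁ ≤ K := by rw [hK]; push_cast; exact le_self_add
    calc (b : ℝ≥0∞) * (K : ℝ≥0∞)⁻¹ * C₁ = 2⁻¹ * ((2 * b * C₁) * (K : ℝ≥0∞)⁻¹) := by
          rw [show (2 : ℝ≥0∞)⁻¹ * ((2 * b * C₁) * (K : ℝ≥0∞)⁻¹) =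
            (2⁻¹ * 2) * (b * (K : ℝ≥0∞)⁻¹ * C₁) by ring,
            ENNReal.inv_mul_cancel (by norm_num) (by norm_num), one_mul]
      _ ≤ 2⁻¹ * (K * (K : ℝ≥0∞)⁻¹) := by gcongr
      _ = 2⁻¹ := by rw [ENNReal.mul_inv_cancel hK0 ENNReal.coe_ne_top, mul_one]
  obtain ⟨r, hr⟩ : ∃ r : ℝ≥0, (r : ℝ≥0∞) = (K : ℝ≥0∞) ^ p * 2 ^ (p - 1) :=
    ⟨K ^ p * 2 ^ (p - 1), by
      rw [ENNReal.coe_mul, ENNReal.coe_rpow_of_nonneg _ hp0.le,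
        ENNReal.coe_rpow_of_nonneg _ (by linarith)]; rfl⟩
  refine ⟨2 * (a * C₁ + a * r * C₂ + a * r * e * C₃), fun {d D m n} A hAp T M B hB hMf hT hM => ?_⟩
  subst hAp
  set F := ∫⁻ y, ‖A.f y‖ₑ ^ A.p ∂A.σ with hF
  have hFtop : F < ⊤ := A.lintegral_f_rpow_lt_top
  set I := ∫⁻ x, A.Sf x ^ A.p ∂A.w with hI
  have hSfm : Measurable A.Sf := A.cellConst_Sf.measurable
  have hMfm : Measurable A.Mf := A.cellConst_Mf.measurable
  have hItop : I < ⊤ := by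
    calc I ≤ ∫⁻ x, ((Finset.Icc A.lo A.hi).card : ℝ≥0∞) ^ A.p * A.Mf x ^ A.p ∂A.w := by
          refine lintegral_mono fun x => ?_
          rw [← ENNReal.mul_rpow_of_nonneg _ _ hp0.le]
          exact ENNReal.rpow_le_rpow (A.Sf_le_card_mul_Mf x) hp0.le
      _ ≤ ((Finset.Icc A.lo A.hi).card : ℝ≥0∞) ^ A.p * (B * F) := by
          rw [lintegral_const_mul _ (hMfm.pow_const _)]
          gcongr
      _ < ⊤ := ENNReal.mul_lt_top (ENNReal.rpow_lt_top_of_nonneg hp0.le (by simp))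
          (ENNReal.mul_lt_top hB.lt_top hFtop)
  have hterm : ∀ k : ℤ, ((2 : ℝ≥0∞) ^ (k + 1 + 1)) ^ A.p *
      A.w {x | (2 : ℝ≥0∞) ^ (k + 1) < A.Sf x ∧ A.Sf x ≤ 2 ^ (k + 1 + 1)} ≤
      a * (((2 : ℝ≥0∞) ^ (k - 1)) ^ A.p * A.w {x | 2 ^ (k - 1) < (m + n + 3) * A.Mf x}) +
      (b * (K : ℝ≥0∞)⁻¹ * (((2 : ℝ≥0∞) ^ k) ^ A.p * A.w {x | 2 ^ k < A.Sf x}) +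
      (a * r * T ^ A.p * (∫⁻ y, ‖A.testPart k y‖ₑ ^ A.p ∂A.σ) +
        a * r * e * ∫⁻ x, (A.E k).indicator
          (fun x => A.af (A.gen k x) x ^ A.p * A.adjAvg k x ^ A.p) x ∂A.w)) := by
    intro k
    -- The constants a = 8^p and b = 4^p measure the upper end 2^(k+2) of the level against 2^(k-1),
    -- the scale of the local estimate, and against 2^k, the threshold of Ω_k.
    have e1 : ((2 : ℝ≥0∞) ^ (k + 1 + 1)) ^ A.p = a * ((2 : ℝ≥0∞) ^ (k - 1)) ^ A.p := by
      rw [ha, ← ENNReal.mul_rpow_of_nonneg _ _ hp0.le, show k + 1 + 1 = 3 + (k - 1) by ring,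
        two_zpow_add]
      norm_num
    have e2 : ((2 : ℝ≥0∞) ^ (k + 1 + 1)) ^ A.p = b * ((2 : ℝ≥0∞) ^ k) ^ A.p := by
      rw [hb, ← ENNReal.mul_rpow_of_nonneg _ _ hp0.le, show k + 1 + 1 = 2 + k by ring,
        two_zpow_add]
      norm_num
    refine (mul_le_mul_right (A.measure_level_le hK0 ENNReal.coe_ne_top k) _).trans ?_
    rw [mul_add, mul_add]
    refine add_le_add (le_of_eq (by rw [e1]; ring)) (add_le_add (le_of_eq ?_) ?_)
    · rw [e2, Ω]; ring
    · rw [e1, mul_assoc]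
      refine (mul_le_mul_right (A.two_zpow_rpow_mul_measure_largeSet_le hT hK1 k) _).trans
        (le_of_eq ?_)
      rw [← mul_assoc ((K : ℝ≥0∞) ^ A.p), ← hr, he]
      ring
  have hsum : I ≤ a * (C₁ * ((m + n + 3) ^ A.p * (B * F))) + (b * (K : ℝ≥0∞)⁻¹ * (C₁ * I) +
      (a * r * T ^ A.p * (C₂ * F) + a * r * e * (C₃ * (M * F)))) := by
    refine (lintegral_rpow_le_tsum hp0 A.w hSfm fun x =>
      (GenHaarShift.finMax_lt_top _ _ _ _ x).ne).trans ?_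
    rw [← (Equiv.addRight (1 : ℤ)).tsum_eq]
    simp only [Equiv.coe_addRight]
    refine (ENNReal.tsum_le_tsum hterm).trans ?_
    rw [ENNReal.tsum_add, ENNReal.tsum_add, ENNReal.tsum_add, ENNReal.tsum_mul_left,
      ENNReal.tsum_mul_left, ENNReal.tsum_mul_left, ENNReal.tsum_mul_left]
    refine add_le_add (mul_le_mul_right ?_ _) (add_le_add (mul_le_mul_right (hC₁ A.w _ hSfm) _)
      (add_le_add (mul_le_mul_right ?_ _) (mul_le_mul_right (hC₃ A rfl hM) _)))
    · have h1 := (Equiv.subRight (1 : ℤ)).tsum_eq fun k : ℤ => ((2 : ℝ≥0∞) ^ k) ^ A.p *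
        A.w {x | 2 ^ k < (m + n + 3) * A.Mf x}
      simp only [Equiv.subRight_apply] at h1
      rw [h1]
      refine (hC₁ A.w _ (hMfm.const_mul _)).trans (mul_le_mul_right ?_ _)
      simp_rw [ENNReal.mul_rpow_of_nonneg _ _ hp0.le]
      rw [lintegral_const_mul _ (hMfm.pow_const _)]
      gcongr
    · rw [ENNReal.tsum_eq_iSup_sum]
      exact iSup_le fun t => hC₂ A rfl t
  set X := a * (C₁ * ((m + n + 3) ^ A.p * (B * F))) +
    (a * r * T ^ A.p * (C₂ * F) + a * r * e * (C₃ * (M * F))) with hX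
  have h1 : I ≤ X + 2⁻¹ * I := by
    refine hsum.trans ?_
    calc _ = X + b * (K : ℝ≥0∞)⁻¹ * C₁ * I := by rw [hX]; ring
      _ ≤ _ := by gcongr
  have h2 : I ≤ 2 * X := by
    have h3 : 2⁻¹ * I + 2⁻¹ * I ≤ X + 2⁻¹ * I := by
      rwa [← add_mul, ENNReal.inv_two_add_inv_two, one_mul]
    -- Absorption: cancelling half of I is legitimate because I is finite.
    have h4 : 2⁻¹ * I ≤ X := ENNReal.le_of_add_le_add_right
      (ENNReal.mul_ne_top (by norm_num) hItop.ne) h3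
    calc I = 2 * (2⁻¹ * I) := by
          rw [← mul_assoc, ENNReal.mul_inv_cancel (by norm_num) (by norm_num), one_mul]
      _ ≤ 2 * X := by gcongr
  refine h2.trans ?_
  have e3 : ((2 * (a * C₁ + a * r * C₂ + a * r * e * C₃) : ℝ≥0) : ℝ≥0∞) =
    2 * (a * C₁ + a * r * C₂ + a * r * e * C₃) := by push_cast; rfl
  rw [e3, mul_assoc]
  refine mul_le_mul_right ?_ _
  set x := (m + n + 3 : ℝ≥0∞) ^ A.p * B
  calc X = a * C₁ * (x * F) + (a * r * C₂ * (T ^ A.p * F) + a * r * e * C₃ * (M * F)) := by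
        rw [hX]; ring
    _ ≤ a * C₁ * ((x + T ^ A.p + M) * F) + (a * r * C₂ * ((x + T ^ A.p + M) * F) +
          a * r * e * C₃ * ((x + T ^ A.p + M) * F)) := by
        gcongr
        · exact le_add_right le_self_add
        · exact le_add_right le_add_self
        · exact le_add_self
    _ = _ := by ring

end ShiftSetup

/-! ### The constants of the statement, and the limit over all scales. -/

section Constants

variable {d : ℕ} {D : DyadicGrid d} {m n : ℕ} (S : GenHaarShift D m n) {p : ℝ}
  {σ w : Measure (Fin d → ℝ)}

theorem eLpNorm_maximalFunction_le (h : maximalConst p σ w ≠ ⊤) {f : (Fin d → ℝ) → ℂ}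
    (hf : MemLp f (ENNReal.ofReal p) σ) : eLpNorm (maximalFunction σ f) (ENNReal.ofReal p) w ≤
      maximalConst p σ w * eLpNorm f (ENNReal.ofReal p) σ :=
  le_sInf_mul h hf.2.ne fun _ hT => hT f hf

theorem lintegral_maxTruncation_le [IsLocallyFiniteMeasure w] (hp : 1 < p)
    (h : S.testingConst p σ w ≠ ⊤) {Q : Cube d} (hQ : Q ∈ D.cubes) {f : (Fin d → ℝ) → ℂ}
    (hf : MemLp f (ENNReal.ofReal p) σ) :
    ∫⁻ x in Q.toSet, S.maxTruncation σ (Q.toSet.indicator f) x ∂w ≤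
      S.testingConst p σ w * eLpNorm f (ENNReal.ofReal p) σ * w Q.toSet ^ (1 - 1 / p) := by
  have hr : 0 ≤ 1 - 1 / p := by
    rw [sub_nonneg, div_le_one (one_pos.trans hp)]; exact hp.le
  rw [mul_assoc]
  refine le_sInf_mul h (ENNReal.mul_ne_top hf.2.ne
    (ENNReal.rpow_ne_top_of_nonneg hr (measure_toSet_lt_top w Q).ne)) fun T hT => ?_
  rw [← mul_assoc]
  exact hT Q hQ f hf

theorem lintegral_iSup_linAdj_le [IsLocallyFiniteMeasure σ] (hp : 1 < p)
    (h : S.nonstandardConst p σ w ≠ ⊤) {s lo hi : ℤ} (c : ScaleChoice D s lo hi)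
    {φ : (Fin d → ℝ) → ℂ} (hφ : Measurable φ) (hφ1 : ∀ x, ‖φ x‖ ≤ 1) {Q₀ : Cube d}
    (hQ₀ : Q₀ ∈ D.cubes) :
    ∫⁻ x in Q₀.toSet, (⨆ (Q : Cube d) (_ : Q ∈ D.cubes) (_ : Q.toSet ⊆ Q₀.toSet)
      (_ : x ∈ Q.toSet), ((w Q.toSet)⁻¹ * ∫⁻ y in Q.toSet,
        ‖S.linAdj c w (Q.toSet.indicator φ) y‖ₑ ∂σ) ^ p) ∂w ≤
      S.nonstandardConst p σ w ^ p * σ Q₀.toSet := by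
  have hp0 : 0 < p := one_pos.trans hp
  have key : (σ Q₀.toSet)⁻¹ * (∫⁻ x in Q₀.toSet, (⨆ (Q : Cube d) (_ : Q ∈ D.cubes)
      (_ : Q.toSet ⊆ Q₀.toSet) (_ : x ∈ Q.toSet), ((w Q.toSet)⁻¹ * ∫⁻ y in Q.toSet,
        ‖S.linAdj c w (Q.toSet.indicator φ) y‖ₑ ∂σ) ^ p) ∂w) ≤ S.nonstandardConst p σ w ^ p := by
    rw [GenHaarShift.nonstandardConst, ← ENNReal.rpow_mul, one_div_mul_cancel hp0.ne',
      ENNReal.rpow_one]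
    refine le_iSup₂_of_le c.toLinearization c.isBounded_toLinearization
      (le_iSup₂_of_le φ hφ (le_iSup₂_of_le hφ1 Q₀ (le_iSup_of_le hQ₀ ?_)))
    simp_rw [S.adjoint_eq_linAdj c w]
    exact le_rfl
  have htop : S.nonstandardConst p σ w ^ p ≠ ⊤ := ENNReal.rpow_ne_top_of_nonneg hp0.le h
  have hσ := (measure_toSet_lt_top σ Q₀).ne
  rw [mul_comm, ← div_eq_mul_inv] at key
  -- If σ(Q₀) = 0, its inverse is ⊤ and finiteness of the constant forces the integral to vanish, so
  -- no separate case is needed.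
  refine (ENNReal.div_le_iff_le_mul (Or.inr htop) (Or.inl hσ)).1 key

theorem maxTruncation_congr {f g : (Fin d → ℝ) → ℂ} (h : f =ᵐ[σ] g) :
    S.maxTruncation σ f = S.maxTruncation σ g := by
  have hint : ∀ Q' R', ∫ y, f y * S.h Q' R' y ∂σ = ∫ y, g y * S.h Q' R' y ∂σ := fun Q' R' =>
    integral_congr_ae (h.mono fun y hy => by simp only [hy])
  funext x
  simp only [GenHaarShift.maxTruncation, GenHaarShift.truncation, GenHaarShift.component, hint]

theorem maxTruncation_zero : S.maxTruncation σ (fun _ => 0) = 0 := by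
  funext x
  simp [GenHaarShift.maxTruncation, GenHaarShift.truncation, GenHaarShift.component]

end Constants

theorem eLpNorm_ofReal_eq {α E : Type*} [MeasurableSpace α] [TopologicalSpace E] [ContinuousENorm E]
    {p : ℝ} (hp : 0 < p) (μ : Measure α) (f : α → E) :
    eLpNorm f (ENNReal.ofReal p) μ = (∫⁻ x, ‖f x‖ₑ ^ p ∂μ) ^ (1 / p) := by
  rw [eLpNorm_eq_lintegral_rpow_enorm_toReal (by simpa using hp) (by simp),
    ENNReal.toReal_ofReal hp.le]

theorem complexity_bound (m n : ℕ) : (m + n + 3 : ℝ≥0∞) ≤ 5 * complexity m n := by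
  have : m + n + 3 ≤ 5 * complexity m n := by unfold complexity; omega
  exact_mod_cast this

/-- The estimate for the truncations between two scales, for finite constants. -/
theorem exists_lintegral_finMax_le (p : ℝ) (hp : 1 < p) : ∃ C : ℝ≥0, ∀ {d : ℕ}, 0 < d →
    ∀ {D : DyadicGrid d} {m n : ℕ} (S : GenHaarShift D m n) {σ w : Measure (Fin d → ℝ)}
      [IsLocallyFiniteMeasure σ] [IsLocallyFiniteMeasure w],
    maximalConst p σ w ≠ ⊤ → S.testingConst p σ w ≠ ⊤ → S.nonstandardConst p σ w ≠ ⊤ →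
    ∀ {f : (Fin d → ℝ) → ℂ}, Measurable f → MemLp f (ENNReal.ofReal p) σ →
    ∀ {lo hi : ℤ}, lo ≤ hi →
    ∫⁻ x, S.finMax σ f lo hi x ^ p ∂w ≤ C * (complexity m n * maximalConst p σ w +
      S.testingConst p σ w + S.nonstandardConst p σ w) ^ p * ∫⁻ y, ‖f y‖ₑ ^ p ∂σ := by
  obtain ⟨C, hC⟩ := ShiftSetup.exists_lintegral_Sf_le p hp
  have hp0 : 0 < p := one_pos.trans hp
  refine ⟨C * (5 ^ p + 2), fun {d} hd {D m n} S {σ w} _ _ hM hT hN {f} hfm hf {lo hi} h => ?_⟩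
  obtain ⟨c, hc⟩ := S.exists_scaleChoice σ f h
  let A : ShiftSetup D m n := ⟨S, σ, w, inferInstance, inferInstance, hd, p, hp, f, hfm, hf, lo,
    hi, h, c, hc⟩
  set F := ∫⁻ y, ‖f y‖ₑ ^ p ∂σ
  have hMf : ∫⁻ x, A.Mf x ^ A.p ∂A.w ≤ maximalConst p σ w ^ p * F := by
    have h1 := ENNReal.rpow_le_rpow (eLpNorm_maximalFunction_le hM hf) hp0.le
    rw [ENNReal.mul_rpow_of_nonneg _ _ hp0.le, eLpNorm_ofReal_eq hp0, eLpNorm_ofReal_eq hp0,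
      ← ENNReal.rpow_mul, ← ENNReal.rpow_mul, one_div_mul_cancel hp0.ne', ENNReal.rpow_one,
      ENNReal.rpow_one] at h1
    exact (lintegral_mono fun x =>
      ENNReal.rpow_le_rpow (dyadicMax_le_maximalFunction f _ _ x) hp0.le).trans h1
  have key := hC A rfl (ENNReal.rpow_ne_top_of_nonneg hp0.le hM) hMf
    (fun Q hQ g hg => lintegral_maxTruncation_le S hp hT hQ hg)
    (fun φ hφ hφ1 Q₀ hQ₀ => lintegral_iSup_linAdj_le S hp hN c hφ hφ1 hQ₀)
  change ∫⁻ x, S.finMax σ f lo hi x ^ p ∂w ≤ C * (((m + n + 3) ^ p * maximalConst p σ w ^ p +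
    S.testingConst p σ w ^ p + S.nonstandardConst p σ w ^ p) * F) at key
  refine key.trans ?_
  set W := complexity m n * maximalConst p σ w + S.testingConst p σ w + S.nonstandardConst p σ w
  have h1 : (m + n + 3 : ℝ≥0∞) ^ p * maximalConst p σ w ^ p ≤ 5 ^ p * W ^ p := by
    rw [← ENNReal.mul_rpow_of_nonneg _ _ hp0.le, ← ENNReal.mul_rpow_of_nonneg _ _ hp0.le]
    refine ENNReal.rpow_le_rpow ((mul_le_mul_left (complexity_bound m n) _).trans ?_) hp0.le
    rw [mul_assoc]
    exact mul_le_mul_right (le_add_right le_self_add) _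
  have h2 : S.testingConst p σ w ^ p ≤ W ^ p :=
    ENNReal.rpow_le_rpow (le_add_right le_add_self) hp0.le
  have h3 : S.nonstandardConst p σ w ^ p ≤ W ^ p := ENNReal.rpow_le_rpow le_add_self hp0.le
  calc _ ≤ (C : ℝ≥0∞) * ((5 ^ p * W ^ p + W ^ p + W ^ p) * F) := by gcongr
    _ = _ := by
      push_cast
      rw [ENNReal.coe_rpow_of_nonneg _ hp0.le]
      push_cast
      ring

theorem eLpNorm_maxTruncation_le (p : ℝ) (hp : 1 < p) : ∃ C : ℝ≥0, ∀ {d : ℕ}, 0 < d →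
    ∀ {D : DyadicGrid d} {m n : ℕ} (S : GenHaarShift D m n) {σ w : Measure (Fin d → ℝ)}
      [IsLocallyFiniteMeasure σ] [IsLocallyFiniteMeasure w],
    maximalConst p σ w ≠ ⊤ → S.testingConst p σ w ≠ ⊤ → S.nonstandardConst p σ w ≠ ⊤ →
    ∀ {f : (Fin d → ℝ) → ℂ}, Measurable f → MemLp f (ENNReal.ofReal p) σ →
    eLpNorm (S.maxTruncation σ f) (ENNReal.ofReal p) w ≤ C * (complexity m n * maximalConst p σ w +
      S.testingConst p σ w + S.nonstandardConst p σ w) * eLpNorm f (ENNReal.ofReal p) σ := by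
  obtain ⟨C, hC⟩ := exists_lintegral_finMax_le p hp
  have hp0 : 0 < p := one_pos.trans hp
  refine ⟨C ^ (1 / p), fun {d} hd {D m n} S {σ w} _ _ hM hT hN {f} hfm hf => ?_⟩
  have hloc : ∀ k x, IntegrableOn f (D.cell k x) σ := fun k x => by
    have : IsFiniteMeasure (σ.restrict (D.cell k x)) :=
      ⟨by rw [Measure.restrict_apply_univ]; exact D.measure_cell_lt_top σ k x⟩
    exact (hf.restrict _).integrable (by
      rw [← ENNReal.ofReal_one]; exact ENNReal.ofReal_le_ofReal hp.le)
  have hsup : ∀ x, S.maxTruncation σ f x ^ p =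
      ⨆ K : ℕ, S.finMax σ f (-K) K x ^ p := fun x => by
    rw [GenHaarShift.maxTruncation_eq_iSup hloc]
    exact (ENNReal.orderIsoRpow p hp0).map_iSup _
  have hint : ∫⁻ x, S.maxTruncation σ f x ^ p ∂w ≤ C * (complexity m n * maximalConst p σ w +
      S.testingConst p σ w + S.nonstandardConst p σ w) ^ p * ∫⁻ y, ‖f y‖ₑ ^ p ∂σ := by
    simp_rw [hsup]
    rw [lintegral_iSup
      (fun K => (GenHaarShift.cellConst_finMax σ f _ _).measurable.pow_const p)
      fun K L hKL x => ENNReal.rpow_le_rpow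
        (GenHaarShift.finMax_mono (by omega) (by omega) x) hp0.le]
    exact iSup_le fun K => hC hd S hM hT hN hfm hf (by omega)
  rw [eLpNorm_ofReal_eq hp0, eLpNorm_ofReal_eq hp0]
  simp only [enorm_eq_self]
  refine (ENNReal.rpow_le_rpow hint (by positivity)).trans (le_of_eq ?_)
  rw [ENNReal.mul_rpow_of_nonneg _ _ (by positivity), ENNReal.mul_rpow_of_nonneg _ _
      (by positivity),
    ← ENNReal.rpow_mul, mul_one_div_cancel hp0.ne', ENNReal.rpow_one,
    ENNReal.coe_rpow_of_nonneg _ (by positivity)]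

end TwoWeight
end

theorem theorem4p3 (d : ℕ) (hd : 0 < d) (p : ℝ) (hp : 1 < p) :
    ∃ C : ℝ≥0, ∀ (D : TwoWeight.DyadicGrid d) (m n : ℕ) (S : TwoWeight.GenHaarShift D m n)
      (σ w : Measure (Fin d → ℝ)), IsLocallyFiniteMeasure σ → IsLocallyFiniteMeasure w →
      ∀ f : (Fin d → ℝ) → ℂ, MemLp f (ENNReal.ofReal p) σ →
        eLpNorm (S.maxTruncation σ f) (ENNReal.ofReal p) w ≤
          (C : ℝ≥0∞) *
            ((TwoWeight.complexity m n : ℝ≥0∞) * TwoWeight.maximalConst p σ w +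
              S.testingConst p σ w + S.nonstandardConst p σ w) *
            eLpNorm f (ENNReal.ofReal p) σ := by
  obtain ⟨C, hC⟩ := TwoWeight.eLpNorm_maxTruncation_le p hp
  have hp0 : ENNReal.ofReal p ≠ 0 := by simpa using one_pos.trans hp
  -- The added 1 keeps the factor nonzero, so that the right side is ⊤ when a constant is infinite
  -- and f does not vanish almost everywhere.
  refine ⟨C + 1, fun D m n S σ w hσ hw f hf => ?_⟩
  set W := (TwoWeight.complexity m n : ℝ≥0∞) * TwoWeight.maximalConst p σ w +
    S.testingConst p σ w + S.nonstandardConst p σ w with hW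
  by_cases htop : W = ⊤
  · rcases eq_or_ne (eLpNorm f (ENNReal.ofReal p) σ) 0 with h0 | h0
    · have hf0 : f =ᵐ[σ] fun _ => 0 := (eLpNorm_eq_zero_iff hf.1 hp0).1 h0
      rw [TwoWeight.maxTruncation_congr S hf0, TwoWeight.maxTruncation_zero, eLpNorm_zero]
      exact zero_le
    · rw [htop, ENNReal.mul_top (by simp), ENNReal.top_mul h0]
      exact le_top
  · have hκ : (TwoWeight.complexity m n : ℝ≥0∞) ≠ 0 := by
      simp [TwoWeight.complexity]
    simp only [hW, ENNReal.add_eq_top, not_or] at htop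
    have hM : TwoWeight.maximalConst p σ w ≠ ⊤ := fun h => htop.1.1 (by
      rw [h, ENNReal.mul_top hκ])
    -- The shift sees f only through integrals against σ, so a measurable representative may be
    -- used.
    obtain ⟨g, hg, hfg⟩ := hf.1
    rw [TwoWeight.maxTruncation_congr S hfg, eLpNorm_congr_ae hfg]
    refine (hC hd S hM htop.1.2 htop.2 hg.measurable
      (hf.ae_eq hfg)).trans ?_
    gcongr
    exact le_self_add
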